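/- Work over the field $\mathbb F_2$. All complexes are cochain complexes, and all signs are trivial. **The Lie superalgebras.** $\mathfrak{sl}_2(\wedge)$ has a basis $e,f,h$ in degree $0$ and $v_2,v_{-2},v_0$ in degree $1$. Its brackets are the reductions modulo $2$ of $[e,f]=h$, $[h,e]=2e$, $[h,f]=-2f$, $[e,v_2]=0$, $[e,v_0]=-2v_2$, $[e,v_{-2}]=v_0=-[f,v_2]$, $[f,v_0]=2v_{-2}$, $[f,v_{-2}]=0$, $[h,v_2]=2v_2$, $[h,v_0]=0$, $[h,v_{-2}]=-2v_{-2}$, $[v_i,v_j]=0$. The Lie superalgebra $\mathfrak{sl}_2(\wedge)_{dg}$ has a basis $e,f,h$ in degree $0$, $v_2,v_{-2},\tilde v_0,d,D$ in degree $1$, and $x$ in degree $2$. The brackets of $e,f,h$ with each other and with $v_2,v_{-2},\tilde v_0$ are as above, and moreover $[v_2,v_{-2}]=x=-[d,D]$ and $[\tilde v_0,\tilde v_0]=2x$ (again reduced modulo $2$), all other brackets of basis elements being zero. Its differential is $[d,\cdot]$. Write $H=\mathfrak{sl}_2(\wedge)\oplus\mathbb F_2 d$, with zero differential, for its homology. **The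 complex.** Let $P$ be an oriented diagram of an annular link $L\subset A\times I$. The space $\mathrm{CKh}(L)$ has as a basis the resolutions of $P$ whose circles are labelled $+$ or $-$; its homological degree is the number of $1$-smoothings minus the number of negative crossings, and its $k$-degree is the number of nontrivial circles labelled $+$ minus the number of nontrivial circles labelled $-$ (a circle is nontrivial if it separates the two boundary components of $A$). Let $\partial=\partial_0+\partial_-$ be the decomposition of Khovanov's differential into its $k$-preserving and $k$-decreasing parts, and let $\partial^{Lee}=\partial^{Lee}_0+\partial^{Lee}_+$ be the decomposition into the $k$-preserving and $k$-increasing parts of Lee's map, the sum of edge maps given by $-\otimes-\mapsto +$ for a merge and $-\mapsto +\otimes+$ for a split (all other labels being sent to $0$). Let $e,f,h$ act on $\mathrm{CKh}(L)$ through the tensor product of the defining representations of $\mathfrak{sl}_2$ on the nontrivial circles and the trivial representations on the trivial circles, let $v_2,v_{-2},d,D$ act by $\partial_+^{Lee},\partial_-,\partial_0,\partial_0^{Lee}$, and let $\tilde v_0=[e,v_{-2}]$ and $x=[v_2,v_{-2}]$ act by the corresponding supercommutators. **Theorem.** 1. $\mathfrak{sl}_2(\wedge)_{dg}$, with its differential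 and bracket, is an $L_\infty$-algebra. With $k_1=\partial_0$, $k_2$ the action above, and $k_n=0$ for $n\ge 3$, $\mathrm{CKh}(L)$ is an $L_\infty$-module over it. 2. The lift $i$ of $H$ into $\mathfrak{sl}_2(\wedge)_{dg}$, the projection $q$ onto $H$ with $q(D)=q(x)=0$, and the homotopy $K$ with $K(x)=-D$ and $K=0$ on the other basis elements form a cochain contraction of $\mathfrak{sl}_2(\wedge)_{dg}$ onto $H$. On $\mathfrak{sl}_2(\wedge)\subset H$ the operations transferred along it are the bracket and no others, and they make $\mathfrak{sl}_2(\wedge)$ an $L_\infty$-algebra. The transfer maps $I_n$, restricted to $\mathfrak{sl}_2(\wedge)$, form an $L_\infty$-algebra homomorphism $I:\mathfrak{sl}_2(\wedge)\to\mathfrak{sl}_2(\wedge)_{dg}$. 3. The operations $k'_n$ on $\mathrm{CKh}(L)$ obtained from those in 1 by restriction of scalars along $I$ make $\mathrm{CKh}(L)$ an $L_\infty$-module over the $L_\infty$-algebra $\mathfrak{sl}_2(\wedge)$. 4. $k'_3(v_2,v_{-2},m)=\partial_0^{Lee}(m)$ for all $m\in\mathrm{CKh}(L)$. In particular, if $\partial_0^{Lee}\neq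 0$, then the $L_\infty$-module structure is nontrivial: $k'_n\ne 0$ for some $n\ge 3$. -/

import Mathlib

/-! ### `L∞`-algebras and modules overer the field with two elements

Every sign is `1` in characteristic two, so skew-symmetric maps are symmetric maps. The cochain
convention is used. An `(i, n - i)`-unshuffle `σ` is determined by the set `S = {σ 1, …, σ i}`, and
sums over unshuffles are written as sums over such subsets `S`. -/

namespace LInf

/-- The subfamily of `x` indexed by `S`, in increasing order. -/
def sub {n : ℕ} {V : Type*} (x : Fin n → V) (S : Finset (Fin n)) : Fin S.card → V :=
  fun a => x (S.orderEmbOfFin rfl a)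

/-- The set partitions of `{1, …, n}` into `r` nonempty blocks, each written once: the blocks
`c ⁻¹ {a}` are numbered so that their least elements increase. -/
def setPartitions (n r : ℕ) : Finset (Fin n → Fin r) :=
  {c | Function.Surjective c ∧ ∀ a b : Fin r, a < b → ∃ i, c i = a ∧ ∀ j, c j = b → i < j}

/-- A block of a set partition. -/
def block {n r : ℕ} (c : Fin n → Fin r) (a : Fin r) : Finset (Fin n) := {i | c i = a}

variable {V V' L M : Type*}
  [AddCommGroup V] [Module (ZMod 2) V] [AddCommGroup V'] [Module (ZMod 2) V']
  [AddCommGroup L] [Module (ZMod 2) L] [AddCommGroup M] [Module (ZMod 2) M]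

/-- The maps `l n = l_n : V^{⊗ n} → V`, `n ≥ 1`, form an `L∞`-algebra structure on the graded vector
space `V = ⨁ 𝒱 i`. -/
structure IsAlgebra (𝒱 : ℤ → Submodule (ZMod 2) V) (l : ∀ n : ℕ, (Fin n → V) → V) : Prop where
  graded : DirectSum.IsInternal 𝒱
  zero : ∀ x, l 0 x = 0
  multilinear : ∀ n, ∃ g : MultilinearMap (ZMod 2) (fun _ : Fin n => V) V, ∀ x, g x = l n x
  symmetric : ∀ n (σ : Equiv.Perm (Fin n)) x, l n (x ∘ σ) = l n x
  degree : ∀ n (x : Fin n → V) (a : Fin n → ℤ), (∀ s, x s ∈ 𝒱 (a s)) →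
    l n x ∈ 𝒱 ((∑ s, a s) + 2 - n)
  jacobi : ∀ n (x : Fin n → V),
    ∑ S : Finset (Fin n) with S.Nonempty,
      l (Sᶜ.card + 1) (Fin.cons (l S.card (sub x S)) (sub x Sᶜ)) = 0

/-- The maps `f n = f_n : V^{⊗ n} → V'`, `n ≥ 1`, form an `L∞`-algebra homomorphism from `(V, l)` to
`(V', l')`. -/
structure IsHom (𝒱 : ℤ → Submodule (ZMod 2) V) (l : ∀ n : ℕ, (Fin n → V) → V)
    (𝒱' : ℤ → Submodule (ZMod 2) V') (l' : ∀ n : ℕ, (Fin n → V') → V')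
    (f : ∀ n : ℕ, (Fin n → V) → V') : Prop where
  zero : ∀ x, f 0 x = 0
  multilinear : ∀ n, ∃ g : MultilinearMap (ZMod 2) (fun _ : Fin n => V) V', ∀ x, g x = f n x
  symmetric : ∀ n (σ : Equiv.Perm (Fin n)) x, f n (x ∘ σ) = f n x
  degree : ∀ n (x : Fin n → V) (a : Fin n → ℤ), (∀ s, x s ∈ 𝒱 (a s)) →
    f n x ∈ 𝒱' ((∑ s, a s) + 1 - n)
  relation : ∀ n (x : Fin n → V),
    ∑ S : Finset (Fin n) with S.Nonempty,
      f (Sᶜ.card + 1) (Fin.cons (l S.card (sub x S)) (sub x Sᶜ)) +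
    ∑ r ∈ Finset.range (n + 1), ∑ c ∈ setPartitions n r,
      l' r (fun a => f (block c a).card (sub x (block c a))) = 0

/-- The maps `k n = k_{n+1} : L^{⊗ n} ⊗ M → M`, `n ≥ 0`, form an `L∞`-module structure on the graded
vector space `M = ⨁ ℳ i` over the `L∞`-algebra `(L, l)`. The index `n` counts the inputs from
`L`. -/
structure IsModule (ℒ : ℤ → Submodule (ZMod 2) L) (l : ∀ n : ℕ, (Fin n → L) → L)
    (ℳ : ℤ → Submodule (ZMod 2) M) (k : ∀ n : ℕ, (Fin n → L) → M → M) : Prop where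
  graded : DirectSum.IsInternal ℳ
  multilinear : ∀ n, ∃ g : MultilinearMap (ZMod 2) (fun _ : Fin n => L) (M →ₗ[ZMod 2] M),
    ∀ x m, g x m = k n x m
  symmetric : ∀ n (σ : Equiv.Perm (Fin n)) x m, k n (x ∘ σ) m = k n x m
  degree : ∀ n (x : Fin n → L) (a : Fin n → ℤ) (m : M) (b : ℤ), (∀ s, x s ∈ ℒ (a s)) → m ∈ ℳ b →
    k n x m ∈ ℳ ((∑ s, a s) + b + 1 - n)
  relation : ∀ n (x : Fin n → L) (m : M),
    ∑ S : Finset (Fin n) with S.Nonempty,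
      k (Sᶜ.card + 1) (Fin.cons (l S.card (sub x S)) (sub x Sᶜ)) m +
    ∑ S : Finset (Fin n), k Sᶜ.card (sub x Sᶜ) (k S.card (sub x S) m) = 0

/-- A cochain contraction of `(V, dV)` onto `(V', dV')`. -/
structure IsContraction (𝒱 : ℤ → Submodule (ZMod 2) V) (dV : V →ₗ[ZMod 2] V)
    (𝒱' : ℤ → Submodule (ZMod 2) V') (dV' : V' →ₗ[ZMod 2] V')
    (i : V' →ₗ[ZMod 2] V) (q : V →ₗ[ZMod 2] V') (K : V →ₗ[ZMod 2] V) : Prop where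
  chain_i : dV ∘ₗ i = i ∘ₗ dV'
  chain_q : dV' ∘ₗ q = q ∘ₗ dV
  degree_i : ∀ a, ∀ y ∈ 𝒱' a, i y ∈ 𝒱 a
  degree_q : ∀ a, ∀ y ∈ 𝒱 a, q y ∈ 𝒱' a
  degree_K : ∀ a, ∀ y ∈ 𝒱 a, K y ∈ 𝒱 (a - 1)
  q_i : q ∘ₗ i = LinearMap.id
  homotopy : LinearMap.id - i ∘ₗ q = K ∘ₗ dV + dV ∘ₗ K
  K_K : K ∘ₗ K = 0
  K_i : K ∘ₗ i = 0
  q_K : q ∘ₗ K = 0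

/-- The maps `I_n` extending `i` in the transfer of an `L∞`-algebra structure along a contraction:
`I_1 = i` (`= -i`), and for `n ≥ 2`, `I_n = K ∘ θ_n` where `θ_n` is the sum of
`l_r (I_{i_1} ⊗ ⋯ ⊗ I_{i_r})` over the set partitions into `r ≥ 2` blocks. The test
`(block c a).card < n` always succeeds, since there are at least two blocks. -/
def transferI (l : ∀ n : ℕ, (Fin n → V) → V) (i : V' →ₗ[ZMod 2] V) (K : V →ₗ[ZMod 2] V) :
    (n : ℕ) → (Fin n → V') → V
  | 0, _ => 0
  | 1, x => i (x 0)
  | n + 2, x => K (∑ r ∈ Finset.Icc 2 (n + 2), ∑ c ∈ setPartitions (n + 2) r,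
      l r (fun a => if _h : (block c a).card < n + 2 then
        transferI l i K (block c a).card (sub x (block c a)) else 0))
  termination_by n => n

/-- The map `θ_n : V'^{⊗ n} → V` for `n ≥ 2`. -/
def transferTheta (l : ∀ n : ℕ, (Fin n → V) → V) (i : V' →ₗ[ZMod 2] V) (K : V →ₗ[ZMod 2] V)
    (n : ℕ) (x : Fin n → V') : V :=
  ∑ r ∈ Finset.Icc 2 n, ∑ c ∈ setPartitions n r,
    l r (fun a => transferI l i K (block c a).card (sub x (block c a)))

/-- The transferred operations: `l'_1 = dV'`, and `l'_n = q ∘ θ_n` for `n ≥ 2`. -/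
def transferOps (l : ∀ n : ℕ, (Fin n → V) → V) (dV' : V' →ₗ[ZMod 2] V') (i : V' →ₗ[ZMod 2] V)
    (q : V →ₗ[ZMod 2] V') (K : V →ₗ[ZMod 2] V) : (n : ℕ) → (Fin n → V') → V'
  | 0, _ => 0
  | 1, x => dV' (x 0)
  | n + 2, x => q (transferTheta l i K (n + 2) x)

/-- Restriction of scalars of the module operations `k` along `I : V → L`. -/
def restrictScalars (I : ∀ n : ℕ, (Fin n → V) → L) (k : ∀ n : ℕ, (Fin n → L) → M → M)
    (n : ℕ) (x : Fin n → V) (m : M) : M :=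
  ∑ r ∈ Finset.range (n + 1), ∑ c ∈ setPartitions n r,
    k r (fun a => I (block c a).card (sub x (block c a))) m

end LInf

/-! ### The Lie superalgebras -/

noncomputable section

/-- The basis of the exterior current algebra `sl₂(∧)`; `v2, vm2, v0` are `v_2, v_{-2}, v_0`. -/
inductive WedgeBasis
  | e | f | h | v2 | vm2 | v0
  deriving DecidableEq

/-- The basis `e, f, h, v_2, v_{-2}, ṽ_0, d, D, x` of `sl₂(∧)_dg`. -/
inductive DgBasis
  | e | f | h | v2 | vm2 | v0 | d | D | x
  deriving DecidableEq

/-- The basis `e, f, h, v_2, v_{-2}, ṽ_0, d` of the homology of `(sl₂(∧)_dg, [d, ·])`. -/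
inductive HBasis
  | wedge (b : WedgeBasis)
  | d
  deriving DecidableEq

/-- The exterior current algebra `sl₂(∧)` over the field with two elements. -/
abbrev SlWedge := WedgeBasis →₀ ZMod 2

/-- The Lie superalgebra `sl₂(∧)_dg` over the field with two elements. -/
abbrev SlDg := DgBasis →₀ ZMod 2

/-- The homology of `(sl₂(∧)_dg, [d, ·])`. -/
abbrev SlH := HBasis →₀ ZMod 2

/-- The graded pieces of the free module on a set whose elements have a degree. -/
def gradedPiece {B : Type*} (deg : B → ℤ) (n : ℤ) : Submodule (ZMod 2) (B →₀ ZMod 2) :=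
  Finsupp.supported (ZMod 2) (ZMod 2) {b | deg b = n}

/-- The bilinear map given on a basis by a table. -/
def bilinearOfTable {B : Type*} (T : B → B → (B →₀ ZMod 2)) :
    (B →₀ ZMod 2) →ₗ[ZMod 2] (B →₀ ZMod 2) →ₗ[ZMod 2] (B →₀ ZMod 2) :=
  Finsupp.linearCombination (ZMod 2) (fun b => Finsupp.linearCombination (ZMod 2) (T b))

def WedgeBasis.deg : WedgeBasis → ℤ
  | .e | .f | .h => 0
  | .v2 | .vm2 | .v0 => 1

def DgBasis.deg : DgBasis → ℤ
  | .e | .f | .h => 0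
  | .v2 | .vm2 | .v0 | .d | .D => 1
  | .x => 2

def HBasis.deg : HBasis → ℤ
  | .wedge b => b.deg
  | .d => 1

/-- The brackets of `sl₂(∧)`, with the coefficients that they have over the integers. -/
def WedgeBasis.table : WedgeBasis → WedgeBasis → SlWedge
  | .e, .f => .single .h 1          | .f, .e => .single .h (-1)
  | .h, .e => .single .e 2          | .e, .h => .single .e (-2)
  | .h, .f => .single .f (-2)       | .f, .h => .single .f 2
  | .e, .v0 => .single .v2 (-2)     | .v0, .e => .single .v2 2
  | .e, .vm2 => .single .v0 1       | .vm2, .e => .single .v0 (-1)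
  | .f, .v2 => .single .v0 (-1)     | .v2, .f => .single .v0 1
  | .f, .v0 => .single .vm2 2       | .v0, .f => .single .vm2 (-2)
  | .h, .v2 => .single .v2 2        | .v2, .h => .single .v2 (-2)
  | .h, .vm2 => .single .vm2 (-2)   | .vm2, .h => .single .vm2 2
  | _, _ => 0

/-- The brackets of `sl₂(∧)_dg`, with the coefficients that they have over the integers. -/
def DgBasis.table : DgBasis → DgBasis → SlDg
  | .e, .f => .single .h 1          | .f, .e => .single .h (-1)
  | .h, .e => .single .e 2          | .e, .h => .single .e (-2)
  | .h, .f => .single .f (-2)       | .f, .h => .single .f 2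
  | .e, .v0 => .single .v2 (-2)     | .v0, .e => .single .v2 2
  | .e, .vm2 => .single .v0 1       | .vm2, .e => .single .v0 (-1)
  | .f, .v2 => .single .v0 (-1)     | .v2, .f => .single .v0 1
  | .f, .v0 => .single .vm2 2       | .v0, .f => .single .vm2 (-2)
  | .h, .v2 => .single .v2 2        | .v2, .h => .single .v2 (-2)
  | .h, .vm2 => .single .vm2 (-2)   | .vm2, .h => .single .vm2 2
  | .v2, .vm2 => .single .x 1       | .vm2, .v2 => .single .x 1
  | .d, .D => .single .x (-1)       | .D, .d => .single .x (-1)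
  | .v0, .v0 => .single .x 2
  | _, _ => 0

namespace SlWedge

def grading : ℤ → Submodule (ZMod 2) SlWedge := gradedPiece WedgeBasis.deg

def bracket : SlWedge →ₗ[ZMod 2] SlWedge →ₗ[ZMod 2] SlWedge := bilinearOfTable WedgeBasis.table

/-- The `L∞`-operations of `sl₂(∧)`: `l_2` is the bracket, and all others vanish. -/
def ops : (n : ℕ) → (Fin n → SlWedge) → SlWedge
  | 2, y => bracket (y 0) (y 1)
  | _, _ => 0

/-- The inclusion `sl₂(∧) → H(sl₂(∧)_dg) = sl₂(∧) ⊕ ⟨d⟩`. -/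
def toH : SlWedge →ₗ[ZMod 2] SlH := Finsupp.lmapDomain (ZMod 2) (ZMod 2) HBasis.wedge

end SlWedge

namespace SlH

def grading : ℤ → Submodule (ZMod 2) SlH := gradedPiece HBasis.deg

end SlH

namespace SlDg

def grading : ℤ → Submodule (ZMod 2) SlDg := gradedPiece DgBasis.deg

def bracket : SlDg →ₗ[ZMod 2] SlDg →ₗ[ZMod 2] SlDg := bilinearOfTable DgBasis.table

/-- The differential `[d, ·]`. -/
def diff : SlDg →ₗ[ZMod 2] SlDg := bracket (.single .d 1)

/-- The `L∞`-operations of `sl₂(∧)_dg`: the differential, the bracket, and no higher ones. -/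
def ops : (n : ℕ) → (Fin n → SlDg) → SlDg
  | 1, y => diff (y 0)
  | 2, y => bracket (y 0) (y 1)
  | _, _ => 0

/-- The lift `i` of the homology into `sl₂(∧)_dg`. -/
def incl : SlH →ₗ[ZMod 2] SlDg := Finsupp.lmapDomain (ZMod 2) (ZMod 2) fun
  | .wedge .e => .e
  | .wedge .f => .f
  | .wedge .h => .h
  | .wedge .v2 => .v2
  | .wedge .vm2 => .vm2
  | .wedge .v0 => .v0
  | .d => .d

/-- The projection `q` onto the homology. -/
def proj : SlDg →ₗ[ZMod 2] SlH := Finsupp.linearCombination (ZMod 2) fun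
  | .e => .single (.wedge .e) 1
  | .f => .single (.wedge .f) 1
  | .h => .single (.wedge .h) 1
  | .v2 => .single (.wedge .v2) 1
  | .vm2 => .single (.wedge .vm2) 1
  | .v0 => .single (.wedge .v0) 1
  | .d => .single .d 1
  | .D => 0
  | .x => 0

/-- The homotopy `K`, with `K x = -D`. -/
def homotopy : SlDg →ₗ[ZMod 2] SlDg := Finsupp.linearCombination (ZMod 2) fun
  | .x => .single .D (-1)
  | _ => 0

/-- The transferred operations on the homology of `sl₂(∧)_dg`. -/
def homologyOps : (n : ℕ) → (Fin n → SlH) → SlH := LInf.transferOps ops 0 incl proj homotopy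

/-- The maps `I_n : H(sl₂(∧)_dg)^{⊗ n} → sl₂(∧)_dg` of the transfer. -/
def homologyI : (n : ℕ) → (Fin n → SlH) → SlDg := LInf.transferI ops incl homotopy

end SlDg

/-! ### Annular link diagrams

A diagram in the annulus is cut by rays into finitely many sectors, each of which holds at most one
crossing or critical point of the angular coordinate (up to isotopy of the annulus this is every
diagram). In a sector, read counterclockwise, strands run from the bottom ray to the top ray, and
positions `0, 1, 2, …` on a ray are counted outwards. -/

/-- What a sector may contain, at the positions `i` and `i + 1`. -/
inductive Piece
  /-- parallel strands only -/
  | straight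
  /-- a new arc whose two ends are at the top -/
  | cup (i : ℕ)
  /-- an arc whose two ends are at the bottom -/
  | cap (i : ℕ)
  /-- a cap followed by a cup -/
  | hook (i : ℕ)
  /-- a crossing; `ov` says that the strand from bottom left to top right is the upper one -/
  | cross (i : ℕ) (ov : Bool)

namespace Piece

/-- The piece fits between `w` strands at the bottom and `w'` strands at the top. -/
def Fits : Piece → ℕ → ℕ → Prop
  | straight, w, w' => w' = w
  | cup i, w, w' => i ≤ w ∧ w' = w + 2
  | cap i, w, w' => i + 2 ≤ w ∧ w = w' + 2
  | hook i, w, w' => i + 2 ≤ w ∧ w' = w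
  | cross i _, w, w' => i + 2 ≤ w ∧ w' = w

/-- A strand runs from the bottom position `a` to the top position `b`. -/
def Through : Piece → ℕ → ℕ → Prop
  | straight, a, b => b = a
  | cup i, a, b => (a < i ∧ b = a) ∨ (i ≤ a ∧ b = a + 2)
  | cap i, a, b => (a < i ∧ b = a) ∨ (i + 2 ≤ a ∧ a = b + 2)
  | hook i, a, b => (a < i ∨ i + 2 ≤ a) ∧ b = a
  | cross i _, a, b => ((a < i ∨ i + 2 ≤ a) ∧ b = a) ∨ (a = i ∧ b = i + 1) ∨ (a = i + 1 ∧ b = i)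

/-- An arc joins the bottom positions `a` and `b`. -/
def BottomTurn : Piece → ℕ → ℕ → Prop
  | cap i, a, b => a = i ∧ b = i + 1
  | hook i, a, b => a = i ∧ b = i + 1
  | _, _, _ => False

/-- An arc joins the top positions `a` and `b`. -/
def TopTurn : Piece → ℕ → ℕ → Prop
  | cup i, a, b => a = i ∧ b = i + 1
  | hook i, a, b => a = i ∧ b = i + 1
  | _, _, _ => False

def isCross : Piece → Bool
  | cross _ _ => true
  | _ => false

/-- The position of a crossing. -/
def pos : Piece → ℕ
  | cross i _ => i
  | _ => 0

/-- The `0`-smoothing (`false`) and the `1`-smoothing (`true`) of a crossing. The `0`-smoothing joins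
the two regions swept out when the upper strand turns counterclockwise. -/
def smooth : Piece → Bool → Piece
  | cross i ov, b => if ov = b then hook i else straight
  | p, _ => p

theorem Fits.pos_lt {p : Piece} {w w' : ℕ} (h : p.Fits w w') (hp : p.isCross = true) :
    p.pos < w ∧ p.pos + 1 < w' := by
  cases p <;> simp_all [Fits, pos, isCross]
  omega

end Piece

/-- An oriented annular link diagram, consisting of `height + 1` cyclically arranged sectors. Sector
`t` lies between the rays `t` and `t + 1`, where `t + 1` is taken modulo `height + 1`. -/
structure AnnularDiagram where
  height : ℕ
  /-- the number of strands that meet a ray -/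
  width : Fin (height + 1) → ℕ
  piece : Fin (height + 1) → Piece
  fits : ∀ t, (piece t).Fits (width t) (width (t + 1))
  /-- the orientation: whether the strand at position `a` of ray `t` runs counterclockwise -/
  up : Fin (height + 1) → ℕ → Bool
  up_through : ∀ t a b, a < width t → b < width (t + 1) → (piece t).Through a b →
    up (t + 1) b = up t a
  up_bottom : ∀ t a b, (piece t).BottomTurn a b → up t b ≠ up t a
  up_top : ∀ t a b, (piece t).TopTurn a b → up (t + 1) b ≠ up (t + 1) a

namespace AnnularDiagram

variable (P : AnnularDiagram)

/-- The points where the diagram meets the rays. -/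
abbrev Point : Type := Σ t : Fin (P.height + 1), Fin (P.width t)

/-- The crossings. -/
abbrev Crossing : Type := {t : Fin (P.height + 1) // (P.piece t).isCross = true}

/-- The number of negative crossings. -/
def negCrossings : ℕ :=
  Nat.card {c : P.Crossing // ∃ i ov, P.piece c.1 = .cross i ov ∧
    ov ≠ (P.up c.1 i == P.up c.1 (i + 1))}

/-- A vertex of the cube of resolutions. -/
abbrev Vertex : Type := P.Crossing → Bool

variable {P}

/-- The bottom left end of a crossing. -/
def bottomLeft (c : P.Crossing) : P.Point :=
  ⟨c.1, ⟨(P.piece c.1).pos, ((P.fits c.1).pos_lt c.2).1⟩⟩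

/-- The top right end of a crossing. In both smoothings, one of the two arcs ends at the bottom left
and the other one at the top right. -/
def topRight (c : P.Crossing) : P.Point :=
  ⟨c.1 + 1, ⟨(P.piece c.1).pos + 1, ((P.fits c.1).pos_lt c.2).2⟩⟩

/-- The content of sector `t` in the resolution `r`. -/
def resolved (r : P.Vertex) (t : Fin (P.height + 1)) : Piece :=
  if h : (P.piece t).isCross = true then (P.piece t).smooth (r ⟨t, h⟩) else P.piece t

/-- The points `a` and `b` are the ends of an arc of the resolution `r` inside a sector. -/
def Joined (r : P.Vertex) (a b : P.Point) : Prop :=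
  ∃ t : Fin (P.height + 1),
    (a.1 = t ∧ b.1 = t + 1 ∧ (resolved r t).Through a.2 b.2) ∨
    (a.1 = t ∧ b.1 = t ∧ (resolved r t).BottomTurn a.2 b.2) ∨
    (a.1 = t + 1 ∧ b.1 = t + 1 ∧ (resolved r t).TopTurn a.2 b.2)

/-- The circles of the resolution `r`. -/
def Circle (r : P.Vertex) : Type := Quotient (Relation.EqvGen.setoid (Joined r))

/-- The circle through a point. -/
def circleOf (r : P.Vertex) (a : P.Point) : Circle r := Quotient.mk _ a

instance (r : P.Vertex) : Finite (Circle r) := inferInstanceAs (Finite (Quotient _))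

instance (r : P.Vertex) : Fintype (Circle r) := Fintype.ofFinite _

instance (r : P.Vertex) : DecidableEq (Circle r) := Classical.decEq _

/-- A circle is nontrivial, that is, it separates the two boundary components of the annulus, if it
meets a radial arc (here the ray `0`) an odd number of times. -/
def Nontriv {r : P.Vertex} (C : Circle r) : Prop :=
  Odd (Nat.card {a : P.Point // a.1 = 0 ∧ circleOf r a = C})

variable (P)

/-- The generators of the Khovanov complex: the circles of a resolution are labelled `+` (`true`) or
`-` (`false`). -/
abbrev Gen : Type := Σ r : P.Vertex, (Circle r → Bool)

/-- The annular Khovanov complex over the field with two elements, as a vector space. -/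
abbrev CKh : Type := P.Gen →₀ ZMod 2

variable {P}

/-- The homological grading. -/
def homDeg (g : P.Gen) : ℤ := (Nat.card {c : P.Crossing // g.1 c = true} : ℤ) - P.negCrossings

open Classical in
/-- The `k`-grading: nontrivial circles count with the sign of their label. -/
def kDeg (g : P.Gen) : ℤ := ∑ C : Circle g.1, if Nontriv C then (if g.2 C then 1 else -1) else 0

variable (P) in
def grading : ℤ → Submodule (ZMod 2) P.CKh := gradedPiece homDeg

/-- The multiplication of Khovanov's Frobenius algebra: the coefficient of `z` in the product of `x`
and `y`. -/
def mulKh : Bool → Bool → Bool → ZMod 2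
  | true, true, true => 1
  | true, false, false => 1
  | false, true, false => 1
  | _, _, _ => 0

/-- The comultiplication of Khovanov's Frobenius algebra: the coefficient of `x ⊗ y` in the coproduct
of `z`. -/
def comulKh : Bool → Bool → Bool → ZMod 2
  | true, true, false => 1
  | true, false, true => 1
  | false, false, false => 1
  | _, _, _ => 0

/-- The additional terms of Lee's multiplication: `- ⊗ - ↦ +`. -/
def mulLee : Bool → Bool → Bool → ZMod 2
  | false, false, true => 1
  | _, _, _ => 0

/-- The additional terms of Lee's comultiplication: `- ↦ + ⊗ +`. -/
def comulLee : Bool → Bool → Bool → ZMod 2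
  | false, true, true => 1
  | _, _, _ => 0

open Classical in
/-- The coefficient of `g'` in the image of `g` under the edge map of the cube of resolutions at the
crossing `c`: the circles that do not meet the crossing keep their labels, and the map at the
crossing is `μ` for a merge and `δ` for a split. -/
def edgeCoeff (μ δ : Bool → Bool → Bool → ZMod 2) (c : P.Crossing) (g g' : P.Gen) : ZMod 2 :=
  if g.1 c = false ∧ g'.1 = Function.update g.1 c true ∧
      ∀ a : P.Point, circleOf g.1 a ≠ circleOf g.1 (bottomLeft c) →
        circleOf g.1 a ≠ circleOf g.1 (topRight c) →
        g'.2 (circleOf g'.1 a) = g.2 (circleOf g.1 a) then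
    if circleOf g.1 (bottomLeft c) ≠ circleOf g.1 (topRight c) ∧
        circleOf g'.1 (bottomLeft c) = circleOf g'.1 (topRight c) then
      μ (g.2 (circleOf g.1 (bottomLeft c))) (g.2 (circleOf g.1 (topRight c)))
        (g'.2 (circleOf g'.1 (bottomLeft c)))
    else if circleOf g.1 (bottomLeft c) = circleOf g.1 (topRight c) ∧
        circleOf g'.1 (bottomLeft c) ≠ circleOf g'.1 (topRight c) then
      δ (g.2 (circleOf g.1 (bottomLeft c)))
        (g'.2 (circleOf g'.1 (bottomLeft c))) (g'.2 (circleOf g'.1 (topRight c)))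
    else 0
  else 0

/-- The sum of the edge maps over the cube of resolutions, restricted to the matrix entries from `g`
to `g'` for which the `k`-gradings satisfy `R (k g) (k g')`. -/
def cubeMap (μ δ : Bool → Bool → Bool → ZMod 2) (R : ℤ → ℤ → Prop) [DecidableRel R] :
    P.CKh →ₗ[ZMod 2] P.CKh :=
  Finsupp.linearCombination (ZMod 2) fun g =>
    ∑ g' : P.Gen, Finsupp.single g'
      (if R (kDeg g) (kDeg g') then ∑ c : P.Crossing, edgeCoeff μ δ c g g' else 0)

variable (P)

/-- The part `∂_0` of Khovanov's differential that preserves the `k`-grading. -/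
def dZero : P.CKh →ₗ[ZMod 2] P.CKh := cubeMap mulKh comulKh fun k k' => k' = k

/-- The part `∂_-` of Khovanov's differential that decreases the `k`-grading. -/
def dMinus : P.CKh →ₗ[ZMod 2] P.CKh := cubeMap mulKh comulKh fun k k' => k' < k

/-- The part `∂_0^{Lee}` of Lee's differential that preserves the `k`-grading. -/
def leeZero : P.CKh →ₗ[ZMod 2] P.CKh := cubeMap mulLee comulLee fun k k' => k' = k

/-- The part `∂_+^{Lee}` of Lee's differential that increases the `k`-grading. -/
def leePlus : P.CKh →ₗ[ZMod 2] P.CKh := cubeMap mulLee comulLee fun k k' => k < k'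

open Classical in
/-- The action of `e`: nontrivial circles carry the defining representation of `sl₂`, and trivial
circles the trivial one. -/
def eAct : P.CKh →ₗ[ZMod 2] P.CKh := Finsupp.linearCombination (ZMod 2) fun g =>
  ∑ C : Circle g.1, if Nontriv C ∧ g.2 C = false then
    Finsupp.single (⟨g.1, Function.update g.2 C true⟩ : P.Gen) 1 else 0

open Classical in
/-- The action of `f`. -/
def fAct : P.CKh →ₗ[ZMod 2] P.CKh := Finsupp.linearCombination (ZMod 2) fun g =>
  ∑ C : Circle g.1, if Nontriv C ∧ g.2 C = true then
    Finsupp.single (⟨g.1, Function.update g.2 C false⟩ : P.Gen) 1 else 0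

/-- The action of `h`: its weights are the `k`-gradings. -/
def hAct : P.CKh →ₗ[ZMod 2] P.CKh := Finsupp.linearCombination (ZMod 2) fun g =>
  Finsupp.single g (kDeg g : ZMod 2)

/-- The action of the basis of `sl₂(∧)_dg`; `ṽ_0 = [e, v_{-2}]` and `x = [v_2, v_{-2}]` act by
supercommutators. -/
def basisAct : DgBasis → (P.CKh →ₗ[ZMod 2] P.CKh)
  | .e => P.eAct
  | .f => P.fAct
  | .h => P.hAct
  | .v2 => P.leePlus
  | .vm2 => P.dMinus
  | .v0 => P.eAct ∘ₗ P.dMinus - P.dMinus ∘ₗ P.eAct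
  | .d => P.dZero
  | .D => P.leeZero
  | .x => P.leePlus ∘ₗ P.dMinus + P.dMinus ∘ₗ P.leePlus

/-- The action of `sl₂(∧)_dg` on the annular Khovanov complex. -/
def dgAct : SlDg →ₗ[ZMod 2] (P.CKh →ₗ[ZMod 2] P.CKh) :=
  Finsupp.linearCombination (ZMod 2) P.basisAct

/-- The operations over `sl₂(∧)_dg`: `k_1 = ∂_0`, `k_2` is the action, and there are no higher
ones. -/
def dgOps : (n : ℕ) → (Fin n → SlDg) → P.CKh → P.CKh
  | 0, _, m => P.dZero m
  | 1, y, m => P.dgAct (y 0) m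
  | _, _, _ => 0

/-- The operations over the homology of `sl₂(∧)_dg`, obtained by restriction of scalars along the
transfer maps `I_n`. -/
def homologyOps : (n : ℕ) → (Fin n → SlH) → P.CKh → P.CKh :=
  LInf.restrictScalars SlDg.homologyI P.dgOps

/-- The operations over `sl₂(∧)`, obtained by restriction to `sl₂(∧) ⊆ H(sl₂(∧)_dg)`. -/
def wedgeOps (n : ℕ) (y : Fin n → SlWedge) (m : P.CKh) : P.CKh :=
  P.homologyOps n (SlWedge.toH ∘ y) m

end AnnularDiagram

end

/-!
All operations in the theorem vanish from arity three on (for modules: with three or more inputs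
from the Lie superalgebra), apart from signs, which are trivial modulo `2`. So each of the
`L∞`-relations reduces to finitely many identities between a differential, a bracket, and at most
one further bilinear map: `LInf.IsDgOps.isAlgebra`, `LInf.IsDgOps.isHom` and
`LInf.IsDgOps.isModule`.

For the Lie superalgebras these identities are checked on the bases. The homotopy takes values in
the line through `D`, and `D` commutes with itself and with the image of `sl₂(∧)`. Therefore the
transfer stops after `I_2`, which sends `v_2, v_{-2}` to `-D` and accounts for
`[v_2, v_{-2}] = x = -[d, D]`.

For the annular Khovanov complex it has to be shown that the given operators satisfy the relations
of `sl₂(∧)_dg`. Add all four operators: `∂ = ∂_0 + ∂_- + ∂_0^{Lee} + ∂_+^{Lee}` is the differential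
of the cube of resolutions for the Frobenius algebra `F₂[X] / (X² = 1)`. Represent the generators of
the complex by functions `u` on the points where the diagram meets the rays: a circle is labelled
`-` if the sum of `u` over its points is odd, so that a point acts as multiplication by `X` on its
circle. In this description a merge does not change `u`, and a split is multiplication by the sum of
the points at the two sides of the crossing (`AnnularDiagram.edgeMap_genVec`). It follows that edge
maps commute around each face of the cube (`AnnularDiagram.edgeMap_comm`), given how circles can
merge and split around a face (`face_cases`), and so `∂² = 0`. Moreover `e + f` is the action of the
sum of all points on one ray, since modulo `2` a circle is counted by this sum exactly if it is
nontrivial. So `e + f` commutes with `∂`, and `(e + f)²` is the number of these points, which is the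
action of `h`.

The operators are homogeneous for the bigrading by the label count `j` on all circles and the label
count `k` on nontrivial circles, with distinct bidegrees. The homogeneous components of `∂² = 0`,
`[∂, e + f] = 0` and `(e + f)² = h` are exactly the relations needed
(`Bihomogeneous.relations_of_sq` and the two lemmas after it), and they give all brackets
(`SlDg.linearCombination_table`).

The only geometric input is that a change of one smoothing merges two circles or splits one circle
into two (`AnnularDiagram.isMerge_or_isMerge`). Orient the strands counterclockwise at even and
clockwise at odd positions of each ray. Every resolution respects this orientation, so its circles
are the orbits of a permutation of the points, and a change of one smoothing multiplies this
permutation by a transposition.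
-/

/-! ### Subfamilies -/

namespace LInf

variable {V V' W : Type*}

theorem apply_congr (F : ∀ n : ℕ, (Fin n → V) → W) {m n : ℕ} (h : m = n) (x : Fin m → V)
    (y : Fin n → V) (hxy : ∀ i, x i = y (Fin.cast h i)) : F m x = F n y := by
  subst h
  exact congrArg _ (funext hxy)

theorem apply_sub_univ (F : ∀ n : ℕ, (Fin n → V) → W) {n : ℕ} (x : Fin n → V) :
    F (Finset.univ : Finset (Fin n)).card (sub x Finset.univ) = F n x := by
  refine apply_congr F (by simp) _ _ fun i => ?_
  have h := Finset.orderEmbOfFin_unique (s := (Finset.univ : Finset (Fin n))) rfl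
    (f := Fin.cast (by simp)) (fun _ => Finset.mem_univ _) (Fin.cast_strictMono _)
  simp only [sub, ← h]

theorem sub_singleton_apply {n : ℕ} (x : Fin n → V) (a : Fin n)
    (i : Fin ({a} : Finset (Fin n)).card) : sub x {a} i = x a := by
  have h := Finset.orderEmbOfFin_mem ({a} : Finset (Fin n)) rfl i
  rw [Finset.mem_singleton] at h
  rw [sub, h]

theorem apply_sub_singleton (F : ∀ n : ℕ, (Fin n → V) → W) {n : ℕ} (x : Fin n → V) (a : Fin n) :
    F ({a} : Finset (Fin n)).card (sub x {a}) = F 1 fun _ => x a :=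
  apply_congr F (by simp) _ _ fun i => sub_singleton_apply x a i

theorem apply_of_eq_zero (F : ∀ n : ℕ, (Fin n → V) → W) {m : ℕ} (h : m = 0) (x : Fin m → V) :
    F m x = F 0 Fin.elim0 :=
  apply_congr F h _ _ fun i => (Fin.cast h i).elim0

theorem apply_of_eq_one (F : ∀ n : ℕ, (Fin n → V) → W) {m : ℕ} (h : m = 1) (x : Fin m → V) :
    F m x = F 1 fun _ => x ⟨0, by omega⟩ := by
  subst h
  exact congrArg _ (funext fun i => by congr; exact Subsingleton.elim _ _)

theorem apply_of_eq_two (F : ∀ n : ℕ, (Fin n → V) → W) {m : ℕ} (h : m = 2) (x : Fin m → V) :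
    F m x = F 2 ![x ⟨0, by omega⟩, x ⟨1, by omega⟩] := by
  subst h
  refine congrArg _ (funext fun i => ?_)
  fin_cases i <;> rfl

theorem comp_perm_one {σ : Equiv.Perm (Fin 1)} (x : Fin 1 → V) : x ∘ σ = x := by
  rw [Subsingleton.elim σ 1]; rfl

theorem perm_two_cases (σ : Equiv.Perm (Fin 2)) : (σ 0 = 0 ∧ σ 1 = 1) ∨ (σ 0 = 1 ∧ σ 1 = 0) := by
  revert σ; decide

theorem univ_finset_one : (Finset.univ : Finset (Finset (Fin 1))) = {∅, {0}} := by decide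

theorem univ_finset_two :
    (Finset.univ : Finset (Finset (Fin 2))) = {∅, {0}, {1}, Finset.univ} := by decide

theorem sum_nonempty_two [AddCommMonoid W] (F : Finset (Fin 2) → W) :
    ∑ S : Finset (Fin 2) with S.Nonempty, F S = F {0} + (F {1} + F Finset.univ) := by
  rw [show (Finset.univ.filter fun S : Finset (Fin 2) => S.Nonempty) = {{0}, {1}, Finset.univ}
    by decide]
  rw [Finset.sum_insert (by decide), Finset.sum_insert (by decide), Finset.sum_singleton]

/-! ### Set partitions -/

theorem setPartitions_zero_right {n : ℕ} (hn : n ≠ 0) : setPartitions n 0 = ∅ := by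
  refine Finset.eq_empty_of_forall_notMem fun c _ => ?_
  exact (c ⟨0, by omega⟩).elim0

theorem setPartitions_one {n : ℕ} (hn : n ≠ 0) : setPartitions n 1 = {fun _ => 0} := by
  ext c
  simp only [setPartitions, Finset.mem_filter, Finset.mem_univ, true_and, Finset.mem_singleton]
  constructor
  · intro _; exact funext fun i => Subsingleton.elim _ _
  · rintro rfl
    exact ⟨fun a => ⟨⟨0, by omega⟩, Subsingleton.elim _ _⟩,
      fun a b hab => absurd (Subsingleton.elim a b) hab.ne⟩

theorem setPartitions_two_two : setPartitions 2 2 = {id} := by decide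

theorem block_const {n : ℕ} : block (fun _ : Fin n => (0 : Fin 1)) 0 = Finset.univ := by
  ext; simp [block]

theorem block_id {n : ℕ} (a : Fin n) : block (id : Fin n → Fin n) a = {a} := by
  ext; simp [block]

theorem apply_block_const (F : ∀ n : ℕ, (Fin n → V) → W) {n : ℕ} (x : Fin n → V) :
    F (block (fun _ : Fin n => (0 : Fin 1)) 0).card (sub x (block (fun _ => 0) 0)) = F n x := by
  rw [block_const, apply_sub_univ F]

theorem apply_block_id (F : ∀ n : ℕ, (Fin n → V) → W) {n : ℕ} (x : Fin n → V) (a : Fin n) :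
    F (block (id : Fin n → Fin n) a).card (sub x (block id a)) = F 1 fun _ => x a := by
  rw [block_id, apply_sub_singleton F]

/-- The two blocks of a set partition together have `n` elements, and both are nonempty. -/
theorem card_block_two {n : ℕ} {c : Fin n → Fin 2} (hc : c ∈ setPartitions n 2) :
    (block c 0).card + (block c 1).card = n ∧ (block c 0).card ≠ 0 ∧ (block c 1).card ≠ 0 := by
  have hs : Function.Surjective c := (Finset.mem_filter.1 hc).2.1
  refine ⟨?_, ?_, ?_⟩
  · have h := Finset.card_eq_sum_card_fiberwise (f := c) (s := Finset.univ) (t := Finset.univ)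
      (fun _ _ => by simp)
    simpa [Fin.sum_univ_two, block] using h.symm
  · obtain ⟨i, hi⟩ := hs 0
    exact Finset.card_ne_zero.2 ⟨i, by simp [block, hi]⟩
  · obtain ⟨i, hi⟩ := hs 1
    exact Finset.card_ne_zero.2 ⟨i, by simp [block, hi]⟩

/-! ### Operations with one or two inputs -/

variable [AddCommGroup V] [Module (ZMod 2) V] [AddCommGroup V'] [Module (ZMod 2) V']

/-- The only nonzero operations are the unary `d` and the binary `b`. -/
structure IsDgOps (l : ∀ n : ℕ, (Fin n → V) → V') (d : V →ₗ[ZMod 2] V')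
    (b : V →ₗ[ZMod 2] V →ₗ[ZMod 2] V') : Prop where
  one : ∀ x, l 1 x = d (x 0)
  two : ∀ x, l 2 x = b (x 0) (x 1)
  other : ∀ n x, n ≠ 1 → n ≠ 2 → l n x = 0

theorem exists_multilinear_zero (n : ℕ) (f : (Fin n → V) → V') (h : ∀ x, f x = 0) :
    ∃ g : MultilinearMap (ZMod 2) (fun _ : Fin n => V) V', ∀ x, g x = f x :=
  ⟨0, fun x => by simp [h]⟩

theorem exists_multilinear_one (d : V →ₗ[ZMod 2] V') :
    ∃ g : MultilinearMap (ZMod 2) (fun _ : Fin 1 => V) V', ∀ x, g x = d (x 0) :=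
  ⟨d.compMultilinearMap (MultilinearMap.ofSubsingleton (ZMod 2) V V 0 LinearMap.id),
    fun x => by simp⟩

theorem exists_multilinear_two (b : V →ₗ[ZMod 2] V →ₗ[ZMod 2] V') :
    ∃ g : MultilinearMap (ZMod 2) (fun _ : Fin 2 => V) V', ∀ x, g x = b (x 0) (x 1) :=
  ⟨{ toFun := fun x => b (x 0) (x 1)
     map_update_add' := fun x i u v => by fin_cases i <;> simp [Function.update]
     map_update_smul' := fun x i u v => by fin_cases i <;> simp [Function.update] },
    fun x => rfl⟩

namespace IsDgOps

variable {l : ∀ n : ℕ, (Fin n → V) → V'} {d : V →ₗ[ZMod 2] V'}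
  {b : V →ₗ[ZMod 2] V →ₗ[ZMod 2] V'}

theorem multilinear (h : IsDgOps l d b) (n : ℕ) :
    ∃ g : MultilinearMap (ZMod 2) (fun _ : Fin n => V) V', ∀ x, g x = l n x := by
  by_cases h1 : n = 1
  · subst h1; simpa only [h.one] using exists_multilinear_one d
  by_cases h2 : n = 2
  · subst h2; simpa only [h.two] using exists_multilinear_two b
  · exact exists_multilinear_zero n _ fun x => h.other n x h1 h2

theorem symmetric (h : IsDgOps l d b) (hb : ∀ x y, b x y = b y x) (n : ℕ)
    (σ : Equiv.Perm (Fin n)) (x : Fin n → V) : l n (x ∘ σ) = l n x := by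
  by_cases h1 : n = 1
  · subst h1; rw [comp_perm_one]
  by_cases h2 : n = 2
  · subst h2
    rcases perm_two_cases σ with ⟨h0, h1⟩ | ⟨h0, h1⟩ <;> simp [h.two, h0, h1]
    exact hb _ _
  · rw [h.other n _ h1 h2, h.other n _ h1 h2]

theorem degree (h : IsDgOps l d b) {𝒱 : ℤ → Submodule (ZMod 2) V}
    {𝒱' : ℤ → Submodule (ZMod 2) V'} {e : ℤ}
    (hd : ∀ a, ∀ y ∈ 𝒱 a, d y ∈ 𝒱' (a + e - 1))
    (hb : ∀ a a', ∀ y ∈ 𝒱 a, ∀ z ∈ 𝒱 a', b y z ∈ 𝒱' (a + a' + e - 2))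
    (n : ℕ) (x : Fin n → V) (a : Fin n → ℤ) (hx : ∀ s, x s ∈ 𝒱 (a s)) :
    l n x ∈ 𝒱' ((∑ s, a s) + e - n) := by
  by_cases h1 : n = 1
  · subst h1; rw [h.one]; simpa using hd _ _ (hx 0)
  by_cases h2 : n = 2
  · subst h2; rw [h.two]; simpa using hb _ _ _ (hx 0) _ (hx 1)
  · rw [h.other n _ h1 h2]; exact zero_mem _

end IsDgOps

/-! ### Differential graded Lie algebras with central brackets -/

/-- The insertion of an operation of `l` into an operation of `f`, summed over all unshuffles. If
`f_2` vanishes on brackets, only the terms with at most two inputs are left. -/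
theorem sum_unshuffles_insert {l : ∀ n : ℕ, (Fin n → V) → V} {d : V →ₗ[ZMod 2] V}
    {b : V →ₗ[ZMod 2] V →ₗ[ZMod 2] V} (hl : IsDgOps l d b)
    {f : ∀ n : ℕ, (Fin n → V) → V'} {φ : V →ₗ[ZMod 2] V'}
    {ψ : V →ₗ[ZMod 2] V →ₗ[ZMod 2] V'} (hf : IsDgOps f φ ψ)
    (nil : ∀ x y z, ψ (b x y) z = 0) (n : ℕ) (x : Fin n → V) :
    ∑ S : Finset (Fin n) with S.Nonempty,
      f (Sᶜ.card + 1) (Fin.cons (l S.card (sub x S)) (sub x Sᶜ)) =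
    f 1 (fun _ => l n x) +
      if h : n = 2 then ψ (d (x ⟨0, by omega⟩)) (x ⟨1, by omega⟩) +
        ψ (d (x ⟨1, by omega⟩)) (x ⟨0, by omega⟩) else 0 := by
  have key : ∀ S : Finset (Fin n), f (Sᶜ.card + 1) (Fin.cons (l S.card (sub x S)) (sub x Sᶜ)) =
      if S.card = n then f 1 (fun _ => l n x) else if S.card = 1 ∧ n = 2 then
        f (Sᶜ.card + 1) (Fin.cons (l S.card (sub x S)) (sub x Sᶜ)) else 0 := by
    intro S
    have hc : S.card + Sᶜ.card = n := by simp [Finset.card_add_card_compl S]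
    split_ifs with h1 h2
    · have : S = Finset.univ := by rwa [← Finset.card_eq_iff_eq_univ, Fintype.card_fin]
      subst this
      rw [apply_sub_univ l, apply_of_eq_one f (by simp)]
      rfl
    · rfl
    · -- the outer operation is binary or vanishes, and the inner one is the bracket or vanishes
      by_cases h3 : Sᶜ.card = 1
      · have hs : S.card ≠ 1 := fun h => h2 ⟨h, by omega⟩
        rw [apply_of_eq_two f (by omega), hf.two]
        by_cases h4 : S.card = 2
        · simp only [Matrix.cons_val_zero]
          change ψ (l S.card (sub x S)) _ = 0
          rw [apply_of_eq_two l h4, hl.two, nil]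
        · simp only [Matrix.cons_val_zero]
          change ψ (l S.card (sub x S)) _ = 0
          rw [hl.other _ _ hs h4]; simp
      · exact hf.other _ _ (by omega) (by omega)
  by_cases h2 : n = 2
  · subst h2
    rw [sum_nonempty_two, add_comm (f 1 _), ← add_assoc, dif_pos rfl]
    congr 1
    · rw [show ({0} : Finset (Fin 2))ᶜ = {1} by decide,
        show ({1} : Finset (Fin 2))ᶜ = {0} by decide]
      congr 1
      · rw [apply_sub_singleton l, apply_of_eq_two f (by simp), hf.two, hl.one]
        exact congrArg _ (sub_singleton_apply x 1 _)
      · rw [apply_sub_singleton l, apply_of_eq_two f (by simp), hf.two, hl.one]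
        exact congrArg _ (sub_singleton_apply x 0 _)
    · rw [key, if_pos (by simp)]
  · rw [dif_neg h2, add_zero, Finset.sum_congr rfl fun S _ => key S]
    simp only [h2, and_false, if_false]
    by_cases h0 : n = 0
    · subst h0
      rw [hl.other 0 x (by simp) (by simp), hf.one]
      simp
    rw [Finset.sum_eq_single Finset.univ]
    · simp
    · intro S _ hS
      rw [if_neg]
      rwa [ne_eq, ← Finset.card_eq_iff_eq_univ, Fintype.card_fin] at hS
    · intro h
      exact absurd (Finset.mem_filter.2 ⟨Finset.mem_univ _, ⟨⟨0, by omega⟩, Finset.mem_univ _⟩⟩) h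

/-- A differential graded Lie algebra in which all brackets are central is an `L∞`-algebra. -/
theorem IsDgOps.isAlgebra {𝒱 : ℤ → Submodule (ZMod 2) V} {l : ∀ n : ℕ, (Fin n → V) → V}
    {d : V →ₗ[ZMod 2] V} {b : V →ₗ[ZMod 2] V →ₗ[ZMod 2] V} (h : IsDgOps l d b)
    (graded : DirectSum.IsInternal 𝒱)
    (hd : ∀ a, ∀ y ∈ 𝒱 a, d y ∈ 𝒱 (a + 1))
    (hb : ∀ a a', ∀ y ∈ 𝒱 a, ∀ z ∈ 𝒱 a', b y z ∈ 𝒱 (a + a'))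
    (symm : ∀ x y, b x y = b y x) (d_d : ∀ x, d (d x) = 0)
    (leibniz : ∀ x y, d (b x y) + (b (d x) y + b (d y) x) = 0)
    (nil : ∀ x y z, b (b x y) z = 0) : IsAlgebra 𝒱 l where
  graded := graded
  zero x := h.other 0 x (by simp) (by simp)
  multilinear := h.multilinear
  symmetric := h.symmetric symm
  degree n x a hx := by
    refine h.degree (e := 2) ?_ ?_ n x a hx
    · intro a y hy; convert hd a y hy using 2; ring
    · intro a a' y hy z hz; convert hb a a' y hy z hz using 2; ring
  jacobi n x := by
    rw [sum_unshuffles_insert h h nil]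
    split_ifs with h2
    · subst h2; rw [h.one, h.two]; exact leibniz _ _
    · rw [add_zero, h.one]
      by_cases h1 : n = 1
      · subst h1; rw [h.one, d_d]
      · rw [h.other n x h1 h2, map_zero]

end LInf

/-! ### Homomorphisms and modules with few nonzero operations -/

namespace LInf

variable {V V' L M : Type*}
  [AddCommGroup V] [Module (ZMod 2) V] [AddCommGroup V'] [Module (ZMod 2) V']
  [AddCommGroup L] [Module (ZMod 2) L] [AddCommGroup M] [Module (ZMod 2) M]

/-- The sum over set partitions into at least two blocks, for a family `f` whose members of arity
`2, …, n - 1` take values in a subspace `U` that has zero bracket with itself and with the values of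
`f_1`. -/
theorem sum_setPartitions_ge_two {l : ∀ n : ℕ, (Fin n → V') → V'} {d : V' →ₗ[ZMod 2] V'}
    {b : V' →ₗ[ZMod 2] V' →ₗ[ZMod 2] V'} (hl : IsDgOps l d b)
    {f : ∀ n : ℕ, (Fin n → V) → V'} {φ : V →ₗ[ZMod 2] V'} (hf : ∀ x, f 1 x = φ (x 0))
    (U : Submodule (ZMod 2) V') (hφU : ∀ x, ∀ u ∈ U, b (φ x) u = 0)
    (hUφ : ∀ x, ∀ u ∈ U, b u (φ x) = 0) (hUU : ∀ u ∈ U, ∀ v ∈ U, b u v = 0)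
    {n : ℕ} (hU : ∀ m, 2 ≤ m → m < n → ∀ x, f m x ∈ U) (x : Fin n → V) :
    ∑ r ∈ Finset.Icc 2 n, ∑ c ∈ setPartitions n r,
      l r (fun a => f (block c a).card (sub x (block c a))) =
    if h : n = 2 then b (φ (x ⟨0, by omega⟩)) (φ (x ⟨1, by omega⟩)) else 0 := by
  by_cases h2 : n = 2
  · subst h2
    simp only [Finset.Icc_self, Finset.sum_singleton, setPartitions_two_two, hl.two,
      apply_block_id f, hf]
    rfl
  rw [dif_neg h2]
  refine Finset.sum_eq_zero fun r hr => Finset.sum_eq_zero fun c hc => ?_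
  rw [Finset.mem_Icc] at hr
  by_cases hr2 : r = 2
  · subst hr2
    obtain ⟨hs, hc0, hc1⟩ := card_block_two hc
    rw [hl.two]
    by_cases h0 : (block c 0).card = 1 <;> by_cases h1 : (block c 1).card = 1
    · omega
    · rw [apply_of_eq_one f h0, hf]
      exact hφU _ _ (hU _ (by omega) (by omega) _)
    · rw [apply_of_eq_one f h1, hf]
      exact hUφ _ _ (hU _ (by omega) (by omega) _)
    · exact hUU _ (hU _ (by omega) (by omega) _) _ (hU _ (by omega) (by omega) _)
  · exact hl.other _ _ (by omega) hr2

/-- A homomorphism with components `φ` and `ψ` from a Lie algebra to a differential graded Lie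
algebra, both with central brackets. The hypothesis `main` says that `φ` is multiplicative up to the
boundary of `ψ`. -/
theorem IsDgOps.isHom {𝒱 : ℤ → Submodule (ZMod 2) V} {l : ∀ n : ℕ, (Fin n → V) → V}
    {β : V →ₗ[ZMod 2] V →ₗ[ZMod 2] V} (h : IsDgOps l 0 β)
    {𝒱' : ℤ → Submodule (ZMod 2) V'} {l' : ∀ n : ℕ, (Fin n → V') → V'}
    {d : V' →ₗ[ZMod 2] V'} {b : V' →ₗ[ZMod 2] V' →ₗ[ZMod 2] V'} (h' : IsDgOps l' d b)
    {f : ∀ n : ℕ, (Fin n → V) → V'} {φ : V →ₗ[ZMod 2] V'}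
    {ψ : V →ₗ[ZMod 2] V →ₗ[ZMod 2] V'} (hf : IsDgOps f φ ψ)
    (hφ : ∀ a, ∀ y ∈ 𝒱 a, φ y ∈ 𝒱' a)
    (hψ : ∀ a a', ∀ y ∈ 𝒱 a, ∀ z ∈ 𝒱 a', ψ y z ∈ 𝒱' (a + a' - 1))
    (symm : ∀ x y, ψ x y = ψ y x) (nil : ∀ x y z, ψ (β x y) z = 0)
    (U : Submodule (ZMod 2) V') (hφU : ∀ x, ∀ u ∈ U, b (φ x) u = 0)
    (hUφ : ∀ x, ∀ u ∈ U, b u (φ x) = 0) (hUU : ∀ u ∈ U, ∀ v ∈ U, b u v = 0)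
    (hU : ∀ x y, ψ x y ∈ U) (d_φ : ∀ x, d (φ x) = 0)
    (main : ∀ x y, φ (β x y) + (d (ψ x y) + b (φ x) (φ y)) = 0) :
    IsHom 𝒱 l 𝒱' l' f where
  zero x := hf.other 0 x (by simp) (by simp)
  multilinear := hf.multilinear
  symmetric := hf.symmetric symm
  degree n x a hx := by
    refine hf.degree (e := 1) ?_ ?_ n x a hx
    · intro a y hy; convert hφ a y hy using 2; ring
    · intro a a' y hy z hz; convert hψ a a' y hy z hz using 2; ring
  relation n x := by
    rw [sum_unshuffles_insert h hf nil]
    rcases Nat.eq_zero_or_pos n with rfl | hn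
    · rw [hf.one, h.other 0 x (by simp) (by simp)]
      simp [h'.other 0 _]
    have hr : Finset.range (n + 1) = insert 0 (insert 1 (Finset.Icc 2 n)) := by
      ext i; simp only [Finset.mem_range, Finset.mem_insert, Finset.mem_Icc]; omega
    have hfU : ∀ m, 2 ≤ m → m < n → ∀ x, f m x ∈ U := by
      intro m hm _ x
      by_cases h2 : m = 2
      · subst h2; rw [hf.two]; exact hU _ _
      · rw [hf.other m x (by omega) h2]; exact zero_mem _
    rw [hr, Finset.sum_insert (by simp), Finset.sum_insert (by simp),
      setPartitions_zero_right hn.ne', setPartitions_one hn.ne',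
      sum_setPartitions_ge_two h' hf.one U hφU hUφ hUU hfU]
    simp only [Finset.sum_empty, Finset.sum_singleton, h'.one, apply_block_const f,
      LinearMap.zero_apply, map_zero, add_zero, zero_add, dite_eq_ite, ite_self]
    by_cases h2 : n = 2
    · subst h2
      rw [dif_pos rfl, h.two, hf.one, hf.two]
      exact main _ _
    · rw [dif_neg h2, add_zero]
      by_cases h1 : n = 1
      · subst h1; simp [h.one, hf.one, d_φ]
      · simp [h.other n x h1 h2, hf.other n x h1 h2, hf.one]

/-- A module whose operations are `δ`, the action `α` and a map `κ` with two inputs from a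
differential graded Lie algebra with central brackets. -/
theorem IsDgOps.isModule {ℒ : ℤ → Submodule (ZMod 2) L} {l : ∀ n : ℕ, (Fin n → L) → L}
    {d : L →ₗ[ZMod 2] L} {b : L →ₗ[ZMod 2] L →ₗ[ZMod 2] L} (h : IsDgOps l d b)
    {ℳ : ℤ → Submodule (ZMod 2) M} {k : ∀ n : ℕ, (Fin n → L) → M → M}
    {δ : M →ₗ[ZMod 2] M} {κ' : ∀ n : ℕ, (Fin n → L) → M →ₗ[ZMod 2] M}
    {α : L →ₗ[ZMod 2] M →ₗ[ZMod 2] M} {κ : L →ₗ[ZMod 2] L →ₗ[ZMod 2] M →ₗ[ZMod 2] M}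
    (hκ : IsDgOps κ' α κ) (k_zero : ∀ x m, k 0 x m = δ m)
    (k_pos : ∀ n x m, n ≠ 0 → k n x m = κ' n x m)
    (graded : DirectSum.IsInternal ℳ)
    (deg_δ : ∀ c, ∀ m ∈ ℳ c, δ m ∈ ℳ (c + 1))
    (deg_α : ∀ a c, ∀ y ∈ ℒ a, ∀ m ∈ ℳ c, α y m ∈ ℳ (a + c))
    (deg_κ : ∀ a a' c, ∀ y ∈ ℒ a, ∀ z ∈ ℒ a', ∀ m ∈ ℳ c, κ y z m ∈ ℳ (a + a' + c - 1))
    (symm : ∀ x y, κ x y = κ y x) (nil : ∀ x y z, κ (b x y) z = 0)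
    (δ_δ : ∀ m, δ (δ m) = 0) (α_δ : ∀ x m, α (d x) m + (α x (δ m) + δ (α x m)) = 0)
    (main : ∀ x y m, α (b x y) m + (κ (d x) y m + κ (d y) x m) +
      ((κ x y (δ m) + δ (κ x y m)) + (α x (α y m) + α y (α x m))) = 0)
    (α_κ : ∀ x y z m, α x (κ y z m) = κ y z (α x m))
    (κ_κ : ∀ x y z w m, κ x y (κ z w m) = κ z w (κ x y m)) :
    IsModule ℒ l ℳ k where
  graded := graded
  multilinear n := by
    rcases Nat.eq_zero_or_pos n with rfl | hn
    · exact ⟨MultilinearMap.constOfIsEmpty (ZMod 2) _ δ, fun x m => by simp [k_zero]⟩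
    · obtain ⟨g, hg⟩ := hκ.multilinear n
      exact ⟨g, fun x m => by rw [k_pos n x m hn.ne', hg]⟩
  symmetric n σ x m := by
    rcases Nat.eq_zero_or_pos n with rfl | hn
    · simp only [k_zero]
    · rw [k_pos _ _ _ hn.ne', k_pos _ _ _ hn.ne', hκ.symmetric symm]
  degree n x a m c hx hm := by
    rcases Nat.eq_zero_or_pos n with rfl | hn
    · rw [k_zero]; simpa using deg_δ c m hm
    rw [k_pos _ _ _ hn.ne']
    by_cases h1 : n = 1
    · subst h1; rw [hκ.one]; simpa using deg_α _ _ _ (hx 0) m hm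
    by_cases h2 : n = 2
    · subst h2
      rw [hκ.two]
      convert deg_κ _ _ _ _ (hx 0) _ (hx 1) m hm using 2
      simp [Fin.sum_univ_two]; ring
    · rw [hκ.other n x h1 h2]; exact zero_mem _
  relation n x m := by
    have e : ∑ S : Finset (Fin n) with S.Nonempty,
        k (Sᶜ.card + 1) (Fin.cons (l S.card (sub x S)) (sub x Sᶜ)) m =
        (∑ S : Finset (Fin n) with S.Nonempty,
        κ' (Sᶜ.card + 1) (Fin.cons (l S.card (sub x S)) (sub x Sᶜ))) m := by
      rw [LinearMap.sum_apply]
      exact Finset.sum_congr rfl fun S _ => k_pos _ _ _ (by omega)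
    rw [e, sum_unshuffles_insert h hκ nil, hκ.one]
    have k_one : ∀ x m, k 1 x m = α (x 0) m := fun x m => by
      rw [k_pos _ _ _ one_ne_zero, hκ.one]
    have k_two : ∀ x m, k 2 x m = κ (x 0) (x 1) m := fun x m => by
      rw [k_pos _ _ _ two_ne_zero, hκ.two]
    have k_empty : ∀ m, k (∅ : Finset (Fin n)).card (sub x ∅) m = δ m := fun m => by
      rw [apply_of_eq_zero k Finset.card_empty, k_zero]
    rcases (by omega : n = 0 ∨ n = 1 ∨ n = 2 ∨ 3 ≤ n) with rfl | rfl | rfl | hn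
    · rw [Fintype.sum_unique, show (default : Finset (Fin 0)) = ∅ from rfl,
        show (∅ : Finset (Fin 0))ᶜ = ∅ from rfl, k_empty, k_empty, δ_δ]
      simp [h.other 0 x]
    · rw [univ_finset_one, Finset.sum_insert (by decide), Finset.sum_singleton,
        show (∅ : Finset (Fin 1))ᶜ = Finset.univ by decide,
        show ({0} : Finset (Fin 1))ᶜ = ∅ by decide]
      have e0 : ∀ F : (n : ℕ) → (Fin n → L) → M → M, ∀ m,
          F (Finset.univ : Finset (Fin 1)).card (sub x Finset.univ) m = F 1 x m := fun F m =>
        congrFun (apply_sub_univ F x) m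
      have e1 : ∀ F : (n : ℕ) → (Fin n → L) → M → M, ∀ m,
          F ({0} : Finset (Fin 1)).card (sub x {0}) m = F 1 (fun _ => x 0) m := fun F m =>
        congrFun (apply_sub_singleton F x 0) m
      rw [e0 k, e1 k, k_empty, k_empty, k_one, k_one, h.one]
      simpa using α_δ _ _
    · rw [univ_finset_two, Finset.sum_insert (by decide), Finset.sum_insert (by decide),
        Finset.sum_insert (by decide), Finset.sum_singleton,
        show (∅ : Finset (Fin 2))ᶜ = Finset.univ by decide,
        show (Finset.univ : Finset (Fin 2))ᶜ = ∅ by decide,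
        show ({0} : Finset (Fin 2))ᶜ = {1} by decide,
        show ({1} : Finset (Fin 2))ᶜ = {0} by decide]
      have e0 : ∀ F : (n : ℕ) → (Fin n → L) → M → M, ∀ m,
          F (Finset.univ : Finset (Fin 2)).card (sub x Finset.univ) m = F 2 x m := fun F m =>
        congrFun (apply_sub_univ F x) m
      have e1 : ∀ F : (n : ℕ) → (Fin n → L) → M → M, ∀ i m,
          F ({i} : Finset (Fin 2)).card (sub x {i}) m = F 1 (fun _ => x i) m := fun F i m =>
        congrFun (apply_sub_singleton F x i) m
      rw [e0 k, e0 k, e1 k, e1 k, e1 k, e1 k, k_empty, k_empty]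
      simp only [k_one, k_two, h.two]
      rw [dif_pos trivial]
      have := main (x 0) (x 1) m
      simp only [LinearMap.add_apply]
      rw [← this]
      simp only [Fin.zero_eta, Fin.mk_one]
      abel
    · rw [h.other n x (by omega) (by omega), dif_neg (by omega)]
      simp only [map_zero, add_zero, LinearMap.zero_apply, zero_add]
      have h_comm : ∀ S : Finset (Fin n), k Sᶜ.card (sub x Sᶜ) (k S.card (sub x S) m) =
          k S.card (sub x S) (k Sᶜ.card (sub x Sᶜ) m) := by
        intro S
        have hc : S.card + Sᶜ.card = n := by simp [Finset.card_add_card_compl S]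
        have big : ∀ T : Finset (Fin n), 3 ≤ T.card → ∀ m, k T.card (sub x T) m = 0 :=
          fun T hT m => by rw [k_pos _ _ _ (by omega), hκ.other _ _ (by omega) (by omega)]; simp
        have lin : ∀ T : Finset (Fin n), k T.card (sub x T) 0 = 0 := by
          intro T
          rcases Nat.eq_zero_or_pos T.card with hT | hT
          · rw [apply_of_eq_zero k hT, k_zero, map_zero]
          · rw [k_pos _ _ _ hT.ne', map_zero]
        by_cases b1 : 3 ≤ S.card
        · rw [big S b1, big S b1, lin]
        by_cases b2 : 3 ≤ Sᶜ.card
        · rw [big _ b2, big _ b2, lin]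
        rcases (by omega : S.card = 1 ∨ S.card = 2) with s1 | s1 <;>
          rcases (by omega : Sᶜ.card = 1 ∨ Sᶜ.card = 2) with s2 | s2
        · omega
        · rw [apply_of_eq_one k s1, apply_of_eq_two k s2]
          simp only [k_one, k_two, α_κ]
        · rw [apply_of_eq_two k s1, apply_of_eq_one k s2]
          simp only [k_one, k_two, α_κ]
        · rw [apply_of_eq_two k s1, apply_of_eq_two k s2]
          simp only [k_two]
          exact κ_κ _ _ _ _ _
      refine Finset.sum_involution (fun S _ => Sᶜ) ?_ ?_ (fun _ _ => Finset.mem_univ _)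
        (fun S _ => compl_compl S)
      · intro S _
        rw [compl_compl, h_comm, ← two_smul (ZMod 2)]
        simp [show (2 : ZMod 2) = 0 from rfl]
      · intro S _ _ hS
        have : (⟨0, by omega⟩ : Fin n) ∈ Sᶜ ↔ (⟨0, by omega⟩ : Fin n) ∈ S := by rw [hS]
        simp at this

end LInf

/-! ### The Lie superalgebras -/

theorem gradedPiece_eq_span {B : Type*} (deg : B → ℤ) (n : ℤ) :
    gradedPiece deg n = Submodule.span (ZMod 2) ((fun b => .single b 1) '' {b | deg b = n}) :=
  Finsupp.supported_eq_span_single _ _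

theorem single_mem_gradedPiece {B : Type*} {deg : B → ℤ} {n : ℤ} {b : B} (h : deg b = n)
    (c : ZMod 2) : .single b c ∈ gradedPiece deg n :=
  Finsupp.single_mem_supported _ _ h

/-- A linear map on a graded piece is controlled by its values on the basis. -/
theorem map_mem_of_gradedPiece {B W : Type*} [AddCommGroup W] [Module (ZMod 2) W] {deg : B → ℤ}
    {n : ℤ} {U : Submodule (ZMod 2) W} (f : (B →₀ ZMod 2) →ₗ[ZMod 2] W)
    (h : ∀ b, deg b = n → f (.single b 1) ∈ U) {y : B →₀ ZMod 2} (hy : y ∈ gradedPiece deg n) :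
    f y ∈ U := by
  have : gradedPiece deg n ≤ U.comap f := by
    rw [gradedPiece_eq_span, Submodule.span_le]
    rintro _ ⟨b, hb, rfl⟩
    exact h b hb
  exact this hy

theorem bilinear_mem_of_gradedPiece {B W : Type*} [AddCommGroup W] [Module (ZMod 2) W]
    {deg : B → ℤ} {m n : ℤ} {U : Submodule (ZMod 2) W}
    (f : (B →₀ ZMod 2) →ₗ[ZMod 2] (B →₀ ZMod 2) →ₗ[ZMod 2] W)
    (h : ∀ b b', deg b = m → deg b' = n → f (.single b 1) (.single b' 1) ∈ U)
    {y z : B →₀ ZMod 2} (hy : y ∈ gradedPiece deg m) (hz : z ∈ gradedPiece deg n) :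
    f y z ∈ U :=
  map_mem_of_gradedPiece (f.flip z) (fun b hb =>
    map_mem_of_gradedPiece (f (.single b 1)) (fun b' hb' => h b b' hb hb') hz) hy

theorem gradedPiece_isInternal {B : Type*} (deg : B → ℤ) :
    DirectSum.IsInternal (gradedPiece deg) := by
  rw [DirectSum.isInternal_submodule_iff_iSupIndep_and_iSup_eq_top]
  constructor
  · intro n
    refine Disjoint.mono_right (iSup₂_le fun j hj =>
      Finsupp.supported_mono (t := {b | deg b ≠ n}) ?_) ?_
    · rintro b rfl
      exact hj
    · exact Finsupp.disjoint_supported_supported (Set.disjoint_left.2 fun b hb hb' => hb' hb)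
  · have e : (⨆ j, gradedPiece deg j) =
        Finsupp.supported (ZMod 2) (ZMod 2) (⋃ j, {b | deg b = j}) := by
      simp only [Finsupp.supported_iUnion, gradedPiece]
    rw [e, eq_top_iff, ← Finsupp.supported_univ]
    exact Finsupp.supported_mono fun b _ => Set.mem_iUnion.2 ⟨_, rfl⟩

theorem bilinear_ext {B W : Type*} [AddCommGroup W] [Module (ZMod 2) W]
    {f g : (B →₀ ZMod 2) →ₗ[ZMod 2] (B →₀ ZMod 2) →ₗ[ZMod 2] W}
    (h : ∀ b b', f (.single b 1) (.single b' 1) = g (.single b 1) (.single b' 1)) : f = g :=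
  Finsupp.lhom_ext' fun b => LinearMap.ext_ring <| Finsupp.lhom_ext' fun b' =>
    LinearMap.ext_ring <| h b b'

theorem bilinearOfTable_single {B : Type*} (T : B → B → (B →₀ ZMod 2)) (b b' : B) :
    bilinearOfTable T (.single b 1) (.single b' 1) = T b b' := by
  simp [bilinearOfTable]

theorem ZMod.two_eq_zero_of_two : (2 : ZMod 2) = 0 := rfl

namespace SlWedge

theorem isDgOps : LInf.IsDgOps ops 0 bracket where
  one _ := rfl
  two _ := rfl
  other n _ h1 h2 := by
    match n, h1, h2 with
    | 0, _, _ => rfl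
    | n + 3, _, _ => rfl

theorem bracket_single (b b' : WedgeBasis) :
    bracket (.single b 1) (.single b' 1) = b.table b' := bilinearOfTable_single _ b b'

theorem bracket_comm (y z : SlWedge) : bracket y z = bracket z y := by
  have : bracket = bracket.flip := bilinear_ext fun b b' => by
    rw [LinearMap.flip_apply, bracket_single, bracket_single]
    cases b <;> cases b' <;> rfl
  exact congrArg (fun f => f y z) this

theorem bracket_table (b b' : WedgeBasis) : bracket (b.table b') = 0 := by
  have hh : bracket (.single .h 1) = 0 := Finsupp.lhom_ext' fun c => LinearMap.ext_ring <| by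
    simp only [LinearMap.comp_apply, Finsupp.lsingle_apply, bracket_single, LinearMap.zero_apply]
    cases c <;> simp [WedgeBasis.table, ZMod.two_eq_zero_of_two]
  have h0 : bracket (.single .v0 1) = 0 := Finsupp.lhom_ext' fun c => LinearMap.ext_ring <| by
    simp only [LinearMap.comp_apply, Finsupp.lsingle_apply, bracket_single, LinearMap.zero_apply]
    cases c <;> simp [WedgeBasis.table, ZMod.two_eq_zero_of_two]
  cases b <;> cases b' <;> simp [WedgeBasis.table, ZMod.two_eq_zero_of_two, hh, h0]

/-- Modulo `2`, all brackets lie in the span of the central elements `h` and `v_0`. -/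
theorem bracket_bracket (x y z : SlWedge) : bracket (bracket x y) z = 0 := by
  have : bracket.compr₂ bracket = 0 := bilinear_ext (W := SlWedge →ₗ[ZMod 2] SlWedge) fun b b' => by
    change bracket (bracket (.single b 1) (.single b' 1)) = 0
    rw [bracket_single, bracket_table]
  exact congrArg (fun f => f x y z) this

theorem bracket_mem (a a' : ℤ) (y : SlWedge) (hy : y ∈ grading a) (z : SlWedge)
    (hz : z ∈ grading a') : bracket y z ∈ grading (a + a') :=
  bilinear_mem_of_gradedPiece bracket (fun b b' hb hb' => by
    rw [bracket_single, ← hb, ← hb']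
    cases b <;> cases b' <;>
      first | exact zero_mem _ | exact single_mem_gradedPiece (by rfl) _) hy hz

theorem isAlgebra : LInf.IsAlgebra grading ops :=
  isDgOps.isAlgebra (gradedPiece_isInternal _) (fun _ _ _ => zero_mem _) bracket_mem bracket_comm
    (fun _ => rfl) (fun x y => by simp) bracket_bracket

end SlWedge

namespace SlDg

theorem isDgOps : LInf.IsDgOps ops diff bracket where
  one _ := rfl
  two _ := rfl
  other n _ h1 h2 := by
    match n, h1, h2 with
    | 0, _, _ => rfl
    | n + 3, _, _ => rfl

theorem bracket_single (b b' : DgBasis) :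
    bracket (.single b 1) (.single b' 1) = b.table b' := bilinearOfTable_single _ b b'

theorem bracket_comm (y z : SlDg) : bracket y z = bracket z y := by
  have : bracket = bracket.flip := bilinear_ext fun b b' => by
    rw [LinearMap.flip_apply, bracket_single, bracket_single]
    cases b <;> cases b' <;> rfl
  exact congrArg (fun f => f y z) this

theorem bracket_table (b b' : DgBasis) : bracket (b.table b') = 0 := by
  have hh : bracket (.single .h 1) = 0 := Finsupp.lhom_ext' fun c => LinearMap.ext_ring <| by
    simp only [LinearMap.comp_apply, Finsupp.lsingle_apply, bracket_single, LinearMap.zero_apply]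
    cases c <;> simp [DgBasis.table, ZMod.two_eq_zero_of_two]
  have h0 : bracket (.single .v0 1) = 0 := Finsupp.lhom_ext' fun c => LinearMap.ext_ring <| by
    simp only [LinearMap.comp_apply, Finsupp.lsingle_apply, bracket_single, LinearMap.zero_apply]
    cases c <;> simp [DgBasis.table, ZMod.two_eq_zero_of_two]
  have hx : bracket (.single .x 1) = 0 := Finsupp.lhom_ext' fun c => LinearMap.ext_ring <| by
    simp only [LinearMap.comp_apply, Finsupp.lsingle_apply, bracket_single, LinearMap.zero_apply]
    cases c <;> simp [DgBasis.table]
  cases b <;> cases b' <;> simp [DgBasis.table, ZMod.two_eq_zero_of_two, hh, h0, hx]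

/-- Modulo `2`, all brackets lie in the span of the central elements `h`, `ṽ_0` and `x`. -/
theorem bracket_bracket (x y z : SlDg) : bracket (bracket x y) z = 0 := by
  have : bracket.compr₂ bracket = 0 := bilinear_ext (W := SlDg →ₗ[ZMod 2] SlDg) fun b b' => by
    change bracket (bracket (.single b 1) (.single b' 1)) = 0
    rw [bracket_single, bracket_table]
  exact congrArg (fun f => f x y z) this

theorem bracket_mem (a a' : ℤ) (y : SlDg) (hy : y ∈ grading a) (z : SlDg)
    (hz : z ∈ grading a') : bracket y z ∈ grading (a + a') :=
  bilinear_mem_of_gradedPiece bracket (fun b b' hb hb' => by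
    rw [bracket_single, ← hb, ← hb']
    cases b <;> cases b' <;>
      first | exact zero_mem _ | exact single_mem_gradedPiece (by rfl) _) hy hz

theorem diff_mem (a : ℤ) (y : SlDg) (hy : y ∈ grading a) : diff y ∈ grading (a + 1) := by
  rw [add_comm]
  exact bracket_mem 1 a _ (single_mem_gradedPiece rfl 1) y hy

theorem diff_diff (y : SlDg) : diff (diff y) = 0 := by
  rw [diff, bracket_comm, bracket_bracket]

theorem diff_bracket (y z : SlDg) : diff (bracket y z) = 0 := by
  rw [diff, bracket_comm, bracket_bracket]

theorem isAlgebra : LInf.IsAlgebra grading ops :=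
  isDgOps.isAlgebra (gradedPiece_isInternal _) diff_mem bracket_mem bracket_comm diff_diff
    (fun x y => by rw [diff_bracket]; simp [diff, bracket_bracket]) bracket_bracket

/-! ### The contraction and the transferred structure -/

theorem isContraction : LInf.IsContraction grading diff SlH.grading 0 incl proj homotopy where
  chain_i := Finsupp.lhom_ext' fun b => LinearMap.ext_ring <| by
    rcases b with b | _
    · cases b <;> simp [incl, diff, bracket_single, DgBasis.table]
    · simp [incl, diff, bracket_single, DgBasis.table]
  chain_q := Finsupp.lhom_ext' fun b => LinearMap.ext_ring <| by
    cases b <;> simp [proj, diff, bracket_single, DgBasis.table]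
  degree_i a y hy := map_mem_of_gradedPiece incl (fun b hb => by
    rw [← hb]
    rcases b with b | _
    · cases b <;> simp [incl] <;> exact single_mem_gradedPiece (by rfl) _
    · simp [incl]; exact single_mem_gradedPiece (by rfl) _) hy
  degree_q a y hy := map_mem_of_gradedPiece proj (fun b hb => by
    rw [← hb]
    cases b <;> simp [proj] <;> exact single_mem_gradedPiece (by rfl) _) hy
  degree_K a y hy := map_mem_of_gradedPiece homotopy (fun b hb => by
    rw [← hb]
    cases b <;> simp [homotopy]
    exact single_mem_gradedPiece (by rfl) _) hy
  q_i := Finsupp.lhom_ext' fun b => LinearMap.ext_ring <| by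
    rcases b with b | _
    · cases b <;> simp [incl, proj]
    · simp [incl, proj]
  homotopy := Finsupp.lhom_ext' fun b => LinearMap.ext_ring <| by
    cases b <;> simp [incl, proj, homotopy, diff, bracket_single, DgBasis.table]
  K_K := Finsupp.lhom_ext' fun b => LinearMap.ext_ring <| by
    cases b <;> simp [homotopy]
  K_i := Finsupp.lhom_ext' fun b => LinearMap.ext_ring <| by
    rcases b with b | _
    · cases b <;> simp [incl, homotopy]
    · simp [incl, homotopy]
  q_K := Finsupp.lhom_ext' fun b => LinearMap.ext_ring <| by
    cases b <;> simp [homotopy, proj]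

end SlDg

namespace LInf

theorem card_block_lt {n r : ℕ} (hr : 2 ≤ r) {c : Fin n → Fin r} (hc : c ∈ setPartitions n r)
    (a : Fin r) : (block c a).card < n := by
  have hs : Function.Surjective c := (Finset.mem_filter.1 hc).2.1
  obtain ⟨b, hb⟩ : ∃ b : Fin r, b ≠ a := by
    have : Nontrivial (Fin r) := Fin.nontrivial_iff_two_le.2 hr
    exact exists_ne a
  obtain ⟨i, hi⟩ := hs b
  have := Finset.card_lt_univ_of_notMem (s := block c a) (x := i) (by simp [block, hi, hb])
  simpa using this

variable {V V' : Type*} [AddCommGroup V] [Module (ZMod 2) V] [AddCommGroup V'] [Module (ZMod 2) V']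

theorem transferI_eq_transferTheta (l : ∀ n : ℕ, (Fin n → V) → V) (i : V' →ₗ[ZMod 2] V)
    (K : V →ₗ[ZMod 2] V) {n : ℕ} (hn : 2 ≤ n) (x : Fin n → V') :
    transferI l i K n x = K (transferTheta l i K n x) := by
  obtain ⟨n, rfl⟩ := Nat.exists_eq_add_of_le' hn
  rw [transferI, transferTheta]
  congr 1
  refine Finset.sum_congr rfl fun r hr => Finset.sum_congr rfl fun c hc => ?_
  congr 1
  funext a
  rw [dif_pos (card_block_lt (Finset.mem_Icc.1 hr).1 hc a)]

end LInf

namespace SlDg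

/-- The inclusion of `sl₂(∧)` into `sl₂(∧)_dg`, the linear part of the homomorphism `I`. -/
noncomputable def ofWedge : SlWedge →ₗ[ZMod 2] SlDg := incl ∘ₗ SlWedge.toH

/-- The quadratic part of the homomorphism `I`. -/
noncomputable def ofWedgeTwo : SlWedge →ₗ[ZMod 2] SlWedge →ₗ[ZMod 2] SlDg :=
  (bracket.compl₁₂ ofWedge ofWedge).compr₂ homotopy

theorem ofWedgeTwo_apply (y z : SlWedge) :
    ofWedgeTwo y z = homotopy (bracket (ofWedge y) (ofWedge z)) := rfl

/-- The homotopy takes values in the line through `D`, which commutes with itself and with the image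
of `sl₂(∧)`. This is why the transfer stops after `I_2`. -/
theorem homotopy_mem (y : SlDg) : homotopy y ∈ Submodule.span (ZMod 2) {(.single .D 1 : SlDg)} := by
  have : (⊤ : Submodule (ZMod 2) SlDg) ≤
      (Submodule.span (ZMod 2) {(.single .D 1 : SlDg)}).comap homotopy := by
    rw [← Finsupp.supported_univ, Finsupp.supported_eq_span_single, Submodule.span_le]
    rintro _ ⟨b, -, rfl⟩
    cases b <;> simp [homotopy, Submodule.mem_span_singleton_self]
  exact this trivial

theorem bracket_ofWedge_of_mem (y : SlWedge) (u : SlDg)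
    (hu : u ∈ Submodule.span (ZMod 2) {(.single .D 1 : SlDg)}) : bracket (ofWedge y) u = 0 := by
  obtain ⟨c, rfl⟩ := Submodule.mem_span_singleton.1 hu
  have : bracket (.single .D 1) ∘ₗ ofWedge = 0 :=
    Finsupp.lhom_ext' fun b => LinearMap.ext_ring <| by
    cases b <;> simp [ofWedge, incl, SlWedge.toH, bracket_single, DgBasis.table]
  rw [map_smul, bracket_comm]
  exact (congrArg (c • ·) (LinearMap.congr_fun this y)).trans (smul_zero c)

theorem bracket_of_mem_of_mem (u v : SlDg)
    (hu : u ∈ Submodule.span (ZMod 2) {(.single .D 1 : SlDg)})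
    (hv : v ∈ Submodule.span (ZMod 2) {(.single .D 1 : SlDg)}) : bracket u v = 0 := by
  obtain ⟨c, rfl⟩ := Submodule.mem_span_singleton.1 hu
  obtain ⟨c', rfl⟩ := Submodule.mem_span_singleton.1 hv
  rw [map_smul, map_smul, LinearMap.smul_apply, bracket_single]
  simp [DgBasis.table]

theorem transferTheta_toH {n : ℕ} (y : Fin n → SlWedge) :
    LInf.transferTheta ops incl homotopy n (SlWedge.toH ∘ y) =
    if h : n = 2 then bracket (ofWedge (y ⟨0, by omega⟩)) (ofWedge (y ⟨1, by omega⟩)) else 0 := by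
  rw [← LInf.sum_setPartitions_ge_two isDgOps
    (f := fun n y => homologyI n (SlWedge.toH ∘ y)) (φ := ofWedge)
    (fun x => by simp [homologyI, LInf.transferI, ofWedge]) _ bracket_ofWedge_of_mem
    (fun x u hu => by rw [bracket_comm, bracket_ofWedge_of_mem x u hu])
    (fun u hu v hv => bracket_of_mem_of_mem u v hu hv)
    (fun m hm _ x => by
      rw [homologyI, LInf.transferI_eq_transferTheta _ _ _ hm]; exact homotopy_mem _)]
  rfl

theorem isDgOps_homologyI :
    LInf.IsDgOps (fun n y => homologyI n (SlWedge.toH ∘ y)) ofWedge ofWedgeTwo where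
  one x := by simp [homologyI, LInf.transferI, ofWedge]
  two x := by
    simp only [homologyI]
    rw [LInf.transferI_eq_transferTheta _ _ _ le_rfl, transferTheta_toH]
    rfl
  other n x h1 h2 := by
    rcases Nat.eq_zero_or_pos n with rfl | hn
    · rw [homologyI, LInf.transferI]
    · simp only [homologyI]
      rw [LInf.transferI_eq_transferTheta _ _ _ (by omega), transferTheta_toH,
        dif_neg h2, map_zero]

theorem homologyOps_toH (n : ℕ) (y : Fin n → SlWedge) :
    homologyOps n (SlWedge.toH ∘ y) = SlWedge.toH (SlWedge.ops n y) := by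
  match n with
  | 0 => simp [homologyOps, LInf.transferOps, SlWedge.ops]
  | 1 => simp [homologyOps, LInf.transferOps, SlWedge.ops]
  | n + 2 =>
    rw [homologyOps, LInf.transferOps, transferTheta_toH]
    split_ifs with h
    · obtain rfl : n = 0 := by omega
      have : (bracket.compl₁₂ ofWedge ofWedge).compr₂ proj =
          SlWedge.bracket.compr₂ SlWedge.toH := bilinear_ext fun b b' => by
        simp only [LinearMap.compr₂_apply, LinearMap.compl₁₂_apply, SlWedge.bracket_single]
        cases b <;> cases b' <;> simp [ofWedge, incl, SlWedge.toH, bracket_single, DgBasis.table,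
          WedgeBasis.table, proj, ZMod.two_eq_zero_of_two]
      exact congrArg (fun f => f (y 0) (y 1)) this
    · rw [map_zero, SlWedge.isDgOps.other _ _ (by omega) h, map_zero]

theorem ofWedge_mem (a : ℤ) (y : SlWedge) (hy : y ∈ SlWedge.grading a) : ofWedge y ∈ grading a :=
  isContraction.degree_i _ _ (map_mem_of_gradedPiece (U := SlH.grading a) SlWedge.toH
    (fun b hb => by
    simp only [SlWedge.toH, Finsupp.lmapDomain_apply, Finsupp.mapDomain_single]
    exact single_mem_gradedPiece (deg := HBasis.deg) (b := .wedge b) hb 1) hy)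

theorem ofWedgeTwo_mem (a a' : ℤ) (y : SlWedge) (hy : y ∈ SlWedge.grading a) (z : SlWedge)
    (hz : z ∈ SlWedge.grading a') : ofWedgeTwo y z ∈ grading (a + a' - 1) :=
  isContraction.degree_K _ _ (bracket_mem _ _ _ (ofWedge_mem _ _ hy) _ (ofWedge_mem _ _ hz))

theorem ofWedgeTwo_comm (y z : SlWedge) : ofWedgeTwo y z = ofWedgeTwo z y := by
  rw [ofWedgeTwo_apply, bracket_comm]; rfl

/-- The inclusion of `sl₂(∧)` fails to be multiplicative only by `[v_2, v_{-2}] = x = -[d, D]`, and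
`ofWedgeTwo v_2 v_{-2} = -D` compensates for this. -/
theorem ofWedge_bracket (y z : SlWedge) : ofWedge (SlWedge.bracket y z) +
    (diff (ofWedgeTwo y z) + bracket (ofWedge y) (ofWedge z)) = 0 := by
  have : SlWedge.bracket.compr₂ ofWedge +
      (ofWedgeTwo.compr₂ diff + bracket.compl₁₂ ofWedge ofWedge) = 0 := bilinear_ext fun b b' => by
    simp only [LinearMap.add_apply, LinearMap.compr₂_apply, LinearMap.compl₁₂_apply,
      SlWedge.bracket_single, ofWedgeTwo_apply]
    cases b <;> cases b' <;> simp [ofWedge, incl, SlWedge.toH, bracket_single, DgBasis.table,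
      WedgeBasis.table, homotopy, diff, ZMod.two_eq_zero_of_two,
      ← Finsupp.single_add, CharTwo.add_self_eq_zero]
  exact congrArg (fun f => f y z) this

theorem ofWedgeTwo_bracket (x y z : SlWedge) : ofWedgeTwo (SlWedge.bracket x y) z = 0 := by
  have e : ofWedge (SlWedge.bracket x y) =
      -(diff (ofWedgeTwo x y) + bracket (ofWedge x) (ofWedge y)) :=
    eq_neg_of_add_eq_zero_left (ofWedge_bracket x y)
  rw [ofWedgeTwo_apply, e]
  simp [diff, bracket_bracket]

theorem diff_ofWedge (y : SlWedge) : diff (ofWedge y) = 0 :=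
  LinearMap.congr_fun isContraction.chain_i (SlWedge.toH y)

theorem isHom : LInf.IsHom SlWedge.grading SlWedge.ops grading ops
    (fun n y => homologyI n (SlWedge.toH ∘ y)) :=
  SlWedge.isDgOps.isHom isDgOps isDgOps_homologyI ofWedge_mem ofWedgeTwo_mem ofWedgeTwo_comm
    ofWedgeTwo_bracket _ bracket_ofWedge_of_mem
    (fun x u hu => by rw [bracket_comm, bracket_ofWedge_of_mem x u hu])
    (fun u hu v hv => bracket_of_mem_of_mem u v hu hv) (fun _ _ => homotopy_mem _) diff_ofWedge
    ofWedge_bracket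

end SlDg

/-! ### Orbits of a permutation multiplied by a transposition -/

namespace Equiv.Perm

variable {α β : Type*}

theorem SameCycle.eq_of_invariant {σ : Perm α} {g : α → β} (h : ∀ a, g (σ a) = g a) {a b : α}
    (hab : σ.SameCycle a b) : g a = g b := by
  obtain ⟨i, rfl⟩ := hab
  have key : ∀ i : ℤ, ∀ a, g ((σ ^ i) a) = g a := by
    intro i
    induction i with
    | zero => simp
    | succ n ih => intro a; rw [zpow_add_one, mul_apply, ih, h]
    | pred n ih =>
      intro a
      rw [zpow_sub_one, mul_apply, ih, ← h]
      simp
  exact (key i a).symm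

theorem not_sameCycle_of_pow_eq {σ : Perm α} {p q : α} {m : ℕ} (hm : 0 < m)
    (h : (σ ^ m) p = p) (hq : ∀ j < m, (σ ^ j) p ≠ q) : ¬ σ.SameCycle p q := by
  rintro ⟨i, hi⟩
  have hm' : (m : ℤ) ≠ 0 := by omega
  have h1 : ((σ ^ m) ^ (i / m)) p = p := zpow_apply_eq_self_of_apply_eq_self h _
  have h2 : 0 ≤ i % m := Int.emod_nonneg _ hm'
  have h3 : i % m < m := Int.emod_lt_of_pos _ (by omega)
  obtain ⟨j, hj⟩ := Int.eq_ofNat_of_zero_le h2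
  refine hq j (by omega) ?_
  rw [← hi]
  conv_rhs => rw [← Int.emod_add_mul_ediv i m, zpow_add, mul_apply, zpow_mul, zpow_natCast, h1, hj,
    zpow_natCast]

variable [Finite α] [DecidableEq α]

/-- A transposition of two points merges their orbits if these are different, and separates the two
points otherwise. -/
theorem sameCycle_mul_swap (σ : Perm α) {p q : α} (hpq : p ≠ q) :
    (σ * swap p q).SameCycle p q ↔ ¬ σ.SameCycle p q := by
  classical
  have ex : ∃ m, 0 < m ∧ ((σ ^ m) p = p ∨ (σ ^ m) p = q) :=
    ⟨orderOf σ, orderOf_pos σ, by simp [pow_orderOf_eq_one]⟩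
  obtain ⟨hm, hmp⟩ := Nat.find_spec ex
  set m := Nat.find ex
  have hmin : ∀ j, 0 < j → j < m → (σ ^ j) p ≠ p ∧ (σ ^ j) p ≠ q := fun j hj hjm =>
    not_or.1 fun h => Nat.find_min ex hjm ⟨hj, h⟩
  -- up to the first return to `{p, q}`, the orbit of `q` under the product is that of `p` under `σ`
  have key : ∀ j, 0 < j → j ≤ m → ((σ * swap p q) ^ j) q = (σ ^ j) p := by
    intro j hj
    induction j, hj using Nat.le_induction with
    | base => intro _; simp
    | succ j hj ih =>
      intro hjm
      obtain ⟨h1, h2⟩ := hmin j hj (by omega)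
      rw [pow_succ', mul_apply, ih (by omega), pow_succ', mul_apply, mul_apply,
        swap_apply_of_ne_of_ne h1 h2]
  rcases hmp with h | h
  · refine iff_of_true (SameCycle.symm ⟨m, ?_⟩) (not_sameCycle_of_pow_eq hm h fun j hj => ?_)
    · rw [zpow_natCast, key m hm le_rfl, h]
    · rcases Nat.eq_zero_or_pos j with rfl | hj0
      · simpa using hpq
      · exact (hmin j hj0 hj).2
  · refine iff_of_false (fun hs => ?_) (not_not.2 ⟨m, by rw [zpow_natCast, h]⟩)
    refine not_sameCycle_of_pow_eq hm (p := q) (q := p) ?_ (fun j hj => ?_) hs.symm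
    · rw [key m hm le_rfl, h]
    · rcases Nat.eq_zero_or_pos j with rfl | hj0
      · simpa using hpq.symm
      · rw [key j hj0 hj.le]; exact (hmin j hj0 hj).1

end Equiv.Perm

/-! ### Merging two fibers -/

/-- The fibers of `f'` are those of `f`, except that the distinct fibers of `p` and `q` are
merged. -/
structure IsMerge {α C C' : Type*} (f : α → C) (f' : α → C') (p q : α) : Prop where
  ne : f p ≠ f q
  eq_iff : ∀ a b, f' a = f' b ↔
    f a = f b ∨ ((f a = f p ∨ f a = f q) ∧ (f b = f p ∨ f b = f q))

theorem eq_or_of_eq_of_mul_swap {α C C' : Type*} [DecidableEq α] {f : α → C} {f' : α → C'}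
    {σ σ' : Equiv.Perm α} (hf : ∀ a b, f a = f b ↔ σ.SameCycle a b)
    (hf' : ∀ a b, f' a = f' b ↔ σ'.SameCycle a b) {p q : α} (hσ : σ' = σ * Equiv.swap p q)
    (a b : α) (hab : f' a = f' b) :
    f a = f b ∨ ((f a = f p ∨ f a = f q) ∧ (f b = f p ∨ f b = f q)) := by
  classical
  have hσf : ∀ a, f (σ a) = f a := fun a => ((hf _ _).2 ⟨1, by simp⟩ : f a = f (σ a)).symm
  have h := Equiv.Perm.SameCycle.eq_of_invariant (g := fun a => if f a = f q then f p else f a)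
    (fun a => by
      rw [hσ, Equiv.Perm.mul_apply]
      simp only [hσf]
      rcases eq_or_ne a p with rfl | hp
      · simp
      rcases eq_or_ne a q with rfl | hq
      · simp
      rw [Equiv.swap_apply_of_ne_of_ne hp hq]) ((hf' _ _).1 hab)
  grind

theorem isMerge_or_of_mul_swap {α C C' : Type*} [Finite α] [DecidableEq α] {f : α → C}
    {f' : α → C'} {σ σ' : Equiv.Perm α} (hf : ∀ a b, f a = f b ↔ σ.SameCycle a b)
    (hf' : ∀ a b, f' a = f' b ↔ σ'.SameCycle a b) {p q : α} (hpq : p ≠ q)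
    (hσ : σ' = σ * Equiv.swap p q) : IsMerge f f' p q ∨ IsMerge f' f p q := by
  have h1 := eq_or_of_eq_of_mul_swap hf hf' hσ
  have h2 := eq_or_of_eq_of_mul_swap hf' hf (p := p) (q := q)
    (by rw [hσ, mul_assoc, Equiv.swap_mul_self, mul_one])
  have h3 := Equiv.Perm.sameCycle_mul_swap σ hpq
  rw [← hσ, ← hf, ← hf'] at h3
  by_cases h : f p = f q
  · exact Or.inr ⟨fun h' => h3.1 h' h, fun a b => ⟨h2 a b, fun h' => by grind⟩⟩
  · exact Or.inl ⟨h, fun a b => ⟨h1 a b, fun h' => by grind⟩⟩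

theorem isMerge_or_of_swap_mul {α C C' : Type*} [Finite α] [DecidableEq α] {f : α → C}
    {f' : α → C'} {σ σ' : Equiv.Perm α} (hf : ∀ a b, f a = f b ↔ σ.SameCycle a b)
    (hf' : ∀ a b, f' a = f' b ↔ σ'.SameCycle a b) {p q : α} (hpq : p ≠ q)
    (hσ : σ' = Equiv.swap p q * σ) : IsMerge f f' p q ∨ IsMerge f' f p q :=
  isMerge_or_of_mul_swap (σ := σ⁻¹) (σ' := σ'⁻¹)
    (fun a b => (hf a b).trans Equiv.Perm.sameCycle_inv.symm)
    (fun a b => (hf' a b).trans Equiv.Perm.sameCycle_inv.symm) hpq (by simp [hσ])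

namespace IsMerge

variable {α C C' : Type*} {f : α → C} {f' : α → C'} {p q : α}

theorem merged_eq (h : IsMerge f f' p q) : f' p = f' q := (h.eq_iff p q).2 (by simp)

theorem sum_add_merged [Fintype C] [Fintype C'] [DecidableEq C] [DecidableEq C']
    (h : IsMerge f f' p q) (hf : Function.Surjective f) (hf' : Function.Surjective f')
    {F : C → ℤ} {F' : C' → ℤ}
    (hF : ∀ a, f a ≠ f p → f a ≠ f q → F (f a) = F' (f' a)) :
    ∑ c, F c + F' (f' p) = ∑ c, F' c + F (f p) + F (f q) := by
  have key : ∑ c ∈ (Finset.univ.erase (f p)).erase (f q), F c =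
      ∑ c ∈ Finset.univ.erase (f' p), F' c := by
    have hs : ∀ c, f (Function.surjInv hf c) = c := Function.surjInv_eq hf
    refine Finset.sum_bij (fun c _ => f' (Function.surjInv hf c)) ?_ ?_ ?_ ?_
    · intro c hc
      have := h.eq_iff (Function.surjInv hf c) p
      simp only [Finset.mem_erase, Finset.mem_univ, and_true] at hc ⊢
      rw [ne_eq, this, hs]
      grind
    · intro c hc c' hc' e
      have := (h.eq_iff _ _).1 e
      simp only [Finset.mem_erase, Finset.mem_univ, and_true] at hc hc'
      rw [hs, hs] at this
      grind
    · intro c' hc'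
      obtain ⟨a, rfl⟩ := hf' c'
      have := h.eq_iff a p
      have := h.eq_iff (Function.surjInv hf (f a)) a
      simp only [Finset.mem_erase, Finset.mem_univ, and_true] at hc'
      refine ⟨f a, ?_, ?_⟩
      · simp only [Finset.mem_erase, Finset.mem_univ, and_true]
        grind
      · grind
    · intro c hc
      simp only [Finset.mem_erase, Finset.mem_univ, and_true] at hc
      rw [← hF _ (by rw [hs]; exact hc.2) (by rw [hs]; exact hc.1), hs]
  rw [← Finset.add_sum_erase _ F (Finset.mem_univ (f p)),
    ← Finset.add_sum_erase _ F (Finset.mem_erase.2 ⟨h.ne.symm, Finset.mem_univ (f q)⟩),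
    ← Finset.add_sum_erase _ F' (Finset.mem_univ (f' p)), key]
  ring

end IsMerge

/-- The sum of `u` over a fiber of `f`. -/
def fiberSum {α C : Type*} [Fintype α] [DecidableEq C] (f : α → C) (u : α → ZMod 2) (c : C) :
    ZMod 2 :=
  ∑ a, if f a = c then u a else 0

section FiberSum

variable {α C C' : Type*} [Fintype α] [DecidableEq C] [DecidableEq C']

theorem fiberSum_add (f : α → C) (u v : α → ZMod 2) (c : C) :
    fiberSum f (u + v) c = fiberSum f u c + fiberSum f v c := by
  simp only [fiberSum, ← Finset.sum_add_distrib]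
  refine Finset.sum_congr rfl fun a _ => ?_
  split_ifs <;> simp

theorem fiberSum_single [DecidableEq α] (f : α → C) (a : α) (c : C) :
    fiberSum f (Pi.single a 1) c = if f a = c then 1 else 0 := by
  rw [fiberSum, Finset.sum_eq_single a]
  · simp
  · intro b _ hb; simp [hb]
  · simp

namespace IsMerge

variable {f : α → C} {f' : α → C'} {p q : α}

theorem fiberSum_of_ne (h : IsMerge f f' p q) (u : α → ZMod 2) {a : α} (hp : f a ≠ f p)
    (hq : f a ≠ f q) : fiberSum f' u (f' a) = fiberSum f u (f a) :=
  Finset.sum_congr rfl fun b _ => by simp [h.eq_iff, hp, hq]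

theorem fiberSum_merged (h : IsMerge f f' p q) (u : α → ZMod 2) :
    fiberSum f' u (f' p) = fiberSum f u (f p) + fiberSum f u (f q) := by
  simp only [fiberSum, ← Finset.sum_add_distrib]
  refine Finset.sum_congr rfl fun b _ => ?_
  have := h.ne
  have := h.eq_iff b p
  by_cases hp : f b = f p <;> by_cases hq : f b = f q <;> simp_all

end IsMerge

end FiberSum

/-- The possible shapes of a face of the cube of resolutions. Here `f₀₀`, `f₁₀`, `f₀₁`, `f₁₁` send a
point to the circle through it in the four resolutions of the face, and `p, q` and `p', q'` are the
points at the two crossings. Either neither change affects whether the other one is a merge, or both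
crossings join the same two circles, so that the second change splits what the first one has merged,
or both changes split the same circle and the second one merges the two parts again. -/
theorem face_cases {α C₀₀ C₁₀ C₀₁ C₁₁ : Type*} {f₀₀ : α → C₀₀} {f₁₀ : α → C₁₀} {f₀₁ : α → C₀₁}
    {f₁₁ : α → C₁₁} {p q p' q' : α} (h₁ : IsMerge f₀₀ f₁₀ p q ∨ IsMerge f₁₀ f₀₀ p q)
    (h₂ : IsMerge f₁₀ f₁₁ p' q' ∨ IsMerge f₁₁ f₁₀ p' q')
    (h₃ : IsMerge f₀₀ f₀₁ p' q' ∨ IsMerge f₀₁ f₀₀ p' q')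
    (h₄ : IsMerge f₀₁ f₁₁ p q ∨ IsMerge f₁₁ f₀₁ p q) :
    ((f₀₀ p = f₀₀ q ↔ f₀₁ p = f₀₁ q) ∧ (f₀₀ p' = f₀₀ q' ↔ f₁₀ p' = f₁₀ q')) ∨
    (f₀₀ p ≠ f₀₀ q ∧ f₁₀ p' = f₁₀ q' ∧ f₀₀ p' ≠ f₀₀ q' ∧ f₀₁ p = f₀₁ q ∧
      ((f₁₁ p = f₁₁ p' ∧ f₁₁ q = f₁₁ q') ∨ (f₁₁ p = f₁₁ q' ∧ f₁₁ q = f₁₁ p'))) ∨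
    (f₀₀ p = f₀₀ q ∧ f₁₀ p' ≠ f₁₀ q' ∧ f₀₀ p' = f₀₀ q' ∧ f₀₁ p ≠ f₀₁ q ∧
      f₁₁ p = f₁₁ q ∧ f₁₁ p' = f₁₁ q') := by
  rcases h₁ with ⟨n₁, e₁⟩ | ⟨n₁, e₁⟩ <;> rcases h₂ with ⟨n₂, e₂⟩ | ⟨n₂, e₂⟩ <;>
    rcases h₃ with ⟨n₃, e₃⟩ | ⟨n₃, e₃⟩ <;> rcases h₄ with ⟨n₄, e₄⟩ | ⟨n₄, e₄⟩ <;>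
    have a₁ := e₁ p q <;> have a₂ := e₂ p' q' <;> have a₃ := e₃ p' q' <;> have a₄ := e₄ p q <;>
    have b₁ := e₁ p' q' <;> have b₂ := e₂ p q <;> have b₃ := e₃ p q <;> have b₄ := e₄ p' q' <;>
    have c₂ := e₂ p p' <;> have c₂' := e₂ q q' <;> have d₂ := e₂ p q' <;> have d₂' := e₂ q p' <;>
    clear e₁ e₂ e₃ e₄ <;> grind

/-! ### The circles of a resolution as orbits of a permutation -/

namespace Piece

theorem not_isCross_smooth (p : Piece) (b : Bool) : (p.smooth b).isCross = false ∨
    p.isCross = false := by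
  cases p <;> simp [smooth, isCross]
  split_ifs <;> simp

theorem Fits.smooth {p : Piece} {w w' : ℕ} (h : p.Fits w w') (b : Bool) :
    (p.smooth b).Fits w w' := by
  cases p <;> try exact h
  simp only [Piece.smooth]
  split_ifs
  · exact h
  · exact h.2

theorem Through.even_iff {p : Piece} (hp : p.isCross = false) {a b : ℕ} (h : p.Through a b) :
    Even a ↔ Even b := by
  cases p <;> simp only [Through, isCross] at h hp <;> simp only [Nat.even_iff] <;> grind

theorem BottomTurn.even_iff {p : Piece} {a b : ℕ} (h : p.BottomTurn a b) : Even a ↔ ¬ Even b := by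
  cases p <;> simp only [BottomTurn] at h <;> simp only [Nat.even_iff] <;> omega

theorem TopTurn.even_iff {p : Piece} {a b : ℕ} (h : p.TopTurn a b) : Even a ↔ ¬ Even b := by
  cases p <;> simp only [TopTurn] at h <;> simp only [Nat.even_iff] <;> omega

theorem Fits.exists_of_bottom {p : Piece} (hp : p.isCross = false) {w w' : ℕ} (h : p.Fits w w')
    {a : ℕ} (ha : a < w) :
    (∃ b < w', p.Through a b) ∨ ∃ b < w, p.BottomTurn a b ∨ p.BottomTurn b a := by
  cases p with
  | straight => exact Or.inl ⟨a, by simp_all [Fits], rfl⟩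
  | cup i =>
    simp only [Fits] at h
    by_cases hi : a < i
    · exact Or.inl ⟨a, by omega, Or.inl ⟨hi, rfl⟩⟩
    · exact Or.inl ⟨a + 2, by omega, Or.inr ⟨by omega, rfl⟩⟩
  | cap i =>
    simp only [Fits] at h
    rcases (by omega : a < i ∨ a = i ∨ a = i + 1 ∨ i + 2 ≤ a) with hi | hi | hi | hi
    · exact Or.inl ⟨a, by omega, Or.inl ⟨hi, rfl⟩⟩
    · exact Or.inr ⟨i + 1, by omega, Or.inl ⟨hi, rfl⟩⟩
    · exact Or.inr ⟨i, by omega, Or.inr ⟨rfl, hi⟩⟩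
    · exact Or.inl ⟨a - 2, by omega, Or.inr ⟨hi, by omega⟩⟩
  | hook i =>
    simp only [Fits] at h
    rcases (by omega : a < i ∨ a = i ∨ a = i + 1 ∨ i + 2 ≤ a) with hi | hi | hi | hi
    · exact Or.inl ⟨a, by omega, Or.inl hi, rfl⟩
    · exact Or.inr ⟨i + 1, by omega, Or.inl ⟨hi, rfl⟩⟩
    · exact Or.inr ⟨i, by omega, Or.inr ⟨rfl, hi⟩⟩
    · exact Or.inl ⟨a, by omega, Or.inr hi, rfl⟩
  | cross i ov => simp [isCross] at hp

theorem Fits.exists_of_top {p : Piece} (hp : p.isCross = false) {w w' : ℕ} (h : p.Fits w w')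
    {a : ℕ} (ha : a < w') :
    (∃ b < w, p.Through b a) ∨ ∃ b < w', p.TopTurn a b ∨ p.TopTurn b a := by
  cases p with
  | straight => exact Or.inl ⟨a, by simp_all [Fits], rfl⟩
  | cap i =>
    simp only [Fits] at h
    by_cases hi : a < i
    · exact Or.inl ⟨a, by omega, Or.inl ⟨hi, rfl⟩⟩
    · exact Or.inl ⟨a + 2, by omega, Or.inr ⟨by omega, rfl⟩⟩
  | cup i =>
    simp only [Fits] at h
    rcases (by omega : a < i ∨ a = i ∨ a = i + 1 ∨ i + 2 ≤ a) with hi | hi | hi | hi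
    · exact Or.inl ⟨a, by omega, Or.inl ⟨hi, rfl⟩⟩
    · exact Or.inr ⟨i + 1, by omega, Or.inl ⟨hi, rfl⟩⟩
    · exact Or.inr ⟨i, by omega, Or.inr ⟨rfl, hi⟩⟩
    · exact Or.inl ⟨a - 2, by omega, Or.inr ⟨by omega, by omega⟩⟩
  | hook i =>
    simp only [Fits] at h
    rcases (by omega : a < i ∨ a = i ∨ a = i + 1 ∨ i + 2 ≤ a) with hi | hi | hi | hi
    · exact Or.inl ⟨a, by omega, Or.inl hi, rfl⟩
    · exact Or.inr ⟨i + 1, by omega, Or.inl ⟨hi, rfl⟩⟩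
    · exact Or.inr ⟨i, by omega, Or.inr ⟨rfl, hi⟩⟩
    · exact Or.inl ⟨a, by omega, Or.inr hi, rfl⟩
  | cross i ov => simp [isCross] at hp

end Piece

namespace AnnularDiagram

variable {P : AnnularDiagram}

theorem Point.ext' {a b : P.Point} (h : a.1 = b.1) (h' : (a.2 : ℕ) = b.2) : a = b := by
  obtain ⟨t, a⟩ := a
  obtain ⟨s, b⟩ := b
  obtain rfl : t = s := h
  exact congrArg (Sigma.mk t) (Fin.ext h')

theorem resolved_isCross (r : P.Vertex) (t : Fin (P.height + 1)) :
    (resolved r t).isCross = false := by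
  rw [resolved]
  split_ifs with h
  · exact (Piece.not_isCross_smooth _ _).resolve_right (by simp [h])
  · simpa using h

theorem resolved_fits (r : P.Vertex) (t : Fin (P.height + 1)) :
    (resolved r t).Fits (P.width t) (P.width (t + 1)) := by
  rw [resolved]
  split_ifs
  · exact (P.fits t).smooth _
  · exact P.fits t

/-- A step along an arc of a sector between the rays `t` and `t'`, from position `i` on ray `s` to
position `j` on ray `s'`, if strands are oriented counterclockwise at even positions and clockwise
at odd ones. Without crossings, strands keep the parity of their position and arcs that turn back
change it, so that this is consistent. -/
def Step {T : Type*} (p : Piece) (t t' s : T) (i : ℕ) (s' : T) (j : ℕ) : Prop :=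
  (s = t ∧ s' = t' ∧ p.Through i j ∧ Even i) ∨
  (s = t' ∧ s' = t ∧ p.Through j i ∧ ¬ Even i) ∨
  (s = t ∧ s' = t ∧ (p.BottomTurn i j ∨ p.BottomTurn j i) ∧ Even i) ∨
  (s = t' ∧ s' = t' ∧ (p.TopTurn i j ∨ p.TopTurn j i) ∧ ¬ Even i)

/-- One step along a circle of a resolution. -/
def Next (r : P.Vertex) (a b : P.Point) : Prop :=
  ∃ t : Fin (P.height + 1), Step (resolved r t) t (t + 1) a.1 a.2 b.1 b.2

theorem exists_next (r : P.Vertex) (a : P.Point) : ∃ b, Next r a b := by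
  by_cases ha : Even (a.2 : ℕ)
  · rcases (resolved_fits r a.1).exists_of_bottom (resolved_isCross r _) a.2.2 with
      ⟨b, hb, h⟩ | ⟨b, hb, h⟩
    · exact ⟨⟨a.1 + 1, b, hb⟩, a.1, Or.inl ⟨rfl, rfl, h, ha⟩⟩
    · exact ⟨⟨a.1, b, hb⟩, a.1, Or.inr (Or.inr (Or.inl ⟨rfl, rfl, h, ha⟩))⟩
  · obtain ⟨t, ht⟩ : ∃ t, a.1 = t + 1 := ⟨a.1 - 1, by simp⟩
    have hw : (a.2 : ℕ) < P.width (t + 1) := ht ▸ a.2.2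
    rcases (resolved_fits r t).exists_of_top (resolved_isCross r _) hw with
      ⟨b, hb, h⟩ | ⟨b, hb, h⟩
    · exact ⟨⟨t, b, hb⟩, t, Or.inr (Or.inl ⟨ht, rfl, h, ha⟩)⟩
    · exact ⟨⟨t + 1, b, hb⟩, t, Or.inr (Or.inr (Or.inr ⟨ht, rfl, h, ha⟩))⟩

theorem Next.right_unique {r : P.Vertex} {a b b' : P.Point} (h : Next r a b) (h' : Next r a b') :
    b = b' := by
  obtain ⟨t, h⟩ := h
  obtain ⟨t', h'⟩ := h'
  by_cases ha : Even (a.2 : ℕ)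
  · obtain rfl : t = t' := by grind [Step]
    have hc := resolved_isCross r t
    have : b.1 = b'.1 ∧ (b.2 : ℕ) = b'.2 := by
      generalize resolved r t = p at *
      cases p <;> simp only [Step, Piece.Through, Piece.BottomTurn, Piece.TopTurn] at h h' <;> grind
    exact Point.ext' this.1 this.2
  · obtain rfl : t = t' := by
      have : t + 1 = t' + 1 := by grind [Step]
      exact add_right_cancel this
    have hc := resolved_isCross r t
    have : b.1 = b'.1 ∧ (b.2 : ℕ) = b'.2 := by
      generalize resolved r t = p at *
      cases p <;> simp only [Step, Piece.Through, Piece.BottomTurn, Piece.TopTurn] at h h' <;> grind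
    exact Point.ext' this.1 this.2

/-- A step that ends at an even position arrives at the later ray, by a strand or by an arc whose
ends are at the top, and a step that ends at an odd position arrives at the earlier ray. -/
theorem Step.end_cases {T : Type*} {p : Piece} (hp : p.isCross = false) {t t' s s' : T} {i j : ℕ}
    (h : Step p t t' s i s' j) :
    (Even j ∧ s' = t' ∧ ((s = t ∧ p.Through i j) ∨
      (s = t' ∧ (p.TopTurn i j ∨ p.TopTurn j i)))) ∨
    (¬ Even j ∧ s' = t ∧ ((s = t' ∧ p.Through j i) ∨
      (s = t ∧ (p.BottomTurn i j ∨ p.BottomTurn j i)))) := by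
  rcases h with ⟨h1, h2, h, ha⟩ | ⟨h1, h2, h, ha⟩ | ⟨h1, h2, h, ha⟩ | ⟨h1, h2, h, ha⟩
  · exact Or.inl ⟨(h.even_iff hp).1 ha, h2, Or.inl ⟨h1, h⟩⟩
  · exact Or.inr ⟨fun hb => ha ((h.even_iff hp).1 hb), h2, Or.inl ⟨h1, h⟩⟩
  · refine Or.inr ⟨?_, h2, Or.inr ⟨h1, h⟩⟩
    rcases h with h | h
    · exact h.even_iff.1 ha
    · exact fun hb => h.even_iff.1 hb ha
  · refine Or.inl ⟨?_, h2, Or.inr ⟨h1, h⟩⟩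
    rcases h with h | h
    · exact not_not.1 fun hb => ha (h.even_iff.2 hb)
    · exact h.even_iff.2 ha

theorem Next.left_unique {r : P.Vertex} {a a' b : P.Point} (h : Next r a b) (h' : Next r a' b) :
    a = a' := by
  obtain ⟨t, h⟩ := h
  obtain ⟨t', h'⟩ := h'
  replace h := h.end_cases (resolved_isCross r t)
  replace h' := h'.end_cases (resolved_isCross r t')
  have hc := resolved_isCross r t
  by_cases hb : Even (b.2 : ℕ)
  · obtain rfl : t = t' := by
      have : t + 1 = t' + 1 := by grind
      exact add_right_cancel this
    have : a.1 = a'.1 ∧ (a.2 : ℕ) = a'.2 := by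
      generalize resolved r t = p at *
      cases p <;> simp only [Piece.Through, Piece.BottomTurn, Piece.TopTurn] at h h' <;> grind
    exact Point.ext' this.1 this.2
  · obtain rfl : t = t' := by grind
    have : a.1 = a'.1 ∧ (a.2 : ℕ) = a'.2 := by
      generalize resolved r t = p at *
      cases p <;> simp only [Piece.Through, Piece.BottomTurn, Piece.TopTurn] at h h' <;> grind
    exact Point.ext' this.1 this.2

/-- The permutation of the points of the diagram whose orbits are the circles of `r`. -/
noncomputable def nextPerm (r : P.Vertex) : Equiv.Perm P.Point :=
  Equiv.ofBijective (fun a => (exists_next r a).choose)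
    (Finite.injective_iff_bijective.1 fun a a' h => by
      have h1 := (exists_next r a).choose_spec
      have h2 := (exists_next r a').choose_spec
      have h : (exists_next r a).choose = (exists_next r a').choose := h
      rw [h] at h1
      exact h1.left_unique h2)

theorem next_nextPerm (r : P.Vertex) (a : P.Point) : Next r a (nextPerm r a) :=
  (exists_next r a).choose_spec

theorem Next.eq_nextPerm {r : P.Vertex} {a b : P.Point} (h : Next r a b) : nextPerm r a = b :=
  (next_nextPerm r a).right_unique h

theorem circleOf_eq_of_next {r : P.Vertex} {a b : P.Point} (h : Next r a b) :
    circleOf r a = circleOf r b := by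
  have key : Joined r a b ∨ Joined r b a := by
    obtain ⟨t, h | h | ⟨h1, h2, h | h, -⟩ | ⟨h1, h2, h | h, -⟩⟩ := h
    · exact Or.inl ⟨t, Or.inl ⟨h.1, h.2.1, h.2.2.1⟩⟩
    · exact Or.inr ⟨t, Or.inl ⟨h.2.1, h.1, h.2.2.1⟩⟩
    · exact Or.inl ⟨t, Or.inr (Or.inl ⟨h1, h2, h⟩)⟩
    · exact Or.inr ⟨t, Or.inr (Or.inl ⟨h2, h1, h⟩)⟩
    · exact Or.inl ⟨t, Or.inr (Or.inr ⟨h1, h2, h⟩)⟩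
    · exact Or.inr ⟨t, Or.inr (Or.inr ⟨h2, h1, h⟩)⟩
  rcases key with h | h
  · exact Quotient.sound (Relation.EqvGen.rel _ _ h)
  · exact (Quotient.sound (Relation.EqvGen.rel _ _ h)).symm

theorem next_or_next_of_joined {r : P.Vertex} {a b : P.Point} (h : Joined r a b) :
    Next r a b ∨ Next r b a := by
  obtain ⟨t, ⟨h1, h2, h⟩ | ⟨h1, h2, h⟩ | ⟨h1, h2, h⟩⟩ := h
  · have e := h.even_iff (resolved_isCross r t)
    by_cases ha : Even (a.2 : ℕ)
    · exact Or.inl ⟨t, Or.inl ⟨h1, h2, h, ha⟩⟩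
    · exact Or.inr ⟨t, Or.inr (Or.inl ⟨h2, h1, h, fun hb => ha (e.2 hb)⟩)⟩
  · have e := h.even_iff
    by_cases ha : Even (a.2 : ℕ)
    · exact Or.inl ⟨t, Or.inr (Or.inr (Or.inl ⟨h1, h2, Or.inl h, ha⟩))⟩
    · exact Or.inr ⟨t, Or.inr (Or.inr (Or.inl ⟨h2, h1, Or.inr h, by tauto⟩))⟩
  · have e := h.even_iff
    by_cases ha : Even (a.2 : ℕ)
    · exact Or.inr ⟨t, Or.inr (Or.inr (Or.inr ⟨h2, h1, Or.inr h, by tauto⟩))⟩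
    · exact Or.inl ⟨t, Or.inr (Or.inr (Or.inr ⟨h1, h2, Or.inl h, ha⟩))⟩

theorem circleOf_eq_iff (r : P.Vertex) (a b : P.Point) :
    circleOf r a = circleOf r b ↔ (nextPerm r).SameCycle a b := by
  constructor
  · intro h
    have h' : Relation.EqvGen (Joined r) a b := Quotient.exact h
    clear h
    induction h' with
    | rel a b h =>
      rcases next_or_next_of_joined h with h | h
      · exact ⟨1, by simpa using h.eq_nextPerm⟩
      · exact Equiv.Perm.SameCycle.symm ⟨1, by simpa using h.eq_nextPerm⟩
    | refl a => exact Equiv.Perm.SameCycle.refl _ _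
    | symm a b h ih => exact ih.symm
    | trans a b c h h' ih ih' => exact ih.trans ih'
  · exact fun h => h.eq_of_invariant fun a => (circleOf_eq_of_next (next_nextPerm r a)).symm

theorem circleOf_surjective (r : P.Vertex) : Function.Surjective (circleOf r) :=
  Quotient.mk_surjective

/-! ### The effect of changing a smoothing -/

theorem resolved_of_ne {r r' : P.Vertex} {c : P.Crossing} (h : ∀ c', c' ≠ c → r' c' = r c')
    {t : Fin (P.height + 1)} (ht : t ≠ c.1) : resolved r' t = resolved r t := by
  rw [resolved, resolved]
  split_ifs with hc
  · rw [h ⟨t, hc⟩ fun e => ht (congrArg Subtype.val e)]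
  · rfl

theorem resolved_crossing {r r' : P.Vertex} {c : P.Crossing} (h : r' c ≠ r c) :
    (resolved r c.1 = .hook (P.piece c.1).pos ∧ resolved r' c.1 = .straight) ∨
    (resolved r c.1 = .straight ∧ resolved r' c.1 = .hook (P.piece c.1).pos) := by
  obtain ⟨t, hc⟩ := c
  simp only [resolved, hc, dite_true]
  generalize r ⟨t, hc⟩ = x at h
  generalize r' ⟨t, hc⟩ = y at h
  generalize P.piece t = p at hc
  cases p <;> simp_all [Piece.isCross, Piece.smooth, Piece.pos]
  cases x <;> cases y <;> simp_all

theorem bottomLeft_ne_topRight (c : P.Crossing) : bottomLeft c ≠ topRight c := by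
  intro h
  have h2 : ((bottomLeft c).2 : ℕ) = (topRight c).2 := by rw [h]
  simp [bottomLeft, topRight] at h2

/-! Away from the two ends of a crossing that are oriented into it, or away from the two ends that
are oriented out of it, both smoothings contain the same steps. -/

theorem Step.hook_of_start {T : Type*} {k : ℕ} (hk : Even k) {t t' s s' : T} {i j : ℕ}
    (h : Step .straight t t' s i s' j) (hp : s = t → i ≠ k) (hq : s = t' → i ≠ k + 1) :
    Step (.hook k) t t' s i s' j := by
  rcases h with ⟨rfl, rfl, h, hi⟩ | ⟨rfl, rfl, h, hi⟩ | ⟨rfl, rfl, h, hi⟩ | ⟨rfl, rfl, h, hi⟩ <;>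
    simp only [Piece.Through, Piece.BottomTurn, Piece.TopTurn, Nat.even_iff] at h hi hk
  · exact Or.inl ⟨rfl, rfl, ⟨by have := hp rfl; omega, h⟩, Nat.even_iff.2 hi⟩
  · exact Or.inr (Or.inl ⟨rfl, rfl, ⟨by have := hq rfl; omega, h⟩, by rwa [Nat.even_iff]⟩)
  · simp at h
  · simp at h

theorem Step.straight_of_start {T : Type*} {k : ℕ} (hk : Even k) {t t' s s' : T} {i j : ℕ}
    (h : Step (.hook k) t t' s i s' j) (hp : s = t → i ≠ k) (hq : s = t' → i ≠ k + 1) :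
    Step .straight t t' s i s' j := by
  rcases h with ⟨rfl, rfl, h, hi⟩ | ⟨rfl, rfl, h, hi⟩ | ⟨rfl, rfl, h, hi⟩ | ⟨rfl, rfl, h, hi⟩ <;>
    simp only [Piece.Through, Piece.BottomTurn, Piece.TopTurn, Nat.even_iff] at h hi hk
  · exact Or.inl ⟨rfl, rfl, h.2, Nat.even_iff.2 hi⟩
  · exact Or.inr (Or.inl ⟨rfl, rfl, h.2, by rwa [Nat.even_iff]⟩)
  · have := hp rfl; omega
  · have := hq rfl; omega

theorem Step.hook_of_end {T : Type*} {k : ℕ} (hk : ¬ Even k) {t t' s s' : T} {i j : ℕ}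
    (h : Step .straight t t' s i s' j) (hp : s' = t → j ≠ k) (hq : s' = t' → j ≠ k + 1) :
    Step (.hook k) t t' s i s' j := by
  rcases h with ⟨rfl, rfl, h, hi⟩ | ⟨rfl, rfl, h, hi⟩ | ⟨rfl, rfl, h, hi⟩ | ⟨rfl, rfl, h, hi⟩ <;>
    simp only [Piece.Through, Piece.BottomTurn, Piece.TopTurn, Nat.even_iff] at h hi hk
  · exact Or.inl ⟨rfl, rfl, ⟨by have := hq rfl; omega, h⟩, Nat.even_iff.2 hi⟩
  · exact Or.inr (Or.inl ⟨rfl, rfl, ⟨by have := hp rfl; omega, h⟩, by rwa [Nat.even_iff]⟩)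
  · simp at h
  · simp at h

theorem Step.straight_of_end {T : Type*} {k : ℕ} (hk : ¬ Even k) {t t' s s' : T} {i j : ℕ}
    (h : Step (.hook k) t t' s i s' j) (hp : s' = t → j ≠ k) (hq : s' = t' → j ≠ k + 1) :
    Step .straight t t' s i s' j := by
  rcases h with ⟨rfl, rfl, h, hi⟩ | ⟨rfl, rfl, h, hi⟩ | ⟨rfl, rfl, h, hi⟩ | ⟨rfl, rfl, h, hi⟩ <;>
    simp only [Piece.Through, Piece.BottomTurn, Piece.TopTurn, Nat.even_iff] at h hi hk
  · exact Or.inl ⟨rfl, rfl, h.2, Nat.even_iff.2 hi⟩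
  · exact Or.inr (Or.inl ⟨rfl, rfl, h.2, by rwa [Nat.even_iff]⟩)
  · have := hp rfl; omega
  · have := hq rfl; omega

/-- At a crossing whose bottom left end has an even position, the bottom left and the top right ends
are oriented into the crossing, and changing the smoothing exchanges the arcs that start there. -/
theorem Next.swap_left {r r' : P.Vertex} {c : P.Crossing} (h : ∀ c', c' ≠ c → r' c' = r c')
    (hc : r' c ≠ r c) (hpos : Even (P.piece c.1).pos) {a b : P.Point}
    (hab : Next r (Equiv.swap (bottomLeft c) (topRight c) a) b) : Next r' a b := by
  have hodd : ¬ Even ((P.piece c.1).pos + 1) := by simpa [Nat.even_add_one] using hpos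
  obtain ⟨t, hab⟩ := hab
  rcases eq_or_ne a (bottomLeft c) with rfl | hp
  · rw [Equiv.swap_apply_left] at hab
    change Step _ _ _ (c.1 + 1) ((P.piece c.1).pos + 1) _ _ at hab
    obtain rfl : t = c.1 := by
      have : c.1 + 1 = t + 1 := by grind [Step]
      exact (add_right_cancel this).symm
    refine ⟨c.1, ?_⟩
    change Step _ _ _ c.1 (P.piece c.1).pos _ _
    generalize (b.2 : ℕ) = j at *
    rcases resolved_crossing hc with ⟨h1, h2⟩ | ⟨h1, h2⟩ <;> rw [h1] at hab <;> rw [h2] <;>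
      simp only [Step, Piece.Through, Piece.BottomTurn, Piece.TopTurn] at hab ⊢ <;> grind
  rcases eq_or_ne a (topRight c) with rfl | hq
  · rw [Equiv.swap_apply_right] at hab
    change Step _ _ _ c.1 (P.piece c.1).pos _ _ at hab
    obtain rfl : t = c.1 := by grind [Step]
    refine ⟨c.1, ?_⟩
    change Step _ _ _ (c.1 + 1) ((P.piece c.1).pos + 1) _ _
    generalize (b.2 : ℕ) = j at *
    rcases resolved_crossing hc with ⟨h1, h2⟩ | ⟨h1, h2⟩ <;> rw [h1] at hab <;> rw [h2] <;>
      simp only [Step, Piece.Through, Piece.BottomTurn, Piece.TopTurn] at hab ⊢ <;> grind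
  rw [Equiv.swap_apply_of_ne_of_ne hp hq] at hab
  refine ⟨t, ?_⟩
  rcases eq_or_ne t c.1 with rfl | ht
  · have hp' : a.1 = c.1 → (a.2 : ℕ) ≠ (P.piece c.1).pos := fun h1 h2 => hp (Point.ext' h1 h2)
    have hq' : a.1 = c.1 + 1 → (a.2 : ℕ) ≠ (P.piece c.1).pos + 1 :=
      fun h1 h2 => hq (Point.ext' h1 h2)
    rcases resolved_crossing hc with ⟨h1, h2⟩ | ⟨h1, h2⟩ <;> rw [h1] at hab <;> rw [h2]
    · exact hab.straight_of_start hpos hp' hq'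
    · exact hab.hook_of_start hpos hp' hq'
  · rwa [resolved_of_ne h ht]

/-- At a crossing whose bottom left end has an odd position, the bottom left and the top right ends
are oriented out of the crossing, and changing the smoothing exchanges the arcs that end there. -/
theorem Next.swap_right {r r' : P.Vertex} {c : P.Crossing} (h : ∀ c', c' ≠ c → r' c' = r c')
    (hc : r' c ≠ r c) (hpos : ¬ Even (P.piece c.1).pos) {a b : P.Point}
    (hab : Next r a b) : Next r' a (Equiv.swap (bottomLeft c) (topRight c) b) := by
  obtain ⟨t, hab⟩ := hab
  rcases eq_or_ne b (bottomLeft c) with rfl | hp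
  · rw [Equiv.swap_apply_left]
    change Step _ _ _ _ _ c.1 (P.piece c.1).pos at hab
    obtain rfl : t = c.1 := by
      have := hab.end_cases (resolved_isCross r t)
      grind
    refine ⟨c.1, ?_⟩
    change Step _ _ _ _ _ (c.1 + 1) ((P.piece c.1).pos + 1)
    generalize (a.2 : ℕ) = i at *
    rcases resolved_crossing hc with ⟨h1, h2⟩ | ⟨h1, h2⟩ <;> rw [h1] at hab <;> rw [h2] <;>
      simp only [Step, Piece.Through, Piece.BottomTurn, Piece.TopTurn, Nat.even_iff] at * <;> grind
  rcases eq_or_ne b (topRight c) with rfl | hq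
  · rw [Equiv.swap_apply_right]
    change Step _ _ _ _ _ (c.1 + 1) ((P.piece c.1).pos + 1) at hab
    obtain rfl : t = c.1 := by
      have : c.1 + 1 = t + 1 := by
        have := hab.end_cases (resolved_isCross r t)
        have : Even ((P.piece c.1).pos + 1) := by simpa [Nat.even_add_one] using hpos
        grind
      exact (add_right_cancel this).symm
    refine ⟨c.1, ?_⟩
    change Step _ _ _ _ _ c.1 (P.piece c.1).pos
    generalize (a.2 : ℕ) = i at *
    rcases resolved_crossing hc with ⟨h1, h2⟩ | ⟨h1, h2⟩ <;> rw [h1] at hab <;> rw [h2] <;>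
      simp only [Step, Piece.Through, Piece.BottomTurn, Piece.TopTurn, Nat.even_iff] at * <;> grind
  rw [Equiv.swap_apply_of_ne_of_ne hp hq]
  refine ⟨t, ?_⟩
  rcases eq_or_ne t c.1 with rfl | ht
  · have hp' : b.1 = c.1 → (b.2 : ℕ) ≠ (P.piece c.1).pos := fun h1 h2 => hp (Point.ext' h1 h2)
    have hq' : b.1 = c.1 + 1 → (b.2 : ℕ) ≠ (P.piece c.1).pos + 1 :=
      fun h1 h2 => hq (Point.ext' h1 h2)
    rcases resolved_crossing hc with ⟨h1, h2⟩ | ⟨h1, h2⟩ <;> rw [h1] at hab <;> rw [h2]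
    · exact hab.straight_of_end hpos hp' hq'
    · exact hab.hook_of_end hpos hp' hq'
  · rwa [resolved_of_ne h ht]

/-- Changing one smoothing merges two circles or splits one; it never reconnects a circle to
itself. -/
theorem isMerge_or_isMerge {r r' : P.Vertex} {c : P.Crossing} (h : ∀ c', c' ≠ c → r' c' = r c')
    (hc : r' c ≠ r c) :
    IsMerge (circleOf r) (circleOf r') (bottomLeft c) (topRight c) ∨
    IsMerge (circleOf r') (circleOf r) (bottomLeft c) (topRight c) := by
  by_cases hpos : Even (P.piece c.1).pos
  · refine isMerge_or_of_mul_swap (circleOf_eq_iff r) (circleOf_eq_iff r')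
      (bottomLeft_ne_topRight c) (Equiv.ext fun a => ?_)
    exact (Next.swap_left h hc hpos (next_nextPerm r _)).eq_nextPerm
  · refine isMerge_or_of_swap_mul (circleOf_eq_iff r) (circleOf_eq_iff r')
      (bottomLeft_ne_topRight c) (Equiv.ext fun a => ?_)
    exact (Next.swap_right h hc hpos (next_nextPerm r a)).eq_nextPerm

end AnnularDiagram

/-! ### Generators as functions on points -/

namespace AnnularDiagram

variable {P : AnnularDiagram}

/-- The generator at the vertex `r` in which a circle is labelled `+` if the sum of `u` over its
points is `0`, and `-` if the sum is `1`. -/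
noncomputable def gen (r : P.Vertex) (u : P.Point → ZMod 2) : P.Gen :=
  ⟨r, fun C => decide (fiberSum (circleOf r) u C = 0)⟩

/-- The basis vector of the generator `gen r u`. -/
noncomputable def genVec (r : P.Vertex) (u : P.Point → ZMod 2) : P.CKh := .single (gen r u) 1

theorem exists_gen_eq (g : P.Gen) : ∃ u, gen g.1 u = g := by
  classical
  obtain ⟨r, ℓ⟩ := g
  refine ⟨fun a => if Function.surjInv (circleOf_surjective r) (circleOf r a) = a ∧
    ℓ (circleOf r a) = false then 1 else 0, ?_⟩
  refine congrArg (Sigma.mk r) (funext fun C => ?_)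
  have h := Function.surjInv_eq (circleOf_surjective r)
  have : fiberSum (circleOf r) (fun a => if Function.surjInv (circleOf_surjective r)
      (circleOf r a) = a ∧ ℓ (circleOf r a) = false then 1 else 0) C =
      if ℓ C = false then 1 else 0 := by
    rw [fiberSum, Finset.sum_eq_single (Function.surjInv (circleOf_surjective r) C)]
    · simp [h]
    · intro a _ ha
      split_ifs with h1 h2
      · subst h1; exact absurd h2.1.symm ha
      · rfl
      · rfl
    · simp
  rw [this]
  cases ℓ C <;> simp

theorem linearMap_ext_genVec {W : Type*} [AddCommGroup W] [Module (ZMod 2) W]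
    {A B : P.CKh →ₗ[ZMod 2] W} (h : ∀ r u, A (genVec r u) = B (genVec r u)) : A = B :=
  Finsupp.lhom_ext' fun g => LinearMap.ext_ring <| by
    obtain ⟨u, hu⟩ := exists_gen_eq g
    simpa [genVec, hu] using h g.1 u

theorem gen_eq_mk_iff (r : P.Vertex) (u : P.Point → ZMod 2) (ℓ : Circle r → Bool) :
    gen r u = ⟨r, ℓ⟩ ↔
      ∀ a, ℓ (circleOf r a) = decide (fiberSum (circleOf r) u (circleOf r a) = 0) := by
  constructor
  · intro h a
    have : (fun C => decide (fiberSum (circleOf r) u C = 0)) = ℓ := eq_of_heq (Sigma.mk.inj h).2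
    rw [← this]
  · intro h
    refine congrArg (Sigma.mk r) (funext fun C => ?_)
    obtain ⟨a, rfl⟩ := circleOf_surjective r C
    rw [h]

theorem genVec_congr {r : P.Vertex} {u v : P.Point → ZMod 2}
    (h : ∀ C, fiberSum (circleOf r) u C = fiberSum (circleOf r) v C) :
    genVec r u = genVec r v := by
  simp only [genVec, gen, h]

theorem genVec_add_single_congr {r : P.Vertex} (u : P.Point → ZMod 2) {a b : P.Point}
    (h : circleOf r a = circleOf r b) :
    genVec r (u + Pi.single a 1) = genVec r (u + Pi.single b 1) :=
  genVec_congr fun C => by rw [fiberSum_add, fiberSum_add, fiberSum_single, fiberSum_single, h]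

/-! ### The edge maps of the full Lee complex -/

/-- The linear map with a given matrix. -/
noncomputable def ofCoeff (A : P.Gen → P.Gen → ZMod 2) : P.CKh →ₗ[ZMod 2] P.CKh :=
  Finsupp.linearCombination (ZMod 2) fun g => ∑ g' : P.Gen, Finsupp.single g' (A g g')

theorem ofCoeff_single_apply (A : P.Gen → P.Gen → ZMod 2) (g g' : P.Gen) :
    ofCoeff A (.single g 1) g' = A g g' := by
  classical
  simp [ofCoeff, Finsupp.finsetSum_apply, Finsupp.single_apply]

theorem linearMap_ext_coeff {A B : P.CKh →ₗ[ZMod 2] P.CKh}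
    (h : ∀ g g', A (.single g 1) g' = B (.single g 1) g') : A = B :=
  Finsupp.lhom_ext' fun g => LinearMap.ext_ring <| Finsupp.ext fun g' => h g g'

/-- The edge map at the crossing `c` of the sum of Khovanov's and Lee's differentials, that is, of
the cube of resolutions of the Frobenius algebra with `X² = 1`. -/
noncomputable def edgeMap (c : P.Crossing) : P.CKh →ₗ[ZMod 2] P.CKh :=
  ofCoeff (edgeCoeff (fun x y z => mulKh x y z + mulLee x y z)
    (fun x y z => comulKh x y z + comulLee x y z) c)

theorem edgeMap_genVec_of_true {c : P.Crossing} {r : P.Vertex} (hc : r c = true)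
    (u : P.Point → ZMod 2) : edgeMap c (genVec r u) = 0 := by
  ext g'
  rw [edgeMap, genVec, ofCoeff_single_apply, edgeCoeff, if_neg]
  · rfl
  · simp [gen, hc]

theorem decide_add_eq_zero (s t : ZMod 2) :
    decide (s + t = 0) = (decide (s = 0) == decide (t = 0)) := by
  revert s t; decide

theorem circle_cases (c : P.Crossing) {r : P.Vertex} (hc : r c = false) :
    IsMerge (circleOf r) (circleOf (Function.update r c true)) (bottomLeft c) (topRight c) ∨
    IsMerge (circleOf (Function.update r c true)) (circleOf r) (bottomLeft c) (topRight c) :=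
  isMerge_or_isMerge (fun c' h => by rw [Function.update_of_ne h]) (by simp [hc])

/-- The circles that do not meet the crossing `c` have the same labels in `g` and `g'`. -/
def Agree (c : P.Crossing) (g g' : P.Gen) : Prop :=
  ∀ a : P.Point, circleOf g.1 a ≠ circleOf g.1 (bottomLeft c) →
    circleOf g.1 a ≠ circleOf g.1 (topRight c) → g'.2 (circleOf g'.1 a) = g.2 (circleOf g.1 a)

open Classical in
theorem edgeCoeff_of_isMerge (μ δ : Bool → Bool → Bool → ZMod 2) {c : P.Crossing} {g g' : P.Gen}
    (hc : g.1 c = false) (hg' : g'.1 = Function.update g.1 c true)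
    (h : IsMerge (circleOf g.1) (circleOf g'.1) (bottomLeft c) (topRight c)) :
    edgeCoeff μ δ c g g' = if Agree c g g' then
      μ (g.2 (circleOf g.1 (bottomLeft c))) (g.2 (circleOf g.1 (topRight c)))
        (g'.2 (circleOf g'.1 (bottomLeft c))) else 0 := by
  rw [edgeCoeff]
  refine if_congr ⟨fun H => H.2.2, fun H => ⟨hc, hg', H⟩⟩ ?_ rfl
  rw [if_pos ⟨h.ne, h.merged_eq⟩]

open Classical in
theorem edgeCoeff_of_isMerge' (μ δ : Bool → Bool → Bool → ZMod 2) {c : P.Crossing} {g g' : P.Gen}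
    (hc : g.1 c = false) (hg' : g'.1 = Function.update g.1 c true)
    (h : IsMerge (circleOf g'.1) (circleOf g.1) (bottomLeft c) (topRight c)) :
    edgeCoeff μ δ c g g' = if Agree c g g' then
      δ (g.2 (circleOf g.1 (bottomLeft c))) (g'.2 (circleOf g'.1 (bottomLeft c)))
        (g'.2 (circleOf g'.1 (topRight c))) else 0 := by
  rw [edgeCoeff]
  refine if_congr ⟨fun H => H.2.2, fun H => ⟨hc, hg', H⟩⟩ ?_ rfl
  rw [if_neg (fun H => h.ne H.2), if_pos ⟨h.merged_eq, h.ne⟩]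

theorem gen_eq_mk_iff_of_isMerge {c : P.Crossing} {r r' : P.Vertex}
    (h : IsMerge (circleOf r) (circleOf r') (bottomLeft c) (topRight c))
    (u : P.Point → ZMod 2) (ℓ : Circle r' → Bool) :
    gen r' u = ⟨r', ℓ⟩ ↔
      Agree c (gen r u) ⟨r', ℓ⟩ ∧
      ℓ (circleOf r' (bottomLeft c)) = ((gen r u).2 (circleOf r (bottomLeft c)) ==
        (gen r u).2 (circleOf r (topRight c))) := by
  rw [gen_eq_mk_iff]
  constructor
  · intro hg
    refine ⟨fun a hp hq => ?_, ?_⟩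
    · exact (hg a).trans (by rw [h.fiberSum_of_ne u hp hq]; rfl)
    · rw [hg, h.fiberSum_merged, decide_add_eq_zero]; rfl
  · rintro ⟨hg, hm⟩ a
    by_cases ha : circleOf r' a = circleOf r' (bottomLeft c)
    · rw [ha, hm, h.fiberSum_merged, decide_add_eq_zero]; rfl
    · have := h.eq_iff a (bottomLeft c)
      have hp : circleOf r a ≠ circleOf r (bottomLeft c) := by grind
      have hq : circleOf r a ≠ circleOf r (topRight c) := by grind
      exact (hg a hp hq).trans (by rw [h.fiberSum_of_ne u hp hq]; rfl)

theorem gen_eq_mk_iff_of_isMerge' {c : P.Crossing} {r r' : P.Vertex}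
    (h : IsMerge (circleOf r') (circleOf r) (bottomLeft c) (topRight c))
    (u : P.Point → ZMod 2) (ℓ : Circle r' → Bool) :
    gen r' u = ⟨r', ℓ⟩ ↔
      Agree c (gen r u) ⟨r', ℓ⟩ ∧
      ℓ (circleOf r' (bottomLeft c)) =
        decide (fiberSum (circleOf r') u (circleOf r' (bottomLeft c)) = 0) ∧
      ℓ (circleOf r' (topRight c)) =
        decide (fiberSum (circleOf r') u (circleOf r' (topRight c)) = 0) := by
  have hm := h.merged_eq
  have key : ∀ a, circleOf r a = circleOf r (bottomLeft c) ↔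
      circleOf r' a = circleOf r' (bottomLeft c) ∨ circleOf r' a = circleOf r' (topRight c) := by
    intro a
    have := h.eq_iff a (bottomLeft c)
    grind
  rw [gen_eq_mk_iff]
  constructor
  · intro hg
    refine ⟨fun a hp hq => ?_, hg _, hg _⟩
    have := (key a).not.1 hp
    refine (hg a).trans ?_
    rw [← h.fiberSum_of_ne u (fun e => this (Or.inl e)) (fun e => this (Or.inr e))]; rfl
  · rintro ⟨hg, hp, hq⟩ a
    by_cases h1 : circleOf r' a = circleOf r' (bottomLeft c)
    · rw [h1, hp]
    by_cases h2 : circleOf r' a = circleOf r' (topRight c)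
    · rw [h2, hq]
    · have : circleOf r a ≠ circleOf r (bottomLeft c) := by simp [key, h1, h2]
      have this' : circleOf r a ≠ circleOf r (topRight c) := by rwa [← hm]
      exact (hg a this this').trans (by rw [← h.fiberSum_of_ne u h1 h2]; rfl)

/-- In terms of functions on points, the merge map does nothing, and the split map is the product
with the sum of the two new circles. -/
theorem edgeMap_genVec {c : P.Crossing} {r : P.Vertex} (hc : r c = false)
    (u : P.Point → ZMod 2) : edgeMap c (genVec r u) =
      if circleOf r (bottomLeft c) = circleOf r (topRight c) then
        genVec (Function.update r c true) (u + Pi.single (bottomLeft c) 1) +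
        genVec (Function.update r c true) (u + Pi.single (topRight c) 1)
      else genVec (Function.update r c true) u := by
  classical
  set r' := Function.update r c true with hr'
  ext g'
  rw [edgeMap, genVec, ofCoeff_single_apply]
  by_cases hg' : g'.1 = r'
  swap
  · have hne : ∀ v, gen r' v ≠ g' := fun v hv => hg' (by rw [← hv]; rfl)
    rw [edgeCoeff, if_neg (fun h => hg' h.2.1)]
    split_ifs <;> simp [genVec, hne]
  obtain ⟨s, ℓ⟩ := g'
  obtain rfl : s = r' := hg'
  rcases circle_cases c hc with h | h
  · rw [if_neg h.ne, genVec, Finsupp.single_apply,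
      edgeCoeff_of_isMerge (g := gen r u) (g' := ⟨r', ℓ⟩) _ _ hc rfl h]
    have tab : ∀ x y z : Bool, mulKh x y z + mulLee x y z = if z = (x == y) then 1 else 0 := by
      decide
    rw [tab, ← ite_and]
    exact if_congr (gen_eq_mk_iff_of_isMerge h u ℓ).symm rfl rfl
  · change IsMerge (circleOf r') (circleOf r) _ _ at h
    rw [if_pos h.merged_eq,
      edgeCoeff_of_isMerge' (g := gen r u) (g' := ⟨r', ℓ⟩) _ _ hc rfl h]
    have hm := h.merged_eq
    have hn := h.ne
    have hz : (gen r u).2 (circleOf r (bottomLeft c)) =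
        (decide (fiberSum (circleOf r') u (circleOf r' (bottomLeft c)) = 0) ==
          decide (fiberSum (circleOf r') u (circleOf r' (topRight c)) = 0)) := by
      rw [← decide_add_eq_zero, ← h.fiberSum_merged]; rfl
    have hA : ∀ b, circleOf r b = circleOf r (bottomLeft c) →
        (Agree c (gen r (u + Pi.single b 1)) ⟨r', ℓ⟩ ↔ Agree c (gen r u) ⟨r', ℓ⟩) := by
      intro b hb
      refine forall_congr' fun a => imp_congr_right fun hp => imp_congr_right fun _ => ?_
      have : (gen r (u + Pi.single b 1)).2 (circleOf r a) = (gen r u).2 (circleOf r a) := by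
        have hne : circleOf r (bottomLeft c) ≠ circleOf r a := fun e => hp e.symm
        simp [gen, fiberSum_add, fiberSum_single, hb, hne]
      exact iff_of_eq (congrArg (ℓ (circleOf r' a) = ·) this)
    have tab : ∀ (x y : Bool) (s t : ZMod 2),
        comulKh (decide (s = 0) == decide (t = 0)) x y +
          comulLee (decide (s = 0) == decide (t = 0)) x y =
        (if x = decide (s + 1 = 0) ∧ y = decide (t + 0 = 0) then 1 else 0) +
        (if x = decide (s + 0 = 0) ∧ y = decide (t + 1 = 0) then 1 else 0) := by
      decide
    simp only [genVec, Finsupp.add_apply, Finsupp.single_apply]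
    change (if Agree c (gen r u) ⟨r', ℓ⟩ then
      comulKh ((gen r u).2 (circleOf r (bottomLeft c))) (ℓ (circleOf r' (bottomLeft c)))
        (ℓ (circleOf r' (topRight c))) +
      comulLee ((gen r u).2 (circleOf r (bottomLeft c))) (ℓ (circleOf r' (bottomLeft c)))
        (ℓ (circleOf r' (topRight c))) else 0) = _
    have e1 : gen r' _ = ⟨r', ℓ⟩ ↔ _ :=
      gen_eq_mk_iff_of_isMerge' h (u + Pi.single (bottomLeft c) 1) ℓ
    have e2 : gen r' _ = ⟨r', ℓ⟩ ↔ _ :=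
      gen_eq_mk_iff_of_isMerge' h (u + Pi.single (topRight c) 1) ℓ
    rw [hA _ rfl] at e1
    rw [hA _ hm.symm] at e2
    simp only [fiberSum_add, fiberSum_single, if_true, if_neg hn, if_neg hn.symm] at e1 e2
    rw [hz, tab]
    simp only [e1, e2]
    by_cases hAg : Agree c (gen r u) ⟨r', ℓ⟩ <;>
      simp only [hAg, true_and, false_and, if_true, if_false, add_zero]

end AnnularDiagram

/-! ### The total differential and the action of `e + f` -/

/-- In characteristic two, a double sum of symmetric terms reduces to its diagonal. -/
theorem sum_sum_eq_sum_diag {M ι : Type*} [AddCommGroup M] [Module (ZMod 2) M] [DecidableEq ι]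
    (s : Finset ι) (F : ι → ι → M) (h : ∀ i j, F i j = F j i) :
    ∑ i ∈ s, ∑ j ∈ s, F i j = ∑ i ∈ s, F i i := by
  rw [← Finset.sum_product', ← Finset.diag_union_offDiag,
    Finset.sum_union (Finset.disjoint_diag_offDiag s), Finset.sum_diag, add_eq_left]
  refine Finset.sum_involution (fun x _ => (x.2, x.1)) ?_ ?_ ?_ ?_
  · intro x _; rw [h, ZModModule.add_self]
  · intro x hx _ e
    exact (Finset.mem_offDiag.1 hx).2.2 (congrArg Prod.snd e)
  · intro x hx
    simp only [Finset.mem_offDiag] at hx ⊢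
    exact ⟨hx.2.1, hx.1, hx.2.2.symm⟩
  · intro x _; rfl

namespace AnnularDiagram

variable {P : AnnularDiagram}

theorem edgeMap_edgeMap_of_true {c : P.Crossing} (c' : P.Crossing) {r : P.Vertex} (hc : r c = true)
    (u : P.Point → ZMod 2) : edgeMap c (edgeMap c' (genVec r u)) = 0 := by
  by_cases hc' : r c' = true
  · rw [edgeMap_genVec_of_true hc', map_zero]
  · have h : Function.update r c' true c = true := by
      by_cases e : c = c'
      · rw [e, Function.update_self]
      · rw [Function.update_of_ne e, hc]
    rw [edgeMap_genVec (by simpa using hc')]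
    split_ifs
    · rw [map_add, edgeMap_genVec_of_true h, edgeMap_genVec_of_true h, add_zero]
    · rw [edgeMap_genVec_of_true h]

theorem edgeMap_edgeMap_self (c : P.Crossing) : edgeMap c ∘ₗ edgeMap c = 0 :=
  linearMap_ext_genVec fun r u => by
    rw [LinearMap.comp_apply, LinearMap.zero_apply]
    by_cases hc : r c = true
    · rw [edgeMap_genVec_of_true hc, map_zero]
    · have h : Function.update r c true c = true := Function.update_self _ _ _
      rw [edgeMap_genVec (by simpa using hc)]
      split_ifs
      · rw [map_add, edgeMap_genVec_of_true h, edgeMap_genVec_of_true h, add_zero]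
      · rw [edgeMap_genVec_of_true h]

/-- The faces of the cube of resolutions commute. -/
theorem edgeMap_comm (c c' : P.Crossing) : edgeMap c' ∘ₗ edgeMap c = edgeMap c ∘ₗ edgeMap c' := by
  by_cases hcc : c = c'
  · rw [hcc]
  refine linearMap_ext_genVec fun r u => ?_
  rw [LinearMap.comp_apply, LinearMap.comp_apply]
  by_cases hc : r c = true
  · rw [edgeMap_genVec_of_true hc, map_zero, edgeMap_edgeMap_of_true _ hc]
  by_cases hc' : r c' = true
  · rw [edgeMap_genVec_of_true hc', map_zero, edgeMap_edgeMap_of_true _ hc']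
  rw [Bool.not_eq_true] at hc hc'
  have h10 : Function.update r c true c' = false := by
    rw [Function.update_of_ne (Ne.symm hcc), hc']
  have h01 : Function.update r c' true c = false := by
    rw [Function.update_of_ne hcc, hc]
  have e : Function.update (Function.update r c true) c' true =
      Function.update (Function.update r c' true) c true := Function.update_comm hcc _ _ _
  have f1 := circle_cases c hc
  have f2 := circle_cases c' h10
  have f3 := circle_cases c' hc'
  have f4 := circle_cases c h01
  rw [e] at f2
  rw [edgeMap_genVec hc, edgeMap_genVec hc', apply_ite (edgeMap c'), apply_ite (edgeMap c), map_add,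
    map_add]
  simp only [edgeMap_genVec h10, edgeMap_genVec h01, e]
  set r' := Function.update (Function.update r c' true) c true
  rcases face_cases f1 f2 f3 f4 with ⟨h1, h2⟩ | ⟨h1, h2, h3, h4, h5⟩ | ⟨h1, h2, h3, h4, h5, h6⟩
  · simp only [← h1, ← h2]
    by_cases a1 : circleOf r (bottomLeft c) = circleOf r (topRight c) <;>
      by_cases a2 : circleOf r (bottomLeft c') = circleOf r (topRight c') <;>
      simp only [a1, a2, if_true, if_false]
    simp only [add_right_comm u (Pi.single (bottomLeft c) 1),
      add_right_comm u (Pi.single (topRight c) 1)]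
    abel
  · rw [if_neg h1, if_pos h2, if_neg h3, if_pos h4]
    rcases h5 with ⟨h5, h6⟩ | ⟨h5, h6⟩
    · rw [genVec_add_single_congr u h5, genVec_add_single_congr u h6]
    · rw [genVec_add_single_congr u h5, genVec_add_single_congr u h6, add_comm]
  · rw [if_pos h1, if_neg h2, if_neg h2, if_pos h3, if_neg h4, if_neg h4,
      genVec_add_single_congr u h5, genVec_add_single_congr u h6, ZModModule.add_self,
      ZModModule.add_self]

variable (P) in
/-- The differential of the complex of the Frobenius algebra with `X² = 1`. -/
noncomputable def totalMap : P.CKh →ₗ[ZMod 2] P.CKh := ∑ c : P.Crossing, edgeMap c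

theorem totalMap_totalMap : P.totalMap ∘ₗ P.totalMap = 0 := by
  classical
  have : P.totalMap ∘ₗ P.totalMap = ∑ c : P.Crossing, ∑ c' : P.Crossing, edgeMap c ∘ₗ edgeMap c' :=
    Finset.sum_mul_sum (R := Module.End (ZMod 2) P.CKh) _ _ _ _
  rw [this, sum_sum_eq_sum_diag _ _ fun c c' => (edgeMap_comm c' c)]
  exact Finset.sum_eq_zero fun c _ => edgeMap_edgeMap_self c

/-- The characteristic function of the ray `0`. -/
noncomputable def rayZero (a : P.Point) : ZMod 2 := if a.1 = 0 then 1 else 0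

theorem nontriv_iff {r : P.Vertex} (C : Circle r) :
    Nontriv C ↔ fiberSum (circleOf r) rayZero C = 1 := by
  have : fiberSum (circleOf r) rayZero C =
      (Nat.card {a : P.Point // a.1 = 0 ∧ circleOf r a = C} : ZMod 2) := by
    rw [Nat.card_eq_fintype_card, Fintype.card_subtype, fiberSum, Finset.card_filter]
    push_cast
    refine Finset.sum_congr rfl fun a _ => ?_
    rw [rayZero, ← ite_and]
    exact if_congr and_comm rfl rfl
  rw [this, Nontriv, ← ZMod.natCast_eq_one_iff_odd]

theorem gen_add_single (r : P.Vertex) (u : P.Point → ZMod 2) (a : P.Point) :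
    gen r (u + Pi.single a 1) = ⟨r, Function.update (gen r u).2 (circleOf r a)
      (!(gen r u).2 (circleOf r a))⟩ := by
  refine congrArg (Sigma.mk r) (funext fun C => ?_)
  have tab : ∀ s : ZMod 2, decide (s + 1 = 0) = !decide (s = 0) := by decide
  rw [fiberSum_add, fiberSum_single]
  by_cases h : circleOf r a = C
  · subst h
    rw [if_pos rfl, tab]
    exact (Function.update_self (β := fun _ => Bool) (circleOf r a) _ (gen r u).2).symm
  · rw [if_neg h, add_zero]
    exact (Function.update_of_ne (β := fun _ => Bool) (Ne.symm h) _ (gen r u).2).symm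

/-- Modulo `2`, the sum of `e` and `f` changes the labels of the nontrivial circles. This is the
action of all points on one ray, since a trivial circle meets the ray an even number of times. -/
theorem eAct_add_fAct_genVec (r : P.Vertex) (u : P.Point → ZMod 2) :
    (P.eAct + P.fAct) (genVec r u) =
      ∑ a : P.Point with a.1 = 0, genVec r (u + Pi.single a 1) := by
  classical
  have h1 : (P.eAct + P.fAct) (genVec r u) = ∑ C : Circle r, if Nontriv C then
      (.single ⟨r, Function.update (gen r u).2 C (!(gen r u).2 C)⟩ 1 : P.CKh) else 0 := by
    have key : ∀ g : P.Gen, (P.eAct + P.fAct) (.single g 1) = ∑ C : Circle g.1, if Nontriv C then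
        (.single ⟨g.1, Function.update g.2 C (!g.2 C)⟩ 1 : P.CKh) else 0 := by
      intro g
      rw [LinearMap.add_apply, eAct, fAct, Finsupp.linearCombination_single,
        Finsupp.linearCombination_single, one_smul, one_smul, ← Finset.sum_add_distrib]
      refine Finset.sum_congr rfl fun C _ => ?_
      by_cases hC : Nontriv C
      · cases h : g.2 C <;> simp [hC]
      · simp [hC]
    exact key _
  rw [h1, ← Finset.sum_fiberwise_of_maps_to (t := Finset.univ) (g := circleOf r)
    (fun _ _ => Finset.mem_univ _)]
  refine Finset.sum_congr rfl fun C _ => ?_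
  have h2 : ∀ a ∈ (Finset.univ.filter fun a : P.Point => a.1 = 0).filter (circleOf r · = C),
      genVec r (u + Pi.single a 1) =
        (.single ⟨r, Function.update (gen r u).2 C (!(gen r u).2 C)⟩ 1 : P.CKh) := by
    intro a ha
    obtain rfl := (Finset.mem_filter.1 ha).2
    rw [genVec, gen_add_single]
  rw [Finset.sum_congr rfl h2, Finset.sum_const, ← Nat.cast_smul_eq_nsmul (ZMod 2),
    Finset.filter_filter]
  have h3 : (((Finset.univ.filter fun a : P.Point => a.1 = 0 ∧ circleOf r a = C).card : ℕ) :
      ZMod 2) = if Nontriv C then 1 else 0 := by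
    have : Nat.card {a : P.Point // a.1 = 0 ∧ circleOf r a = C} =
        (Finset.univ.filter fun a : P.Point => a.1 = 0 ∧ circleOf r a = C).card := by
      rw [Nat.card_eq_fintype_card, Fintype.card_subtype]
    rw [Nontriv, this]
    split_ifs with h
    · exact ZMod.natCast_eq_one_iff_odd.2 h
    · exact ZMod.natCast_eq_zero_iff_even.2 (Nat.not_odd_iff_even.1 h)
  rw [h3]
  split_ifs <;> simp

theorem edgeMap_comm_eAct_add_fAct (c : P.Crossing) :
    edgeMap c ∘ₗ (P.eAct + P.fAct) = (P.eAct + P.fAct) ∘ₗ edgeMap c :=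
  linearMap_ext_genVec fun r u => by
    rw [LinearMap.comp_apply, LinearMap.comp_apply, eAct_add_fAct_genVec, map_sum]
    by_cases hc : r c = true
    · simp [edgeMap_genVec_of_true hc]
    rw [Bool.not_eq_true] at hc
    simp only [edgeMap_genVec hc]
    split_ifs
    · rw [map_add, eAct_add_fAct_genVec, eAct_add_fAct_genVec, ← Finset.sum_add_distrib]
      simp only [add_right_comm u]
    · rw [eAct_add_fAct_genVec]

theorem totalMap_comm_eAct_add_fAct :
    P.totalMap ∘ₗ (P.eAct + P.fAct) = (P.eAct + P.fAct) ∘ₗ P.totalMap := by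
  refine (Finset.sum_mul (R := Module.End (ZMod 2) P.CKh) _ _ _).trans
    (Eq.trans ?_ (Finset.mul_sum (R := Module.End (ZMod 2) P.CKh) _ _ _).symm)
  exact Finset.sum_congr rfl fun c _ => edgeMap_comm_eAct_add_fAct c

/-- Modulo `2`, the `k`-grading of every generator is the number of points on the ray `0`. -/
theorem hAct_eq : P.hAct = (∑ a : P.Point, rayZero a) • LinearMap.id := by
  classical
  refine Finsupp.lhom_ext' fun g => LinearMap.ext_ring ?_
  have h : (kDeg g : ZMod 2) = ∑ a : P.Point, rayZero a := by
    rw [kDeg]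
    push_cast
    rw [← Finset.sum_fiberwise_of_maps_to (t := Finset.univ) (g := circleOf g.1)
      (fun _ _ => Finset.mem_univ _)]
    refine Finset.sum_congr rfl fun C _ => ?_
    rw [Finset.sum_filter]
    change _ = fiberSum (circleOf g.1) rayZero C
    rw [nontriv_iff]
    have tab : ∀ s : ZMod 2, (if s = 1 then 1 else 0) = s := by decide
    conv_rhs => rw [← tab (fiberSum (circleOf g.1) rayZero C)]
    split_ifs <;> simp
  simp [hAct, h]

theorem eAct_add_fAct_sq : (P.eAct + P.fAct) ∘ₗ (P.eAct + P.fAct) = P.hAct := by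
  classical
  refine linearMap_ext_genVec fun r u => ?_
  rw [LinearMap.comp_apply, eAct_add_fAct_genVec, map_sum]
  simp only [eAct_add_fAct_genVec]
  rw [sum_sum_eq_sum_diag _ _ fun a b => by rw [add_right_comm], hAct_eq]
  have h : ∀ a : P.Point, u + Pi.single a 1 + Pi.single a 1 = u := fun a => by
    rw [add_assoc, ZModModule.add_self, add_zero]
  simp only [h, Finset.sum_const, LinearMap.smul_apply, LinearMap.id_apply, rayZero,
    Finset.sum_boole, Nat.cast_smul_eq_nsmul]

end AnnularDiagram

/-! ### The bigrading -/

namespace AnnularDiagram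

variable {P : AnnularDiagram}

/-- The degree function on generators to which a circle contributes `ω n b` if it is labelled `b`
and meets the ray `0` in `n` points modulo `2`. -/
noncomputable def weight (ω : ZMod 2 → Bool → ℤ) (g : P.Gen) : ℤ :=
  ∑ C : Circle g.1, ω (fiberSum (circleOf g.1) rayZero C) (g.2 C)

theorem weight_of_isMerge (ω : ZMod 2 → Bool → ℤ) {c : P.Crossing} {g g' : P.Gen}
    (h : IsMerge (circleOf g.1) (circleOf g'.1) (bottomLeft c) (topRight c))
    (hA : ∀ a : P.Point, circleOf g.1 a ≠ circleOf g.1 (bottomLeft c) →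
      circleOf g.1 a ≠ circleOf g.1 (topRight c) →
      g'.2 (circleOf g'.1 a) = g.2 (circleOf g.1 a)) :
    weight ω g + ω (fiberSum (circleOf g.1) rayZero (circleOf g.1 (bottomLeft c)) +
        fiberSum (circleOf g.1) rayZero (circleOf g.1 (topRight c)))
        (g'.2 (circleOf g'.1 (bottomLeft c))) =
      weight ω g' + ω (fiberSum (circleOf g.1) rayZero (circleOf g.1 (bottomLeft c)))
        (g.2 (circleOf g.1 (bottomLeft c))) +
      ω (fiberSum (circleOf g.1) rayZero (circleOf g.1 (topRight c)))
        (g.2 (circleOf g.1 (topRight c))) := by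
  rw [← h.fiberSum_merged]
  exact h.sum_add_merged (circleOf_surjective _) (circleOf_surjective _)
    (F := fun C => ω (fiberSum (circleOf g.1) rayZero C) (g.2 C))
    (F' := fun C => ω (fiberSum (circleOf g'.1) rayZero C) (g'.2 C))
    fun a hp hq => by rw [h.fiberSum_of_ne _ hp hq, hA a hp hq]

/-- A nonzero matrix entry of an edge map comes from a merge or a split of two circles, and changes
every degree function accordingly. -/
theorem exists_of_edgeCoeff_ne_zero {μ δ : Bool → Bool → Bool → ZMod 2} {c : P.Crossing}
    {g g' : P.Gen} (h : edgeCoeff μ δ c g g' ≠ 0) :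
    ∃ (s t : ZMod 2) (x y z : Bool),
      (μ x y z ≠ 0 ∧ ∀ ω, weight ω g + ω (s + t) z = weight ω g' + ω s x + ω t y) ∨
      (δ z x y ≠ 0 ∧ ∀ ω, weight ω g' + ω (s + t) z = weight ω g + ω s x + ω t y) := by
  classical
  have H := (ite_ne_right_iff.1 h).1
  rcases (H.2.1 ▸ circle_cases c H.1 :
      IsMerge (circleOf g.1) (circleOf g'.1) (bottomLeft c) (topRight c) ∨
      IsMerge (circleOf g'.1) (circleOf g.1) (bottomLeft c) (topRight c)) with hm | hm
  · rw [edgeCoeff_of_isMerge μ δ H.1 H.2.1 hm] at h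
    exact ⟨_, _, _, _, _, .inl ⟨(ite_ne_right_iff.1 h).2, fun ω => weight_of_isMerge ω hm H.2.2⟩⟩
  · rw [edgeCoeff_of_isMerge' μ δ H.1 H.2.1 hm] at h
    refine ⟨_, _, _, _, _, .inr ⟨(ite_ne_right_iff.1 h).2, fun ω => weight_of_isMerge ω hm ?_⟩⟩
    intro a hp hq
    have key := hm.eq_iff a (bottomLeft c)
    have hn : circleOf g.1 a ≠ circleOf g.1 (bottomLeft c) := by grind
    exact (H.2.2 a hn (by rwa [← hm.merged_eq])).symm

/-- A circle counts with the sign of its label. -/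
def jWeight (_ : ZMod 2) (b : Bool) : ℤ := if b then 1 else -1

/-- A circle counts with the sign of its label if it is nontrivial. -/
def kWeight (n : ZMod 2) (b : Bool) : ℤ := if n = 1 then if b then 1 else -1 else 0

theorem kDeg_eq_weight (g : P.Gen) : kDeg g = weight kWeight g := by
  classical
  exact Finset.sum_congr rfl fun C _ => if_congr (nontriv_iff C) rfl rfl

/-- The bidegree of a generator: the number of circles labelled `+` minus the number of circles
labelled `-`, and the same difference for the nontrivial circles. -/
noncomputable def bideg (g : P.Gen) : ℤ × ℤ := (weight jWeight g, kDeg g)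

theorem bideg_of_edgeCoeff_kh {c : P.Crossing} {g g' : P.Gen}
    (h : edgeCoeff mulKh comulKh c g g' ≠ 0) :
    bideg g' = bideg g + (-1, 0) ∨ bideg g' = bideg g + (-1, -2) := by
  have tab : ∀ (s t : ZMod 2) (x y z : Bool),
      (mulKh x y z ≠ 0 → jWeight (s + t) z = jWeight s x + jWeight t y - 1 ∧
        (kWeight (s + t) z = kWeight s x + kWeight t y ∨
          kWeight (s + t) z = kWeight s x + kWeight t y - 2)) ∧
      (comulKh z x y ≠ 0 → jWeight s x + jWeight t y = jWeight (s + t) z - 1 ∧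
        (kWeight s x + kWeight t y = kWeight (s + t) z ∨
          kWeight s x + kWeight t y = kWeight (s + t) z - 2)) := by decide
  simp only [bideg, kDeg_eq_weight, Prod.mk_add_mk, Prod.mk.injEq]
  obtain ⟨s, t, x, y, z, ⟨h0, h⟩ | ⟨h0, h⟩⟩ := exists_of_edgeCoeff_ne_zero h
  · have := (tab s t x y z).1 h0
    have := h jWeight
    have := h kWeight
    omega
  · have := (tab s t x y z).2 h0
    have := h jWeight
    have := h kWeight
    omega

theorem bideg_of_edgeCoeff_lee {c : P.Crossing} {g g' : P.Gen}
    (h : edgeCoeff mulLee comulLee c g g' ≠ 0) :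
    bideg g' = bideg g + (3, 0) ∨ bideg g' = bideg g + (3, 2) := by
  have tab : ∀ (s t : ZMod 2) (x y z : Bool),
      (mulLee x y z ≠ 0 → jWeight (s + t) z = jWeight s x + jWeight t y + 3 ∧
        (kWeight (s + t) z = kWeight s x + kWeight t y ∨
          kWeight (s + t) z = kWeight s x + kWeight t y + 2)) ∧
      (comulLee z x y ≠ 0 → jWeight s x + jWeight t y = jWeight (s + t) z + 3 ∧
        (kWeight s x + kWeight t y = kWeight (s + t) z ∨
          kWeight s x + kWeight t y = kWeight (s + t) z + 2)) := by decide
  simp only [bideg, kDeg_eq_weight, Prod.mk_add_mk, Prod.mk.injEq]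
  obtain ⟨s, t, x, y, z, ⟨h0, h⟩ | ⟨h0, h⟩⟩ := exists_of_edgeCoeff_ne_zero h
  · have := (tab s t x y z).1 h0
    have := h jWeight
    have := h kWeight
    omega
  · have := (tab s t x y z).2 h0
    have := h jWeight
    have := h kWeight
    omega

theorem cubeMap_single_apply (μ δ : Bool → Bool → Bool → ZMod 2) (R : ℤ → ℤ → Prop)
    [DecidableRel R] (g g' : P.Gen) : cubeMap μ δ R (.single g 1) g' =
      if R (kDeg g) (kDeg g') then ∑ c : P.Crossing, edgeCoeff μ δ c g g' else 0 :=
  ofCoeff_single_apply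
    (fun g g' => if R (kDeg g) (kDeg g') then ∑ c : P.Crossing, edgeCoeff μ δ c g g' else 0) g g'

theorem exists_of_cubeMap_ne_zero {μ δ : Bool → Bool → Bool → ZMod 2} {R : ℤ → ℤ → Prop}
    [DecidableRel R] {g g' : P.Gen} (h : cubeMap μ δ R (.single g 1) g' ≠ 0) :
    R (kDeg g) (kDeg g') ∧ ∃ c, edgeCoeff μ δ c g g' ≠ 0 := by
  rw [cubeMap_single_apply, ite_ne_right_iff] at h
  exact ⟨h.1, (Finset.exists_ne_zero_of_sum_ne_zero h.2).imp fun _ h => h.2⟩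

/-- The endomorphism `T` is homogeneous of bidegree `n`. -/
def HasBideg (n : ℤ × ℤ) (T : Module.End (ZMod 2) P.CKh) : Prop :=
  ∀ g g', T (.single g 1) g' ≠ 0 → bideg g' = bideg g + n

theorem hasBideg_dZero : HasBideg (-1, 0) P.dZero := fun g g' h => by
  obtain ⟨hk, c, hc⟩ := exists_of_cubeMap_ne_zero h
  refine (bideg_of_edgeCoeff_kh hc).resolve_right fun e => ?_
  have : kDeg g' = kDeg g + -2 := congrArg Prod.snd e
  omega

theorem hasBideg_dMinus : HasBideg (-1, -2) P.dMinus := fun g g' h => by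
  obtain ⟨hk, c, hc⟩ := exists_of_cubeMap_ne_zero h
  refine (bideg_of_edgeCoeff_kh hc).resolve_left fun e => ?_
  have : kDeg g' = kDeg g + 0 := congrArg Prod.snd e
  omega

theorem hasBideg_leeZero : HasBideg (3, 0) P.leeZero := fun g g' h => by
  obtain ⟨hk, c, hc⟩ := exists_of_cubeMap_ne_zero h
  refine (bideg_of_edgeCoeff_lee hc).resolve_right fun e => ?_
  have : kDeg g' = kDeg g + 2 := congrArg Prod.snd e
  omega

theorem hasBideg_leePlus : HasBideg (3, 2) P.leePlus := fun g g' h => by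
  obtain ⟨hk, c, hc⟩ := exists_of_cubeMap_ne_zero h
  refine (bideg_of_edgeCoeff_lee hc).resolve_left fun e => ?_
  have : kDeg g' = kDeg g + 0 := congrArg Prod.snd e
  omega

theorem weight_update (ω : ZMod 2 → Bool → ℤ) (g : P.Gen) (C : Circle g.1) (b : Bool) :
    weight ω (⟨g.1, Function.update g.2 C b⟩ : P.Gen) = weight ω g -
      ω (fiberSum (circleOf g.1) rayZero C) (g.2 C) + ω (fiberSum (circleOf g.1) rayZero C) b := by
  rw [weight, weight, ← Finset.add_sum_erase _ _ (Finset.mem_univ C),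
    ← Finset.add_sum_erase _ (fun C => ω (fiberSum (circleOf g.1) rayZero C) (g.2 C))
      (Finset.mem_univ C)]
  have : ∑ D ∈ Finset.univ.erase C, ω (fiberSum (circleOf g.1) rayZero D)
      (Function.update g.2 C b D) =
      ∑ D ∈ Finset.univ.erase C, ω (fiberSum (circleOf g.1) rayZero D) (g.2 D) :=
    Finset.sum_congr rfl fun D hD => by rw [Function.update_of_ne (Finset.ne_of_mem_erase hD)]
  simp only [Function.update_self, this]
  ring

theorem hasBideg_eAct : HasBideg (2, 2) P.eAct := fun g g' h => by
  rw [eAct, Finsupp.linearCombination_single, one_smul, Finsupp.finsetSum_apply] at h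
  obtain ⟨C, -, hC⟩ := Finset.exists_ne_zero_of_sum_ne_zero h
  have hC' : Nontriv C ∧ g.2 C = false := by
    by_contra H
    exact hC (by rw [if_neg H, Finsupp.zero_apply])
  rw [if_pos hC'] at hC
  obtain rfl := (Finsupp.single_apply_ne_zero.1 hC).1
  rw [bideg, bideg, kDeg_eq_weight, kDeg_eq_weight, weight_update, weight_update,
    (nontriv_iff C).1 hC'.1, hC'.2]
  refine Prod.ext ?_ ?_ <;> simp [jWeight, kWeight] <;> ring

theorem hasBideg_fAct : HasBideg (-2, -2) P.fAct := fun g g' h => by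
  rw [fAct, Finsupp.linearCombination_single, one_smul, Finsupp.finsetSum_apply] at h
  obtain ⟨C, -, hC⟩ := Finset.exists_ne_zero_of_sum_ne_zero h
  have hC' : Nontriv C ∧ g.2 C = true := by
    by_contra H
    exact hC (by rw [if_neg H, Finsupp.zero_apply])
  rw [if_pos hC'] at hC
  obtain rfl := (Finsupp.single_apply_ne_zero.1 hC).1
  rw [bideg, bideg, kDeg_eq_weight, kDeg_eq_weight, weight_update, weight_update,
    (nontriv_iff C).1 hC'.1, hC'.2]
  refine Prod.ext ?_ ?_ <;> simp [jWeight, kWeight] <;> ring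

theorem hasBideg_hAct : HasBideg (0, 0) P.hAct := fun g g' h => by
  rw [hAct, Finsupp.linearCombination_single, one_smul] at h
  rw [(Finsupp.single_apply_ne_zero.1 h).1, Prod.mk_zero_zero, add_zero]

theorem HasBideg.mul {m n : ℤ × ℤ} {S T : Module.End (ZMod 2) P.CKh} (hS : HasBideg m S)
    (hT : HasBideg n T) : HasBideg (m + n) (S * T) := fun g g' h => by
  have e : (S * T) (.single g 1) g' = ∑ x : P.Gen, T (.single g 1) x * S (.single x 1) g' := by
    conv_lhs => rw [Module.End.mul_apply, ← Finsupp.sum_single (T (.single g 1)),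
      Finsupp.sum_fintype _ _ (by simp),
      map_sum, Finsupp.finsetSum_apply]
    refine Finset.sum_congr rfl fun x _ => ?_
    rw [← mul_one (T (.single g 1) x), ← Finsupp.smul_single', map_smul,
      Finsupp.smul_apply, smul_eq_mul, mul_one]
  rw [e] at h
  obtain ⟨x, -, hx⟩ := Finset.exists_ne_zero_of_sum_ne_zero h
  rw [hS _ _ (right_ne_zero_of_mul hx), hT _ _ (left_ne_zero_of_mul hx), add_assoc, add_comm m]

/-- The homogeneous component of bidegree `n`. -/
noncomputable def component (n : ℤ × ℤ) :
    Module.End (ZMod 2) P.CKh →+ Module.End (ZMod 2) P.CKh where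
  toFun T := ofCoeff fun g g' => if bideg g' = bideg g + n then T (.single g 1) g' else 0
  map_zero' := linearMap_ext_coeff fun g g' => by simp [ofCoeff_single_apply]
  map_add' S T := linearMap_ext_coeff fun g g' => by
    simp only [ofCoeff_single_apply, LinearMap.add_apply, Finsupp.add_apply]
    split_ifs <;> simp

theorem HasBideg.component_eq {m : ℤ × ℤ} {T : Module.End (ZMod 2) P.CKh} (hT : HasBideg m T)
    (n : ℤ × ℤ) : component n T = if n = m then T else 0 := by
  refine linearMap_ext_coeff fun g g' => ?_
  refine (ofCoeff_single_apply _ g g').trans ?_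
  by_cases h : T (.single g 1) g' = 0
  · split_ifs <;> simp [h]
  · have := hT g g' h
    rw [this]
    simp only [add_right_inj, eq_comm (a := m)]
    split_ifs <;> rfl

theorem totalMap_eq : P.totalMap = P.dZero + P.dMinus + (P.leeZero + P.leePlus) := by
  refine linearMap_ext_coeff fun g g' => ?_
  have add : ∀ c : P.Crossing, edgeCoeff (fun x y z => mulKh x y z + mulLee x y z)
      (fun x y z => comulKh x y z + comulLee x y z) c g g' =
      edgeCoeff mulKh comulKh c g g' + edgeCoeff mulLee comulLee c g g' := by
    intro c
    simp only [edgeCoeff]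
    split_ifs <;> simp
  have kh : ∑ c : P.Crossing, edgeCoeff mulKh comulKh c g g' =
      P.dZero (.single g 1) g' + P.dMinus (.single g 1) g' := by
    rw [dZero, dMinus, cubeMap_single_apply, cubeMap_single_apply]
    by_cases h : kDeg g' ≤ kDeg g
    · rcases h.eq_or_lt with h | h
      · rw [if_pos h, if_neg h.not_lt, add_zero]
      · rw [if_neg h.ne, if_pos h, zero_add]
    · rw [if_neg (by omega), if_neg (by omega), add_zero]
      refine Finset.sum_eq_zero fun c _ => by_contra fun hc => ?_
      have := (bideg_of_edgeCoeff_kh hc).imp (congrArg Prod.snd) (congrArg Prod.snd)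
      simp only [bideg, Prod.snd_add] at this
      omega
  have lee : ∑ c : P.Crossing, edgeCoeff mulLee comulLee c g g' =
      P.leeZero (.single g 1) g' + P.leePlus (.single g 1) g' := by
    rw [leeZero, leePlus, cubeMap_single_apply, cubeMap_single_apply]
    by_cases h : kDeg g ≤ kDeg g'
    · rcases h.eq_or_lt with h | h
      · rw [if_pos h.symm, if_neg h.not_lt, add_zero]
      · rw [if_neg h.ne', if_pos h, zero_add]
    · rw [if_neg (by omega), if_neg (by omega), add_zero]
      refine Finset.sum_eq_zero fun c _ => by_contra fun hc => ?_
      have := (bideg_of_edgeCoeff_lee hc).imp (congrArg Prod.snd) (congrArg Prod.snd)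
      simp only [bideg, Prod.snd_add] at this
      omega
  simp only [LinearMap.add_apply, Finsupp.add_apply, ← kh, ← lee, ← Finset.sum_add_distrib, ← add]
  rw [totalMap, LinearMap.sum_apply, Finsupp.finsetSum_apply]
  exact Finset.sum_congr rfl fun c _ => ofCoeff_single_apply _ g g'

end AnnularDiagram

/-! ### Bihomogeneous relations -/

namespace Bihomogeneous

/- The ring `R` has additive maps `π n` that extract the part of bidegree `n`. -/
variable {R : Type*} [Ring R] {H : ℤ × ℤ → R → Prop} {π : ℤ × ℤ → R →+ R}
  (proj : ∀ m n T, H m T → π n T = if n = m then T else 0)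
  (mul : ∀ m n S T, H m S → H n T → H (m + n) (S * T))

include proj mul

/-- The homogeneous components of `(D + B + (L + A))² = 0`. -/
theorem relations_of_sq {D B L A : R} (hD : H (-1, 0) D) (hB : H (-1, -2) B) (hL : H (3, 0) L)
    (hA : H (3, 2) A) (h : (D + B + (L + A)) * (D + B + (L + A)) = 0) :
    (D * D = 0 ∧ B * B = 0 ∧ L * L = 0 ∧ A * A = 0) ∧
    (D * B + B * D = 0 ∧ D * A + A * D = 0 ∧ B * L + L * B = 0 ∧ L * A + A * L = 0) ∧
    D * L + L * D + (A * B + B * A) = 0 := by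
  have key : ∀ n, π n _ = π n _ := fun n => congrArg (π n) h
  simp only [add_mul, mul_add, map_add, map_zero, proj _ _ _ (mul _ _ _ _ hD hD),
    proj _ _ _ (mul _ _ _ _ hD hB), proj _ _ _ (mul _ _ _ _ hD hL),
    proj _ _ _ (mul _ _ _ _ hD hA), proj _ _ _ (mul _ _ _ _ hB hD),
    proj _ _ _ (mul _ _ _ _ hB hB), proj _ _ _ (mul _ _ _ _ hB hL),
    proj _ _ _ (mul _ _ _ _ hB hA), proj _ _ _ (mul _ _ _ _ hL hD),
    proj _ _ _ (mul _ _ _ _ hL hB), proj _ _ _ (mul _ _ _ _ hL hL),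
    proj _ _ _ (mul _ _ _ _ hL hA), proj _ _ _ (mul _ _ _ _ hA hD),
    proj _ _ _ (mul _ _ _ _ hA hB), proj _ _ _ (mul _ _ _ _ hA hL),
    proj _ _ _ (mul _ _ _ _ hA hA), Prod.mk_add_mk] at key
  refine ⟨⟨?_, ?_, ?_, ?_⟩, ⟨?_, ?_, ?_, ?_⟩, ?_⟩
  · simpa using key (-2, 0)
  · simpa using key (-2, -4)
  · simpa using key (6, 0)
  · simpa using key (6, 4)
  · simpa [add_comm] using key (-2, -2)
  · simpa [add_comm] using key (2, 2)
  · simpa [add_comm] using key (2, -2)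
  · simpa [add_comm] using key (6, 2)
  · have := key (2, 0)
    simp at this
    rw [← this]
    abel

/-- The homogeneous components of the relation between `D + B + (L + A)` and `e + f`. -/
theorem relations_of_comm {D B L A e f : R} (hD : H (-1, 0) D) (hB : H (-1, -2) B)
    (hL : H (3, 0) L) (hA : H (3, 2) A) (he : H (2, 2) e) (hf : H (-2, -2) f)
    (h : (D + B + (L + A)) * (e + f) = (e + f) * (D + B + (L + A))) :
    (Commute e D ∧ Commute e L ∧ Commute e A) ∧ (Commute f D ∧ Commute f L ∧ Commute f B) ∧
    e * B + f * A = B * e + A * f := by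
  have key : ∀ n, π n _ = π n _ := fun n => congrArg (π n) h
  simp only [add_mul, mul_add, map_add, proj _ _ _ (mul _ _ _ _ hD he),
    proj _ _ _ (mul _ _ _ _ hD hf), proj _ _ _ (mul _ _ _ _ hB he),
    proj _ _ _ (mul _ _ _ _ hB hf), proj _ _ _ (mul _ _ _ _ hL he),
    proj _ _ _ (mul _ _ _ _ hL hf), proj _ _ _ (mul _ _ _ _ hA he),
    proj _ _ _ (mul _ _ _ _ hA hf), proj _ _ _ (mul _ _ _ _ he hD),
    proj _ _ _ (mul _ _ _ _ hf hD), proj _ _ _ (mul _ _ _ _ he hB),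
    proj _ _ _ (mul _ _ _ _ hf hB), proj _ _ _ (mul _ _ _ _ he hL),
    proj _ _ _ (mul _ _ _ _ hf hL), proj _ _ _ (mul _ _ _ _ he hA),
    proj _ _ _ (mul _ _ _ _ hf hA), Prod.mk_add_mk] at key
  refine ⟨⟨?_, ?_, ?_⟩, ⟨?_, ?_, ?_⟩, ?_⟩
  · simpa [commute_iff_eq] using (key (1, 2)).symm
  · simpa [commute_iff_eq] using (key (5, 2)).symm
  · simpa [commute_iff_eq] using (key (5, 4)).symm
  · simpa [commute_iff_eq] using (key (-3, -2)).symm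
  · simpa [commute_iff_eq] using (key (1, -2)).symm
  · simpa [commute_iff_eq] using (key (-3, -4)).symm
  · simpa using (key (1, 0)).symm

/-- The homogeneous components of `(e + f)² = h`. -/
theorem relations_of_sq_eq {e f h : R} (he : H (2, 2) e) (hf : H (-2, -2) f) (hh : H (0, 0) h)
    (hs : (e + f) * (e + f) = h) : e * e = 0 ∧ f * f = 0 ∧ e * f + f * e = h := by
  have key : ∀ n, π n _ = π n _ := fun n => congrArg (π n) hs
  simp only [add_mul, mul_add, map_add, proj _ _ _ (mul _ _ _ _ he he),
    proj _ _ _ (mul _ _ _ _ he hf), proj _ _ _ (mul _ _ _ _ hf he),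
    proj _ _ _ (mul _ _ _ _ hf hf), proj _ _ _ hh, Prod.mk_add_mk] at key
  refine ⟨?_, ?_, ?_⟩
  · simpa using key (4, 4)
  · simpa using key (-4, -4)
  · simpa [add_comm] using key (0, 0)

end Bihomogeneous

/-! ### Actions of `sl₂(∧)_dg` -/

/-- An element of square zero commutes with each of its anticommutators. -/
theorem commute_mul_add_mul {R : Type*} [Ring R] {a : R} (ha : a * a = 0) (b : R) :
    Commute a (a * b + b * a) := by
  rw [Commute, SemiconjBy, mul_add, add_mul, ← mul_assoc, ha, zero_mul, zero_add, mul_assoc b, ha,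
    mul_zero, add_zero, mul_assoc]

/-- Relations that make a family of operators an action of `sl₂(∧)_dg`. -/
theorem SlDg.linearCombination_table {R : Type*} [Ring R] [Algebra (ZMod 2) R] (φ : DgBasis → R)
    (sq : φ .d * φ .d = 0 ∧ φ .vm2 * φ .vm2 = 0 ∧ φ .D * φ .D = 0 ∧ φ .v2 * φ .v2 = 0)
    (anti : φ .d * φ .vm2 + φ .vm2 * φ .d = 0 ∧ φ .d * φ .v2 + φ .v2 * φ .d = 0 ∧
      φ .vm2 * φ .D + φ .D * φ .vm2 = 0 ∧ φ .D * φ .v2 + φ .v2 * φ .D = 0)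
    (x_eq : φ .x = φ .v2 * φ .vm2 + φ .vm2 * φ .v2)
    (dD : φ .d * φ .D + φ .D * φ .d + φ .x = 0)
    (comm_e : Commute (φ .e) (φ .d) ∧ Commute (φ .e) (φ .D) ∧ Commute (φ .e) (φ .v2))
    (comm_f : Commute (φ .f) (φ .d) ∧ Commute (φ .f) (φ .D) ∧ Commute (φ .f) (φ .vm2))
    (v0_eq : φ .v0 = φ .e * φ .vm2 + φ .vm2 * φ .e)
    (v0_eq' : φ .e * φ .vm2 + φ .f * φ .v2 = φ .vm2 * φ .e + φ .v2 * φ .f)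
    (sl_two : φ .e * φ .e = 0 ∧ φ .f * φ .f = 0 ∧ φ .e * φ .f + φ .f * φ .e = φ .h)
    (comm_h : ∀ T, Commute (φ .h) T) (b b' : DgBasis) :
    Finsupp.linearCombination (ZMod 2) φ (b.table b') = φ b * φ b' + φ b' * φ b := by
  have add_self : ∀ T : R, T + T = 0 := ZModModule.add_self
  have eq_of : ∀ {S T : R}, S + T = 0 → S = T := fun {S T} h => by
    rw [← add_left_inj T, h, add_self]
  have comm : ∀ {S T : R}, Commute S T → 0 = S * T + T * S :=
    fun {S T} h => by rw [h.eq, add_self]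
  obtain ⟨DD, BB, LL, AA⟩ := sq
  obtain ⟨DB, DA, BL, LA⟩ := anti
  replace DB : Commute (φ .d) (φ .vm2) := eq_of DB
  replace DA : Commute (φ .d) (φ .v2) := eq_of DA
  replace BL : Commute (φ .vm2) (φ .D) := eq_of BL
  replace LA : Commute (φ .D) (φ .v2) := eq_of LA
  obtain ⟨eD, eL, eA⟩ := comm_e
  obtain ⟨fD, fL, fB⟩ := comm_f
  obtain ⟨ee, ff, ef⟩ := sl_two
  have x_eq' : φ .x = φ .d * φ .D + φ .D * φ .d := (eq_of dD).symm
  have v0_eq'' : φ .v0 = φ .f * φ .v2 + φ .v2 * φ .f := eq_of <| by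
    rw [v0_eq, add_add_add_comm, v0_eq', add_add_add_comm, add_self, add_self, add_zero]
  have x_comm : ∀ T, Commute T (φ .d) → Commute T (φ .D) → Commute T (φ .x) := fun T h1 h2 =>
    x_eq' ▸ (h1.mul_right h2).add_right (h2.mul_right h1)
  have ex := x_comm _ eD eL
  have fx := x_comm _ fD fL
  have Bx := x_comm _ DB.symm BL
  have Ax := x_comm _ DA.symm LA.symm
  have Dx : Commute (φ .d) (φ .x) := x_eq' ▸ commute_mul_add_mul DD _
  have Lx : Commute (φ .D) (φ .x) := x_eq' ▸ add_comm (φ .D * φ .d) _ ▸ commute_mul_add_mul LL _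
  have eV : Commute (φ .e) (φ .v0) := v0_eq ▸ commute_mul_add_mul ee _
  have fV : Commute (φ .f) (φ .v0) := v0_eq'' ▸ commute_mul_add_mul ff _
  have BV : Commute (φ .vm2) (φ .v0) :=
    v0_eq ▸ add_comm (φ .vm2 * φ .e) _ ▸ commute_mul_add_mul BB _
  have AV : Commute (φ .v2) (φ .v0) :=
    v0_eq'' ▸ add_comm (φ .v2 * φ .f) _ ▸ commute_mul_add_mul AA _
  have DV : Commute (φ .d) (φ .v0) :=
    v0_eq ▸ (eD.symm.mul_right DB).add_right (DB.mul_right eD.symm)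
  have LV : Commute (φ .D) (φ .v0) :=
    v0_eq ▸ (eL.symm.mul_right BL.symm).add_right (BL.symm.mul_right eL.symm)
  have Vx : Commute (φ .v0) (φ .x) := x_eq ▸
    (AV.symm.mul_right BV.symm).add_right (BV.symm.mul_right AV.symm)
  have neg : (-1 : ZMod 2) = 1 := rfl
  cases b <;> cases b' <;>
    simp only [DgBasis.table, map_zero, Finsupp.linearCombination_single, ZMod.two_eq_zero_of_two,
      neg, neg_zero, zero_smul, one_smul] <;>
    first
    | exact comm (Commute.refl _)
    | exact comm (comm_h _)
    | exact comm (comm_h _).symm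
    | exact comm (by assumption)
    | exact comm (Commute.symm (by assumption))
    | exact ef.symm
    | exact (add_comm _ _).trans ef |>.symm
    | exact x_eq
    | exact x_eq.trans (add_comm _ _)
    | exact x_eq'
    | exact x_eq'.trans (add_comm _ _)
    | exact v0_eq
    | exact v0_eq.trans (add_comm _ _)
    | exact v0_eq''
    | exact v0_eq''.trans (add_comm _ _)

namespace AnnularDiagram

variable {P : AnnularDiagram}

theorem component_of_hasBideg (m n : ℤ × ℤ) (T : Module.End (ZMod 2) P.CKh) (h : HasBideg m T) :
    component n T = if n = m then T else 0 := h.component_eq n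

theorem hasBideg_mul (m n : ℤ × ℤ) (S T : Module.End (ZMod 2) P.CKh) (hS : HasBideg m S)
    (hT : HasBideg n T) : HasBideg (m + n) (S * T) := hS.mul hT

variable (P) in
/-- The homogeneous components of the equation `∂² = 0` for the total differential. -/
theorem relations_of_totalMap_totalMap :
    (P.dZero * P.dZero = 0 ∧ P.dMinus * P.dMinus = 0 ∧ P.leeZero * P.leeZero = 0 ∧
      P.leePlus * P.leePlus = 0) ∧
    (P.dZero * P.dMinus + P.dMinus * P.dZero = 0 ∧ P.dZero * P.leePlus + P.leePlus * P.dZero = 0 ∧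
      P.dMinus * P.leeZero + P.leeZero * P.dMinus = 0 ∧
      P.leeZero * P.leePlus + P.leePlus * P.leeZero = 0) ∧
    P.dZero * P.leeZero + P.leeZero * P.dZero +
      (P.leePlus * P.dMinus + P.dMinus * P.leePlus) = 0 :=
  Bihomogeneous.relations_of_sq component_of_hasBideg hasBideg_mul hasBideg_dZero hasBideg_dMinus
    hasBideg_leeZero hasBideg_leePlus (totalMap_eq (P := P) ▸ totalMap_totalMap (P := P))

theorem basisAct_v0 : P.basisAct .v0 = P.eAct ∘ₗ P.dMinus + P.dMinus ∘ₗ P.eAct :=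
  LinearMap.ext fun _ => ZModModule.sub_eq_add _ _

/-- The action of `sl₂(∧)_dg` turns brackets into commutators. -/
theorem dgAct_bracket (y z : SlDg) :
    P.dgAct (SlDg.bracket y z) = P.dgAct y ∘ₗ P.dgAct z + P.dgAct z ∘ₗ P.dgAct y := by
  obtain ⟨h1, h2, h3⟩ := relations_of_totalMap_totalMap P
  obtain ⟨h4, h5, h6⟩ := Bihomogeneous.relations_of_comm component_of_hasBideg hasBideg_mul
    hasBideg_dZero hasBideg_dMinus hasBideg_leeZero hasBideg_leePlus hasBideg_eAct hasBideg_fAct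
    (totalMap_eq (P := P) ▸ totalMap_comm_eAct_add_fAct (P := P))
  have h7 := Bihomogeneous.relations_of_sq_eq component_of_hasBideg hasBideg_mul
    hasBideg_eAct hasBideg_fAct (@hasBideg_hAct P) eAct_add_fAct_sq
  have comm_h : ∀ T : Module.End (ZMod 2) P.CKh, Commute P.hAct T := fun T => by
    rw [hAct_eq]
    exact (Commute.one_left T).smul_left _
  have key := SlDg.linearCombination_table (R := Module.End (ZMod 2) P.CKh) P.basisAct h1 h2 rfl h3
    h4 h5 basisAct_v0 h6 h7 comm_h
  have : SlDg.bracket.compr₂ P.dgAct =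
      (LinearMap.llcomp (ZMod 2) P.CKh P.CKh P.CKh).compl₁₂ P.dgAct P.dgAct +
      ((LinearMap.llcomp (ZMod 2) P.CKh P.CKh P.CKh).compl₁₂ P.dgAct P.dgAct).flip :=
    bilinear_ext (W := P.CKh →ₗ[ZMod 2] P.CKh) fun b b' => by
      refine (congrArg P.dgAct (SlDg.bracket_single b b')).trans ((key b b').trans ?_)
      change _ = P.dgAct (.single b 1) * P.dgAct (.single b' 1) +
        P.dgAct (.single b' 1) * P.dgAct (.single b 1)
      rw [dgAct, Finsupp.linearCombination_single, Finsupp.linearCombination_single, one_smul,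
        one_smul]
  exact congrArg (fun f => f y z) this

end AnnularDiagram

/-! ### The modules -/

namespace AnnularDiagram

variable {P : AnnularDiagram}

theorem homDeg_eq_of_fst_eq {g g' : P.Gen} (h : g'.1 = g.1) : homDeg g' = homDeg g := by
  rw [homDeg, homDeg, h]

theorem homDeg_of_edgeCoeff_ne_zero {μ δ : Bool → Bool → Bool → ZMod 2} {c : P.Crossing}
    {g g' : P.Gen} (h : edgeCoeff μ δ c g g' ≠ 0) : homDeg g' = homDeg g + 1 := by
  classical
  have H := (ite_ne_right_iff.1 h).1
  have key : (Finset.univ.filter fun x : P.Crossing => g'.1 x = true) =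
      insert c (Finset.univ.filter fun x : P.Crossing => g.1 x = true) := by
    ext x
    rw [H.2.1]
    by_cases hx : x = c
    · subst hx; simp
    · simp [hx]
  have hc : c ∉ Finset.univ.filter fun x : P.Crossing => g.1 x = true := by simp [H.1]
  rw [homDeg, homDeg, Nat.card_eq_fintype_card, Nat.card_eq_fintype_card, Fintype.card_subtype,
    Fintype.card_subtype, key, Finset.card_insert_of_notMem hc]
  push_cast
  ring

/-- A linear map is homogeneous if its matrix entries are. -/
theorem map_mem_grading {T : P.CKh →ₗ[ZMod 2] P.CKh} {n : ℤ}
    (h : ∀ g g', T (.single g 1) g' ≠ 0 → homDeg g' = n + homDeg g) (a : ℤ) (m : P.CKh)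
    (hm : m ∈ P.grading a) : T m ∈ P.grading (n + a) :=
  map_mem_of_gradedPiece (deg := homDeg) (n := a) (U := P.grading (n + a)) T
    (fun g hg => (Finsupp.mem_supported _ _).2 fun g' hg' =>
      (h g g' (Finsupp.mem_support_iff.1 hg')).trans (by rw [hg])) hm

theorem cubeMap_mem_grading {μ δ : Bool → Bool → Bool → ZMod 2} {R : ℤ → ℤ → Prop}
    [DecidableRel R] (a : ℤ) (m : P.CKh) (hm : m ∈ P.grading a) :
    cubeMap μ δ R m ∈ P.grading (1 + a) :=
  map_mem_grading (fun g g' h => by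
    obtain ⟨-, c, hc⟩ := exists_of_cubeMap_ne_zero h
    rw [homDeg_of_edgeCoeff_ne_zero hc, add_comm]) a m hm

theorem eAct_mem_grading (a : ℤ) (m : P.CKh) (hm : m ∈ P.grading a) :
    P.eAct m ∈ P.grading (0 + a) :=
  map_mem_grading (fun g g' h => by
    rw [eAct, Finsupp.linearCombination_single, one_smul, Finsupp.finsetSum_apply] at h
    obtain ⟨C, -, hC⟩ := Finset.exists_ne_zero_of_sum_ne_zero h
    split_ifs at hC
    · rw [(Finsupp.single_apply_ne_zero.1 hC).1, zero_add]
      exact homDeg_eq_of_fst_eq rfl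
    · exact absurd Finsupp.zero_apply hC) a m hm

theorem fAct_mem_grading (a : ℤ) (m : P.CKh) (hm : m ∈ P.grading a) :
    P.fAct m ∈ P.grading (0 + a) :=
  map_mem_grading (fun g g' h => by
    rw [fAct, Finsupp.linearCombination_single, one_smul, Finsupp.finsetSum_apply] at h
    obtain ⟨C, -, hC⟩ := Finset.exists_ne_zero_of_sum_ne_zero h
    split_ifs at hC
    · rw [(Finsupp.single_apply_ne_zero.1 hC).1, zero_add]
      exact homDeg_eq_of_fst_eq rfl
    · exact absurd Finsupp.zero_apply hC) a m hm

theorem dMinus_mem_grading (a : ℤ) (m : P.CKh) (hm : m ∈ P.grading a) :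
    P.dMinus m ∈ P.grading (1 + a) :=
  cubeMap_mem_grading a m hm

theorem leePlus_mem_grading (a : ℤ) (m : P.CKh) (hm : m ∈ P.grading a) :
    P.leePlus m ∈ P.grading (1 + a) :=
  cubeMap_mem_grading a m hm

theorem dZero_mem_grading (a : ℤ) (m : P.CKh) (hm : m ∈ P.grading a) :
    P.dZero m ∈ P.grading (1 + a) :=
  cubeMap_mem_grading a m hm

theorem leeZero_mem_grading (a : ℤ) (m : P.CKh) (hm : m ∈ P.grading a) :
    P.leeZero m ∈ P.grading (1 + a) :=
  cubeMap_mem_grading a m hm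

theorem basisAct_mem_grading (b : DgBasis) (a : ℤ) (m : P.CKh) (hm : m ∈ P.grading a) :
    P.basisAct b m ∈ P.grading (b.deg + a) := by
  cases b
  · exact eAct_mem_grading a m hm
  · exact fAct_mem_grading a m hm
  · rw [basisAct, hAct_eq, LinearMap.smul_apply, LinearMap.id_apply, DgBasis.deg, zero_add]
    exact Submodule.smul_mem _ _ hm
  · exact leePlus_mem_grading a m hm
  · exact dMinus_mem_grading a m hm
  · have h1 := eAct_mem_grading _ _ (dMinus_mem_grading a m hm)
    have h2 := dMinus_mem_grading _ _ (eAct_mem_grading a m hm)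
    rw [zero_add] at h1 h2
    rw [basisAct_v0, DgBasis.deg, LinearMap.add_apply, LinearMap.comp_apply, LinearMap.comp_apply]
    exact Submodule.add_mem _ h1 h2
  · exact dZero_mem_grading a m hm
  · exact leeZero_mem_grading a m hm
  · have h1 := leePlus_mem_grading _ _ (dMinus_mem_grading a m hm)
    have h2 := dMinus_mem_grading _ _ (leePlus_mem_grading a m hm)
    rw [← add_assoc, one_add_one_eq_two] at h1 h2
    rw [basisAct, DgBasis.deg, LinearMap.add_apply, LinearMap.comp_apply, LinearMap.comp_apply]
    exact Submodule.add_mem _ h1 h2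

theorem dgAct_single (b : DgBasis) : P.dgAct (.single b 1) = P.basisAct b :=
  (Finsupp.linearCombination_single _ _ _).trans (one_smul _ _)

theorem dgAct_mem_grading (a c : ℤ) (y : SlDg) (hy : y ∈ SlDg.grading a) (m : P.CKh)
    (hm : m ∈ P.grading c) : P.dgAct y m ∈ P.grading (a + c) :=
  map_mem_of_gradedPiece (P.dgAct.flip m) (fun b hb => by
    rw [LinearMap.flip_apply, dgAct_single, ← hb]
    exact basisAct_mem_grading b c m hm) hy

theorem dgAct_bracket_apply (y z : SlDg) (m : P.CKh) : P.dgAct (SlDg.bracket y z) m =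
    P.dgAct y (P.dgAct z m) + P.dgAct z (P.dgAct y m) :=
  LinearMap.congr_fun (dgAct_bracket y z) m

theorem dgAct_comm_of_bracket_eq_zero {y z : SlDg} (h : SlDg.bracket y z = 0) (m : P.CKh) :
    P.dgAct y (P.dgAct z m) = P.dgAct z (P.dgAct y m) := by
  have := dgAct_bracket_apply y z m
  rw [h, map_zero, LinearMap.zero_apply] at this
  rw [eq_neg_of_add_eq_zero_left this.symm, ZModModule.neg_eq_self]

theorem dgAct_diff (y : SlDg) (m : P.CKh) :
    P.dgAct (SlDg.diff y) m = P.dZero (P.dgAct y m) + P.dgAct y (P.dZero m) := by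
  rw [SlDg.diff, dgAct_bracket_apply, dgAct_single]
  rfl

theorem dZero_dZero (m : P.CKh) : P.dZero (P.dZero m) = 0 :=
  LinearMap.congr_fun (relations_of_totalMap_totalMap P).1.1 m

theorem isModule_dgOps : LInf.IsModule SlDg.grading SlDg.ops P.grading P.dgOps :=
  SlDg.isDgOps.isModule (δ := P.dZero) (α := P.dgAct) (κ := 0)
    (κ' := fun n y => match n, y with
      | 1, y => P.dgAct (y 0)
      | _, _ => 0)
    { one := fun _ => rfl
      two := fun _ => rfl
      other := fun n _ h1 _ => by
        match n, h1 with
        | 0, _ => rfl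
        | n + 2, _ => rfl }
    (fun _ _ => rfl)
    (fun n x m hn => by
      match n, hn with
      | 1, _ => rfl
      | n + 2, _ => rfl)
    (gradedPiece_isInternal _)
    (fun c m hm => add_comm 1 c ▸ dZero_mem_grading c m hm)
    (fun a c y hy m hm => dgAct_mem_grading a c y hy m hm) (fun _ _ _ _ _ _ _ _ _ => zero_mem _)
    (fun _ _ => rfl) (fun _ _ _ => rfl) dZero_dZero
    (fun x m => by rw [dgAct_diff, add_comm (P.dZero _), ZModModule.add_self])
    (fun x y m => by simp [dgAct_bracket_apply, ZModModule.add_self])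
    (fun _ _ _ _ => by simp) (fun _ _ _ _ _ => rfl)

theorem wedgeOps_zero (y : Fin 0 → SlWedge) (m : P.CKh) : P.wedgeOps 0 y m = P.dZero m := by
  simp [wedgeOps, homologyOps, LInf.restrictScalars, LInf.setPartitions, dgOps,
    Function.Surjective]

/-- In the restriction of scalars only the set partition into one block contributes, as the module
over `sl₂(∧)_dg` has no operations with several inputs from the Lie superalgebra. -/
theorem wedgeOps_eq (n : ℕ) (y : Fin n → SlWedge) (m : P.CKh) (hn : n ≠ 0) :
    P.wedgeOps n y m = P.dgAct (SlDg.homologyI n (SlWedge.toH ∘ y)) m := by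
  rw [wedgeOps, homologyOps, LInf.restrictScalars, Finset.sum_eq_single 1]
  · rw [LInf.setPartitions_one hn, Finset.sum_singleton]
    exact congrArg (P.dgAct · m) (LInf.apply_block_const SlDg.homologyI (SlWedge.toH ∘ y))
  · intro r _ hr
    match r, hr with
    | 0, _ => rw [LInf.setPartitions_zero_right hn, Finset.sum_empty]
    | r + 2, _ => exact Finset.sum_eq_zero fun _ _ => rfl
  · intro h
    exact absurd (Finset.mem_range.2 (by omega)) h

theorem isModule_wedgeOps : LInf.IsModule SlWedge.grading SlWedge.ops P.grading P.wedgeOps :=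
  SlWedge.isDgOps.isModule (δ := P.dZero) (α := P.dgAct ∘ₗ SlDg.ofWedge)
    (κ := SlDg.ofWedgeTwo.compr₂ P.dgAct)
    (κ' := fun n y => P.dgAct (SlDg.homologyI n (SlWedge.toH ∘ y)))
    { one := fun x => congrArg P.dgAct (SlDg.isDgOps_homologyI.one x)
      two := fun x => congrArg P.dgAct (SlDg.isDgOps_homologyI.two x)
      other := fun n x h1 h2 =>
        (congrArg P.dgAct (SlDg.isDgOps_homologyI.other n x h1 h2)).trans (map_zero _) }
    wedgeOps_zero wedgeOps_eq (gradedPiece_isInternal _)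
    (fun c m hm => add_comm 1 c ▸ dZero_mem_grading c m hm)
    (fun a c y hy m hm => dgAct_mem_grading a c _ (SlDg.ofWedge_mem a y hy) m hm)
    (fun a a' c y hy z hz m hm => by
      rw [← sub_add_eq_add_sub]
      exact dgAct_mem_grading _ c _ (SlDg.ofWedgeTwo_mem a a' y hy z hz) m hm)
    (fun x y => congrArg P.dgAct (SlDg.ofWedgeTwo_comm x y))
    (fun x y z => (congrArg P.dgAct (SlDg.ofWedgeTwo_bracket x y z)).trans (map_zero _))
    dZero_dZero
    (fun x m => by
      have := dgAct_diff (SlDg.ofWedge x) m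
      rw [SlDg.diff_ofWedge, map_zero, LinearMap.zero_apply] at this
      simp only [LinearMap.comp_apply, LinearMap.zero_apply, map_zero, zero_add]
      rw [add_comm, ← this])
    (fun x y m => by
      have := LinearMap.congr_fun (congrArg P.dgAct (SlDg.ofWedge_bracket x y)) m
      rw [map_add, map_add, LinearMap.add_apply, LinearMap.add_apply, dgAct_diff,
        dgAct_bracket_apply, map_zero, LinearMap.zero_apply] at this
      simp only [LinearMap.comp_apply, LinearMap.zero_apply, map_zero, add_zero,
        LinearMap.compr₂_apply]
      rw [add_comm (P.dgAct _ (P.dZero m)), this])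
    (fun x y z m => dgAct_comm_of_bracket_eq_zero
      (SlDg.bracket_ofWedge_of_mem x _ (SlDg.homotopy_mem _)) m)
    (fun x y z w m => dgAct_comm_of_bracket_eq_zero
      (SlDg.bracket_of_mem_of_mem _ _ (SlDg.homotopy_mem _) (SlDg.homotopy_mem _)) m)

theorem wedgeOps_two_v2_vm2 (m : P.CKh) :
    P.wedgeOps 2 ![.single .v2 1, .single .vm2 1] m = P.leeZero m := by
  rw [wedgeOps_eq _ _ _ two_ne_zero]
  have h : SlDg.homologyI 2 (SlWedge.toH ∘ ![.single .v2 1, .single .vm2 1]) =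
      SlDg.ofWedgeTwo (.single .v2 1) (.single .vm2 1) := SlDg.isDgOps_homologyI.two _
  have h' : SlDg.ofWedgeTwo (.single .v2 1) (.single .vm2 1) = .single .D 1 := by
    rw [SlDg.ofWedgeTwo_apply]
    simp [SlDg.ofWedge, SlDg.incl, SlWedge.toH, SlDg.bracket_single, DgBasis.table, SlDg.homotopy]
  rw [h, h', dgAct_single]
  rfl

end AnnularDiagram

theorem mainTheorem5 (P : AnnularDiagram) :
    -- the strict `sl₂(∧)_dg`-action on the annular Khovanov complex
    LInf.IsAlgebra SlDg.grading SlDg.ops ∧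
    LInf.IsModule SlDg.grading SlDg.ops P.grading P.dgOps ∧
    -- the contraction, and the `L∞`-algebra `sl₂(∧)` inside the transferred structure
    LInf.IsContraction SlDg.grading SlDg.diff SlH.grading 0
      SlDg.incl SlDg.proj SlDg.homotopy ∧
    LInf.IsAlgebra SlWedge.grading SlWedge.ops ∧
    (∀ n (y : Fin n → SlWedge),
      SlDg.homologyOps n (SlWedge.toH ∘ y) = SlWedge.toH (SlWedge.ops n y)) ∧
    LInf.IsHom SlWedge.grading SlWedge.ops SlDg.grading SlDg.ops
      (fun n y => SlDg.homologyI n (SlWedge.toH ∘ y)) ∧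
    -- the restricted structure is an `L∞`-module over `sl₂(∧)`
    LInf.IsModule SlWedge.grading SlWedge.ops P.grading P.wedgeOps ∧
    -- its operation `k_3`, and the nontriviality of the higher operations
    (∀ m : P.CKh, P.wedgeOps 2 ![.single .v2 1, .single .vm2 1] m = P.leeZero m) ∧
    (P.leeZero ≠ 0 → ∃ n, 2 ≤ n ∧ ∃ (y : Fin n → SlWedge) (m : P.CKh), P.wedgeOps n y m ≠ 0) := by
  refine ⟨SlDg.isAlgebra, AnnularDiagram.isModule_dgOps, SlDg.isContraction, SlWedge.isAlgebra,
    SlDg.homologyOps_toH, SlDg.isHom, AnnularDiagram.isModule_wedgeOps,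
    AnnularDiagram.wedgeOps_two_v2_vm2, fun h => ?_⟩
  obtain ⟨m, hm⟩ : ∃ m, P.leeZero m ≠ 0 := by
    by_contra! H
    exact h (LinearMap.ext H)
  exact ⟨2, le_rfl, ![.single .v2 1, .single .vm2 1], m, by
    rwa [AnnularDiagram.wedgeOps_two_v2_vm2]⟩
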